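/- Let $F$ be a matching of size $k$ in a (simple, not necessarily finite) graph $G$. Paths are identified with their edge sets. An $F$-AAP (augmenting $F$-alternating path) is a simple path in $G$ with at least one edge such that exactly one of any two consecutive edges belongs to $F$ and neither endpoint is covered by $F$. Let $\mathcal{P}=(P_i)_{i\in I}$ be a family of $F$-AAPs (repetitions allowed). A set of edges is $\mathcal{P}$-rainbow if it is the image of a partial choice function of $\mathcal{P}$, i.e. it is $\{x_i : i\in J\}$ for some $J\subseteq I$ and some $x_i\in P_i$ ($i\in J$); an $F$-AAP is $\mathcal{P}$-rainbow if the set of its edges not in $F$ is $\mathcal{P}$-rainbow. For $m\ge 1$, an $m$-origamistrip with endpoints $x,y$ consists of distinct vertices $u_1,\dots,u_m,v_1,\dots,v_m,x,y$, where the $u_i,v_i$ are called the interior vertices, together with its skeleton $\{u_1v_1,\dots,u_mv_m\}$ and the two paths $P^A=x\,u_1v_1\,u_2v_2\cdots u_mv_m\,y$ and $P^B=x\,v_1u_1\,v_2u_2\cdots v_mu_m\,y$. A badge is a collection of paths obtained from a finite loopless multigraph $H$ (parallel edges allowed) and a weighting $w$ of its edges by positive integers as follows: for each edge $e=xy$ of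 $H$ take a $w(e)$-origamistrip $OS(e)$ with endpoints $x,y$, such that the sets of interior vertices of the $OS(e)$ are pairwise disjoint and disjoint from the vertex set of $H$; the badge is the multiset of all paths $P^A(OS(e))$, $P^B(OS(e))$, each repeated $w(e)$ times. It is a $k$-badge if $\sum_e w(e)=k$, and its skeleton is the union of the skeletons of the $OS(e)$. **Theorem.** Suppose that there is no $\mathcal{P}$-rainbow $F$-AAP. Then 1. $|\mathcal{P}|\le 2k$, and 2. if $|\mathcal{P}|=2k$, then $\mathcal{P}$ is, as a multiset, a $k$-badge with skeleton $F$. -/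

import Mathlib

namespace RainbowBadge

/-- `R` is an `S`-rainbow set: the image of a partial choice function of the family `S`. -/
def IsRainbowSet {α ι : Type*} (S : ι → Set α) (R : Set α) : Prop :=
  ∃ (I : Set ι) (x : I → α), (∀ i : I, x i ∈ S i) ∧ Set.range x = R

/-- `p` is `F`-alternating: every other edge of `p` belongs to `F`, that is, of any two consecutive
edges exactly one belongs to `F`. -/
def IsAlternating {V : Type*} {G : SimpleGraph V} (F : G.Subgraph) {a b : V} (p : G.Walk a b) :
    Prop :=
  p.edges.IsChain fun e f => (e ∈ F.edgeSet ↔ f ∉ F.edgeSet)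

/-- `S` is (the edge set of) an `F`-AAP, an augmenting `F`-alternating path: a simple path with at
least one edge that is `F`-alternating and both of whose endpoints are not covered by the
matching `F`. -/
def IsAAP {V : Type*} {G : SimpleGraph V} (F : G.Subgraph) (S : Set (Sym2 V)) : Prop :=
  ∃ (a b : V) (p : G.Walk a b), p.IsPath ∧ 0 < p.length ∧ IsAlternating F p ∧
    a ∉ F.verts ∧ b ∉ F.verts ∧ S = {e | e ∈ p.edges}

/-- `S` is a `P`-rainbow `F`-AAP: an `F`-AAP whose edges outside `F` form a `P`-rainbow set. -/
def IsRainbowAAP {V ι : Type*} {G : SimpleGraph V} (F : G.Subgraph) (P : ι → Set (Sym2 V))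
    (S : Set (Sym2 V)) : Prop :=
  IsAAP F S ∧ IsRainbowSet P (S \ F.edgeSet)

/-- An `m`-origamistrip on distinct vertices `u₁, …, uₘ, v₁, …, vₘ, x, y` of `V`
(here indexed from `0` to `m - 1`). -/
structure Origamistrip (V : Type*) (m : ℕ) where
  u : Fin m → V
  v : Fin m → V
  x : V
  y : V
  u_injective : Function.Injective u
  v_injective : Function.Injective v
  u_ne_v : ∀ i j, u i ≠ v j
  x_ne_y : x ≠ y
  x_ne_u : ∀ i, x ≠ u i
  x_ne_v : ∀ i, x ≠ v i
  y_ne_u : ∀ i, y ≠ u i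
  y_ne_v : ∀ i, y ≠ v i

namespace Origamistrip

variable {V : Type*} {m : ℕ}

/-- The interior vertices `u₁, v₁, …, uₘ, vₘ`. -/
def interior (O : Origamistrip V m) : Set V := Set.range O.u ∪ Set.range O.v

/-- The skeleton `{u₁v₁, …, uₘvₘ}`. -/
def skeleton (O : Origamistrip V m) : Set (Sym2 V) := {e | ∃ i : Fin m, e = s(O.u i, O.v i)}

/-- The matching `{x u₁, v₁ u₂, v₂ u₃, …, vₘ₋₁ uₘ, vₘ y}`. -/
def matchingA (O : Origamistrip V m) : Set (Sym2 V) :=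
  {e | (∃ i : Fin m, (i : ℕ) = 0 ∧ e = s(O.x, O.u i)) ∨
    (∃ i j : Fin m, (j : ℕ) = i + 1 ∧ e = s(O.v i, O.u j)) ∨
    (∃ i : Fin m, (i : ℕ) + 1 = m ∧ e = s(O.v i, O.y))}

/-- The matching `{x v₁, u₁ v₂, u₂ v₃, …, uₘ₋₁ vₘ, uₘ y}`. -/
def matchingB (O : Origamistrip V m) : Set (Sym2 V) :=
  {e | (∃ i : Fin m, (i : ℕ) = 0 ∧ e = s(O.x, O.v i)) ∨
    (∃ i j : Fin m, (j : ℕ) = i + 1 ∧ e = s(O.u i, O.v j)) ∨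
    (∃ i : Fin m, (i : ℕ) + 1 = m ∧ e = s(O.u i, O.y))}

/-- The path `x u₁ v₁ u₂ v₂ … uₘ vₘ y`, as a set of edges. -/
def pathA (O : Origamistrip V m) : Set (Sym2 V) := O.matchingA ∪ O.skeleton

/-- The path `x v₁ u₁ v₂ u₂ … vₘ uₘ y`, as a set of edges. -/
def pathB (O : Origamistrip V m) : Set (Sym2 V) := O.matchingB ∪ O.skeleton

end Origamistrip

/-- The data of a badge: a finite loopless multigraph `H` with a positive integer weighting `w` of
its edge set `E`, and for each edge `e` of `H` a `w e`-origamistrip whose endpoints are the ends of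
`e`; the interiors of the strips are disjoint from each other and contain no vertex of `H`.
The multigraph is recorded through its edge type `E` and the ends `(strip e).x`, `(strip e).y` of
each edge; parallel edges are allowed, and isolated vertices of `H` would play no role. -/
structure Badge (V : Type*) where
  E : Type
  fintypeE : Fintype E
  w : E → ℕ
  w_pos : ∀ e, 0 < w e
  strip : (e : E) → Origamistrip V (w e)
  interior_disjoint : ∀ e e', e ≠ e' → Disjoint (strip e).interior (strip e').interior
  x_notMem_interior : ∀ e e', (strip e).x ∉ (strip e').interior
  y_notMem_interior : ∀ e e', (strip e).y ∉ (strip e').interior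

namespace Badge

variable {V : Type*}

/-- The total weight `∑ e, w e`; a badge `B` is a `k`-badge for `k = B.weight`. -/
def weight (B : Badge V) : ℕ := Finset.sum (@Finset.univ B.E B.fintypeE) B.w

/-- The skeleton of a badge, the union of the skeletons of its strips. -/
def skeleton (B : Badge V) : Set (Sym2 V) := ⋃ e, (B.strip e).skeleton

/-- The index set of the collection of paths of a badge: for each edge `e` of `H`, the `A`-path
(`true`) and the `B`-path (`false`) of the strip of `e`, each repeated `w e` times. -/
abbrev Index (B : Badge V) : Type := Σ e : B.E, Bool × Fin (B.w e)

/-- The collection of paths of a badge, as an indexed family. -/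
def path (B : Badge V) (j : B.Index) : Set (Sym2 V) :=
  if j.2.1 = true then (B.strip j.1).pathA else (B.strip j.1).pathB

end Badge

/-- The family `P` is a `k`-badge with skeleton `M`: up to reindexing, that is, as a multiset, it is
the collection of paths of a badge of total weight `k` with skeleton `M`. -/
def IsBadge {V ι : Type*} (k : ℕ) (M : Set (Sym2 V)) (P : ι → Set (Sym2 V)) : Prop :=
  ∃ B : Badge V, B.weight = k ∧ B.skeleton = M ∧
    ∃ σ : ι ≃ B.Index, ∀ i, P i = B.path (σ i)

end RainbowBadge

/-!
The matching is encoded as an involution `m` exchanging the ends of its edges, so the covered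
vertices are those moved by `m`, and there are `2 * k` of them. An alternating path is encoded by
the list of every other vertex on it, and is mostly handled through its edges outside the matching.

*The bound.* For an edge set `E` let `outer m E` be the set of vertices reached from uncovered
vertices by alternating paths of even length. If `E` has no augmenting path, then, as in the
Gallai–Edmonds theorem, `outer m E` is partitioned into blossoms in a way that certifies the absence
of augmenting paths (`Cert`, `exists_cert`), and the partition is determined by `E` on its outer
set. Hence if each edge of an augmenting path `C` could be added to `E` without creating an
augmenting path or a new outer vertex, then the certificate of `E` would also be one for `C`, which
is absurd. So some edge of `C` makes progress (`exists_edge_outer_ssubset`). Choosing such an edge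
from each path in turn, in the absence of rainbow augmenting paths every colour contributes a new
outer covered vertex, and there are at most `2 * k` colours (`NoRainbow.card_le`).

*Equality.* With `2 * k` colours the greedy process is tight from any start: no partial choice has
more outer covered vertices than colours. A blossom with `t` matching edges makes `2 * t` covered
vertices outer using at most `t + 1` colours, so rainbow blossoms are triangles; and the first edge
`s(a, p)` of any path does lie in a rainbow blossom. This gives a triangle on `a`, `p`, `m p` with
sides of two colours `i` and `j` (`NoRainbow.exists_triangle`). Contract it and drop both colours:
rainbow augmenting paths lift, every other path contains an augmenting path of the contraction, and
by induction these form a badge. Enough copies of each path of this badge are available to rule out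
any further edge between a strip and an uncovered vertex (`NoRainbow.not_edge_to_free`), so each
path of the original family either equals its contraction or arises by inserting the triangle at one
end (`TriangleContraction.classify_aux`). In a badge a path occurs as often as its companion, so all
colours with the same side of the triangle have the same contraction
(`TriangleContraction.eq_of_same_side`). Therefore either the triangle lengthens one strip of the
badge by one (`TriangleContraction.isBadgeFamily_of_side`), or the paths of `i` and `j` form a new
strip of weight one (`TriangleContraction.isBadgeFamily_of_no_side`).

This is carried out for the combinatorial notion `IsBadgeFamily`; the last parts translate between
lists and walks, and build the strips.
-/

namespace RainbowBadge

/-! ### Alternating paths as lists -/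

/-- The edges outside the matching of an alternating path.  The matching is the fixed-point-free
part of an involution `m`, and the path is the list of its vertices at even distance from the start,
most recent first: from `x` the path uses the edge `s(x, m y)` and then the matching edge
`s(m y, y)`. -/
def altEdges {V : Type*} (m : V → V) : List V → Set (Sym2 V)
  | y :: x :: l => insert s(x, m y) (altEdges m (x :: l))
  | _ => ∅

/-- The path encoded by `l` visits no vertex twice. -/
def Simple {V : Type*} (m : V → V) (l : List V) : Prop :=
  l.Pairwise fun y x => x ≠ y ∧ x ≠ m y

/-- The path encoded by `l` starts at a vertex not covered by the matching. -/
def Rooted {V : Type*} (m : V → V) (l : List V) : Prop :=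
  ∃ l' a, l = l' ++ [a] ∧ m a = a

/-- The vertices reached from an uncovered vertex by an alternating path of even length whose
non-matching edges lie in `E`. -/
def outer {V : Type*} (m : V → V) (E : Set (Sym2 V)) : Set V :=
  {v | ∃ l, Simple m (v :: l) ∧ Rooted m (v :: l) ∧ altEdges m (v :: l) ⊆ E}

/-- The list `L` encodes an augmenting alternating path: its ends are uncovered, and all its other
vertices are covered. -/
def IsAug {V : Type*} (m : V → V) (L : List V) : Prop :=
  Simple m L ∧ ∃ b l c, L = b :: (l ++ [c]) ∧ m b = b ∧ m c = c ∧ ∀ v ∈ l, m v ≠ v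

/-- Some augmenting alternating path has all its non-matching edges in `E`. -/
def HasAug {V : Type*} (m : V → V) (E : Set (Sym2 V)) : Prop :=
  ∃ L, IsAug m L ∧ altEdges m L ⊆ E

section Lists

variable {V : Type*} {m : V → V} {E : Set (Sym2 V)}

@[simp] lemma altEdges_nil : altEdges m [] = ∅ := rfl

@[simp] lemma altEdges_singleton (x : V) : altEdges m [x] = ∅ := rfl

@[simp] lemma altEdges_cons_cons (x y : V) (l : List V) :
    altEdges m (y :: x :: l) = insert s(x, m y) (altEdges m (x :: l)) := rfl

lemma altEdges_append (l₁ l₂ : List V) (x : V) :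
    altEdges m (l₁ ++ x :: l₂) = altEdges m (l₁ ++ [x]) ∪ altEdges m (x :: l₂) := by
  induction l₁ with
  | nil => simp
  | cons y l₁ ih =>
    cases l₁ with
    | nil => simp
    | cons z l₁ =>
      simp only [List.cons_append, altEdges_cons_cons] at ih ⊢
      rw [ih, Set.insert_union]

lemma altEdges_subset_append_right (l₁ l₂ : List V) :
    altEdges m l₂ ⊆ altEdges m (l₁ ++ l₂) := by
  cases l₂ with
  | nil => simp
  | cons x l₂ => rw [altEdges_append]; exact Set.subset_union_right

lemma altEdges_subset_append_left (l₁ l₂ : List V) :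
    altEdges m l₁ ⊆ altEdges m (l₁ ++ l₂) := by
  rcases List.eq_nil_or_concat l₁ with rfl | ⟨l, x, rfl⟩
  · simp
  · rw [List.concat_eq_append, List.append_assoc, List.singleton_append, altEdges_append _ l₂]
    exact Set.subset_union_left

lemma altEdges_map (l : List V) :
    altEdges m (l.map m) = Sym2.map m '' altEdges m l := by
  induction l with
  | nil => simp
  | cons y l ih =>
    cases l with
    | nil => simp
    | cons x l =>
      simp only [List.map_cons, altEdges_cons_cons] at ih ⊢
      rw [ih, Set.image_insert_eq, Sym2.map_mk]

/-- Traversing a path backwards. -/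
lemma altEdges_reverse (hm : Function.Involutive m) (l : List V) :
    altEdges m (l.map m).reverse = altEdges m l := by
  induction l with
  | nil => simp
  | cons y l ih =>
    cases l with
    | nil => simp
    | cons x l =>
      simp only [List.map_cons, List.reverse_cons, altEdges_cons_cons, List.append_assoc,
        List.singleton_append] at ih ⊢
      rw [altEdges_append, ih]
      simp only [altEdges_cons_cons, altEdges_singleton, hm x]
      rw [Set.union_comm, Sym2.eq_swap, Set.insert_union, Set.empty_union]

lemma finite_altEdges (l : List V) : (altEdges m l).Finite := by
  induction l with
  | nil => simp
  | cons y l ih =>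
    cases l with
    | nil => simp
    | cons x l => exact ih.insert _

lemma exists_mem_of_mem_altEdges {l : List V} {e : Sym2 V} (he : e ∈ altEdges m l) :
    ∃ x y, x ∈ l ∧ y ∈ l ∧ e = s(x, m y) := by
  induction l with
  | nil => simp at he
  | cons y l ih =>
    cases l with
    | nil => simp at he
    | cons x l =>
      rcases he with rfl | he
      · exact ⟨x, y, by simp, by simp, rfl⟩
      · obtain ⟨u, v, hu, hv, rfl⟩ := ih he
        exact ⟨u, v, List.mem_cons_of_mem _ hu, List.mem_cons_of_mem _ hv, rfl⟩

lemma exists_altEdge_of_mem_tail {w z : V} {l : List V} (hz : z ∈ l) :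
    ∃ e ∈ altEdges m (w :: l), z ∈ e := by
  induction l generalizing w with
  | nil => simp at hz
  | cons x l ih =>
    rcases List.mem_cons.1 hz with rfl | hz
    · exact ⟨_, Set.mem_insert _ _, by simp⟩
    · obtain ⟨e, he, hze⟩ := ih hz
      exact ⟨e, Set.mem_insert_of_mem _ he, hze⟩

lemma simple_cons {y : V} {l : List V} :
    Simple m (y :: l) ↔ (∀ x ∈ l, x ≠ y ∧ x ≠ m y) ∧ Simple m l := List.pairwise_cons

lemma Simple.of_append_right {l₁ l₂ : List V} (h : Simple m (l₁ ++ l₂)) : Simple m l₂ :=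
  (List.pairwise_append.1 h).2.1

lemma Simple.of_append_left {l₁ l₂ : List V} (h : Simple m (l₁ ++ l₂)) : Simple m l₁ :=
  (List.pairwise_append.1 h).1

lemma Simple.reverse (hm : Function.Involutive m) {l : List V} (h : Simple m l) :
    Simple m (l.map m).reverse := by
  unfold Simple at *
  rw [List.pairwise_reverse, List.pairwise_map]
  refine h.imp fun {x y} hxy => ⟨fun h => hxy.1 (hm.injective h).symm, fun h => hxy.2 ?_⟩
  rw [hm] at h
  exact h.symm

lemma Simple.map (hm : Function.Involutive m) {l : List V} (h : Simple m l) :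
    Simple m (l.map m) := by
  unfold Simple at *
  rw [List.pairwise_map]
  exact h.imp fun {x y} hxy => ⟨fun h => hxy.1 (hm.injective h), fun h => hxy.2 (hm.injective h)⟩

lemma rooted_singleton {a : V} : Rooted m [a] ↔ m a = a := by
  constructor
  · rintro ⟨l, b, h, hb⟩
    cases l with
    | nil => simp at h; rwa [h]
    | cons => simp at h
  · intro h; exact ⟨[], a, rfl, h⟩

lemma rooted_cons_cons {x y : V} {l : List V} : Rooted m (y :: x :: l) ↔ Rooted m (x :: l) := by
  constructor
  · rintro ⟨l', a, h, ha⟩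
    cases l' with
    | nil => simp at h
    | cons z l' => exact ⟨l', a, by simpa using (List.cons.inj h).2, ha⟩
  · rintro ⟨l', a, h, ha⟩
    exact ⟨y :: l', a, by simp [h], ha⟩

lemma outer_mono {E' : Set (Sym2 V)} (h : E ⊆ E') : outer m E ⊆ outer m E' :=
  fun _ ⟨l, h₁, h₂, h₃⟩ => ⟨l, h₁, h₂, h₃.trans h⟩

lemma HasAug.mono {E' : Set (Sym2 V)} (h : E ⊆ E') (hE : HasAug m E) : HasAug m E' :=
  let ⟨L, h₁, h₂⟩ := hE; ⟨L, h₁, h₂.trans h⟩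

lemma free_mem_outer {a : V} (ha : m a = a) : a ∈ outer m E :=
  ⟨[], List.pairwise_singleton _ _, rooted_singleton.2 ha, by simp⟩

/-- A list with an element satisfying `p` splits at the first such element. -/
lemma exists_first {p : V → Prop} {l : List V} (h : ∃ v ∈ l, p v) :
    ∃ l₁ v l₂, l = l₁ ++ v :: l₂ ∧ p v ∧ ∀ w ∈ l₁, ¬ p w := by
  induction l with
  | nil => simp at h
  | cons x l ih =>
    by_cases hx : p x
    · exact ⟨[], x, l, rfl, hx, by simp⟩
    · obtain ⟨v, hv, hpv⟩ := h
      rcases List.mem_cons.1 hv with rfl | hv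
      · exact absurd hpv hx
      obtain ⟨l₁, w, l₂, rfl, hw, h₁⟩ := ih ⟨v, hv, hpv⟩
      refine ⟨x :: l₁, w, l₂, rfl, hw, ?_⟩
      simpa [hx] using h₁

/-- A simple path between distinct uncovered vertices contains an augmenting path. -/
lemma hasAug_of_rooted {b x : V} {l : List V} (hb : m b = b) (hs : Simple m (b :: x :: l))
    (hr : Rooted m (b :: x :: l)) (hE : altEdges m (b :: x :: l) ⊆ E) : HasAug m E := by
  obtain ⟨l', a, hl, ha⟩ := rooted_cons_cons.1 hr
  obtain ⟨l₁, c, l₂, h, hc, h₁⟩ := exists_first (p := fun v => m v = v) (l := x :: l)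
    ⟨a, by simp [hl], ha⟩
  have heq : b :: x :: l = (b :: (l₁ ++ [c])) ++ l₂ := by simp [h]
  rw [heq] at hs hE
  exact ⟨_, ⟨hs.of_append_left, b, l₁, c, rfl, hb, hc, h₁⟩,
    (altEdges_subset_append_left _ _).trans hE⟩

lemma IsAug.rooted {L : List V} (h : IsAug m L) : Rooted m L := by
  obtain ⟨-, b, l, c, rfl, -, hc, -⟩ := h
  exact ⟨b :: l, c, rfl, hc⟩

lemma IsAug.reverse (hm : Function.Involutive m) {L : List V} (h : IsAug m L) :
    IsAug m (L.map m).reverse := by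
  obtain ⟨hs, b, l, c, rfl, hb, hc, hl⟩ := h
  refine ⟨hs.reverse hm, c, (l.map m).reverse, b, by simp [hb, hc], hc, hb, ?_⟩
  intro v hv hvv
  rw [List.mem_reverse, List.mem_map] at hv
  obtain ⟨w, hw, rfl⟩ := hv
  exact hl w hw (hm.injective hvv)

lemma IsAug.map (hm : Function.Involutive m) {L : List V} (h : IsAug m L) :
    IsAug m (L.map m) := by
  obtain ⟨hs, b, l, c, rfl, hb, hc, hl⟩ := h
  refine ⟨hs.map hm, b, l.map m, c, by simp [hb, hc], hb, hc, ?_⟩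
  intro v hv hvv
  obtain ⟨w, hw, rfl⟩ := List.mem_map.1 hv
  exact hl w hw (hm.injective hvv)

end Lists

/-! ### Dual certificates -/

/-- A dual certificate for the edge set `E`: a set `O` of outer vertices partitioned into blossoms
by the map `β` sending each of them to the base of its blossom.  Uncovered vertices are bases, only
the base of a blossom may be matched outside of it, and an edge of `E` that leaves a blossom ends
in an inner vertex, that is, one outside `O` whose mate is in `O`. -/
structure Cert {V : Type*} (m : V → V) (E : Set (Sym2 V)) (O : Set V) (β : V → V) : Prop where
  free : ∀ a, m a = a → a ∈ O ∧ β a = a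
  mate : ∀ v ∈ O, v ≠ β v → m v ∈ O ∧ β (m v) = β v
  edge : ∀ x y, x ∈ O → s(x, y) ∈ E → (y ∈ O ∧ β y = β x) ∨ (y ∉ O ∧ m y ∈ O)

section Cert

variable {V : Type*} {m : V → V} {E : Set (Sym2 V)} {O : Set V} {β : V → V}

/-- Along a path from an uncovered vertex, each blossom is entered through its base. -/
lemma Cert.mem_of_path (hm : Function.Involutive m) (h : Cert m E O β) :
    ∀ (l : List V) (v : V), Simple m (v :: l) → Rooted m (v :: l) → altEdges m (v :: l) ⊆ E →
      v ∈ O ∧ β v ∈ v :: l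
  | [], v, _, hr, _ => by
    have := h.free v (rooted_singleton.1 hr)
    exact ⟨this.1, by simp [this.2]⟩
  | x :: l, v, hs, hr, hE => by
    rw [simple_cons] at hs
    rw [altEdges_cons_cons, Set.insert_subset_iff] at hE
    obtain ⟨hx, hβ⟩ := h.mem_of_path hm l x hs.2 (rooted_cons_cons.1 hr) hE.2
    rcases h.edge x (m v) hx hE.1 with ⟨h₁, h₂⟩ | ⟨h₁, h₂⟩
    · have hne : m v ≠ β (m v) := by
        rw [h₂]; exact (hs.1 _ hβ).2.symm
      have := h.mate _ h₁ hne
      rw [hm v] at this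
      exact ⟨this.1, by rw [this.2, h₂]; exact List.mem_cons_of_mem _ hβ⟩
    · rw [hm v] at h₂
      refine ⟨h₂, ?_⟩
      by_contra hne
      exact h₁ (h.mate v h₂ fun h => hne (by rw [← h]; simp)).1

lemma Cert.not_hasAug (hm : Function.Involutive m) (h : Cert m E O β) : ¬ HasAug m E := by
  rintro ⟨L, hL, hE⟩
  have hr := hL.rooted
  obtain ⟨hs, b, l, c, rfl, hb, hc, hl⟩ := hL
  obtain ⟨x, l', hx⟩ : ∃ x l', l ++ [c] = x :: l' := by
    cases l with
    | nil => exact ⟨_, _, rfl⟩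
    | cons x l => exact ⟨x, _, rfl⟩
  rw [hx] at hs hr hE
  rw [simple_cons] at hs
  rw [altEdges_cons_cons, Set.insert_subset_iff] at hE
  obtain ⟨hxO, hβ⟩ := h.mem_of_path hm l' x hs.2 (rooted_cons_cons.1 hr) hE.2
  have hbO := h.free b hb
  have := h.edge x (m b) hxO hE.1
  rw [hb] at this
  rcases this with ⟨-, h₂⟩ | ⟨h₁, -⟩
  · rw [hbO.2] at h₂
    exact (hs.1 _ hβ).1 h₂.symm
  · exact h₁ hbO.1

lemma Cert.outer_subset (hm : Function.Involutive m) (h : Cert m E O β) : outer m E ⊆ O :=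
  fun v ⟨l, h₁, h₂, h₃⟩ => (h.mem_of_path hm l v h₁ h₂ h₃).1

/-- The base of the blossom of `v` can be read off from any path reaching `v`. -/
lemma Cert.unique (hm : Function.Involutive m) {β' : V → V} (h : Cert m E O β)
    (h' : Cert m E O β') :
    ∀ (l : List V) (v : V), Simple m (v :: l) → Rooted m (v :: l) → altEdges m (v :: l) ⊆ E →
      β v = β' v
  | [], v, _, hr, _ => by
    rw [(h.free v (rooted_singleton.1 hr)).2, (h'.free v (rooted_singleton.1 hr)).2]
  | x :: l, v, hs, hr, hE => by
    have key : ∀ γ, Cert m E O γ → (m v ∈ O → γ v = γ x) ∧ (m v ∉ O → γ v = v) := by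
      intro γ hγ
      rw [simple_cons] at hs
      rw [altEdges_cons_cons, Set.insert_subset_iff] at hE
      obtain ⟨hx, hβ⟩ := hγ.mem_of_path hm l x hs.2 (rooted_cons_cons.1 hr) hE.2
      rcases hγ.edge x (m v) hx hE.1 with ⟨h₁, h₂⟩ | ⟨h₁, h₂⟩
      · have hne : m v ≠ γ (m v) := by
          rw [h₂]; exact (hs.1 _ hβ).2.symm
        have := hγ.mate _ h₁ hne
        rw [hm v] at this
        exact ⟨fun _ => by rw [this.2, h₂], fun h => absurd h₁ h⟩
      · refine ⟨fun h => absurd h h₁, fun _ => ?_⟩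
        rw [hm v] at h₂
        by_contra hne
        exact h₁ (hγ.mate v h₂ fun h => hne h.symm).1
    have ih := h.unique hm h' l x (simple_cons.1 hs).2 (rooted_cons_cons.1 hr)
      ((Set.subset_insert _ _).trans hE)
    by_cases hv : m v ∈ O
    · rw [(key β h).1 hv, (key β' h').1 hv, ih]
    · rw [(key β h).2 hv, (key β' h').2 hv]

end Cert

/-! ### Contraction of blossoms -/

/-- The matching left after contracting `B`; all vertices of `B` become uncovered, so those other than
the base remain as isolated uncovered vertices. -/
noncomputable def contractMate {V : Type*} (m : V → V) (B : Set V) (v : V) : V :=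
  open Classical in if v ∈ B then v else m v

/-- The map contracting `B` to its element `a`; the vertex type does not change. -/
noncomputable def contract {V : Type*} (B : Set V) (a v : V) : V :=
  open Classical in if v ∈ B then a else v

/-- `B` is the vertex set of a blossom with base the uncovered vertex `a`: it is closed under the
matching, `a` is its only uncovered vertex, and all its vertices are reached from `a` by alternating
paths of even length inside `B` with edges in `E`. -/
structure IsBlossom {V : Type*} (m : V → V) (E : Set (Sym2 V)) (B : Set V) (a : V) : Prop where
  mem : a ∈ B
  free : m a = a
  mate : ∀ v ∈ B, m v ∈ B
  eq_of_free : ∀ v ∈ B, m v = v → v = a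
  reach : ∀ g ∈ B, ∃ l, (∀ z ∈ g :: l, z ∈ B) ∧ Simple m (g :: l) ∧ Rooted m (g :: l) ∧
    altEdges m (g :: l) ⊆ E

section Contract

variable {V : Type*} {m : V → V} {E : Set (Sym2 V)} {B : Set V} {a : V}

lemma contractMate_of_mem {v : V} (h : v ∈ B) : contractMate m B v = v := if_pos h

lemma contractMate_of_notMem {v : V} (h : v ∉ B) : contractMate m B v = m v := if_neg h

lemma contract_of_mem {v : V} (h : v ∈ B) : contract B a v = a := if_pos h

lemma contract_of_notMem {v : V} (h : v ∉ B) : contract B a v = v := if_neg h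

lemma contractMate_involutive (hm : Function.Involutive m) (hB : ∀ v ∈ B, m v ∈ B) :
    Function.Involutive (contractMate m B) := by
  intro v
  by_cases h : v ∈ B
  · rw [contractMate_of_mem h, contractMate_of_mem h]
  · have : m v ∉ B := fun h' => h (by simpa [hm v] using hB _ h')
    rw [contractMate_of_notMem h, contractMate_of_notMem this, hm]

lemma contract_mem {v : V} (h : contract B a v ∈ B) : v ∈ B ∧ contract B a v = a := by
  by_cases hv : v ∈ B
  · exact ⟨hv, contract_of_mem hv⟩
  · rw [contract_of_notMem hv] at h; exact absurd h hv

lemma contract_notMem {v : V} (h : contract B a v ∉ B) (ha : a ∈ B) : v = contract B a v := by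
  by_cases hv : v ∈ B
  · rw [contract_of_mem hv] at h; exact absurd ha h
  · rw [contract_of_notMem hv]

lemma exists_of_mem_contract {x y : V} (h : s(x, y) ∈ Sym2.map (contract B a) '' E) :
    ∃ g h, s(g, h) ∈ E ∧ contract B a g = x ∧ contract B a h = y := by
  obtain ⟨e, he, heq⟩ := h
  induction e with
  | _ g h =>
    rw [Sym2.map_mk, Sym2.eq_iff] at heq
    rcases heq with ⟨h₁, h₂⟩ | ⟨h₁, h₂⟩
    · exact ⟨g, h, he, h₁, h₂⟩
    · exact ⟨h, g, by rwa [Sym2.eq_swap], h₂, h₁⟩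

/-- A path of the contracted graph that ends outside the blossom lifts: if it enters the blossom, its
initial part is replaced by a path inside the blossom from the base. -/
lemma IsBlossom.lift (hm : Function.Involutive m) (hB : IsBlossom m E B a) :
    ∀ (l : List V) (v : V), v ∉ B → Simple (contractMate m B) (v :: l) →
      Rooted (contractMate m B) (v :: l) →
      altEdges (contractMate m B) (v :: l) ⊆ Sym2.map (contract B a) '' E →
      ∃ l', Simple m (v :: l') ∧ Rooted m (v :: l') ∧ altEdges m (v :: l') ⊆ E ∧
        (∀ z ∈ l', z ∈ l ∨ z ∈ B) ∧ (l ≠ [] → l' ≠ [])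
  | [], v, hv, _, hr, _ => by
    refine ⟨[], List.pairwise_singleton _ _, ?_, by simp, by simp, by simp⟩
    rwa [rooted_singleton, contractMate_of_notMem hv, ← rooted_singleton] at hr
  | x :: l, v, hv, hs, hr, hE => by
    rw [simple_cons] at hs
    rw [rooted_cons_cons] at hr
    rw [altEdges_cons_cons, Set.insert_subset_iff, contractMate_of_notMem hv] at hE
    have hmv : m v ∉ B := fun h' => hv (by simpa [hm v] using hB.mate _ h')
    obtain ⟨g, h, hgh, hg, hh⟩ := exists_of_mem_contract hE.1
    obtain rfl : h = m v := (contract_notMem (by rwa [hh]) hB.mem).trans hh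
    by_cases hx : x ∈ B
    · have hgB := (contract_mem (hg ▸ hx)).1
      obtain ⟨lg, h₁, h₂, h₃, h₄⟩ := hB.reach g hgB
      refine ⟨g :: lg, simple_cons.2 ⟨fun z hz => ⟨?_, ?_⟩, h₂⟩, rooted_cons_cons.2 h₃, ?_,
        fun z hz => Or.inr (h₁ z hz), by simp⟩
      · rintro rfl; exact hv (h₁ _ hz)
      · rintro rfl; exact hmv (h₁ _ hz)
      · rw [altEdges_cons_cons, Set.insert_subset_iff]; exact ⟨hgh, h₄⟩
    · obtain rfl : g = x := (contract_notMem (by rwa [hg]) hB.mem).trans hg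
      obtain ⟨l', h₁, h₂, h₃, h₄, -⟩ := hB.lift hm l g hx hs.2 hr hE.2
      have h₅ : ∀ z ∈ g :: l', z ∈ g :: l ∨ z ∈ B := by
        intro z hz
        rcases List.mem_cons.1 hz with rfl | hz
        · simp
        · exact (h₄ z hz).imp_left (List.mem_cons_of_mem _)
      refine ⟨g :: l', simple_cons.2 ⟨fun z hz => ?_, h₁⟩, rooted_cons_cons.2 h₂, ?_, h₅, by simp⟩
      · rcases h₅ z hz with h | h
        · simpa [contractMate_of_notMem hv] using hs.1 z h
        · exact ⟨by rintro rfl; exact hv h, by rintro rfl; exact hmv h⟩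
      · rw [altEdges_cons_cons, Set.insert_subset_iff]; exact ⟨hgh, h₃⟩

lemma IsBlossom.hasAug_lift (hm : Function.Involutive m) (hB : IsBlossom m E B a)
    (h : HasAug (contractMate m B) (Sym2.map (contract B a) '' E)) : HasAug m E := by
  have hm' := contractMate_involutive hm hB.mate
  -- with a suitable orientation, the path ends outside the blossom
  obtain ⟨L, hL, hE⟩ := h
  obtain ⟨L, hL, hE, b, x, l, rfl, hb, hbB⟩ : ∃ L, IsAug (contractMate m B) L ∧
      altEdges (contractMate m B) L ⊆ Sym2.map (contract B a) '' E ∧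
      ∃ b x l, L = b :: x :: l ∧ contractMate m B b = b ∧ b ∉ B := by
    have hform : ∀ L, IsAug (contractMate m B) L → ∃ b x l, L = b :: x :: l := by
      rintro L ⟨-, b, l, c, rfl, -⟩
      cases l with
      | nil => exact ⟨b, c, [], rfl⟩
      | cons x l => exact ⟨b, x, _, rfl⟩
    have hends : ∀ L b x l, IsAug (contractMate m B) L → L = b :: x :: l →
        altEdges (contractMate m B) L ⊆ Sym2.map (contract B a) '' E →
        contractMate m B b = b ∧ (b ∈ B → b = a) := by
      rintro L b x l ⟨-, b', l', c, rfl, hb, -⟩ h₁ h₂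
      obtain ⟨rfl, h₁⟩ := List.cons.inj h₁
      refine ⟨hb, fun hbB => ?_⟩
      rw [h₁, altEdges_cons_cons, Set.insert_subset_iff, hb] at h₂
      obtain ⟨g, h, -, -, hh⟩ := exists_of_mem_contract h₂.1
      rw [← hh] at hbB ⊢
      exact (contract_mem hbB).2
    by_cases h : ∃ b x l, L = b :: x :: l ∧ b ∉ B
    · obtain ⟨b, x, l, h, hb⟩ := h
      exact ⟨L, hL, hE, b, x, l, h, (hends _ _ _ _ hL h hE).1, hb⟩
    · push Not at h
      have hL' := hL.reverse hm'
      have hE' : altEdges _ _ ⊆ _ := (altEdges_reverse hm' L).le.trans hE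
      obtain ⟨c, y, l', hc⟩ := hform _ hL'
      have hc' := hends _ _ _ _ hL' hc hE'
      refine ⟨_, hL', hE', c, y, l', hc, hc'.1, fun hcB => ?_⟩
      obtain ⟨b, x, l, hb⟩ := hform _ hL
      have hbB := h _ _ _ hb
      have hb' := hends _ _ _ _ hL hb hE
      obtain ⟨hs, b₁, l₁, c₁, rfl, h₁, h₂, h₃⟩ := hL
      obtain ⟨rfl, h₅⟩ := List.cons.inj hb
      simp only [List.map_cons, List.map_append, List.reverse_cons, List.reverse_append,
        List.map_nil, List.reverse_nil, List.nil_append, List.cons_append, h₂] at hc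
      obtain ⟨rfl, h₆⟩ := List.cons.inj hc
      refine ((simple_cons.1 hs).1 c₁ (by simp)).1 ?_
      rw [hb'.2 hbB, hc'.2 hcB]
  obtain ⟨l', h₁, h₂, h₃, -, h₄⟩ := hB.lift hm _ b hbB hL.1 hL.rooted hE
  rw [contractMate_of_notMem hbB] at hb
  obtain ⟨y, l'', rfl⟩ := List.exists_cons_of_ne_nil (h₄ (by simp))
  exact hasAug_of_rooted hb h₁ h₂ h₃

end Contract

/-! ### Existence of certificates and the augmentation step -/

section GallaiEdmonds

variable {V : Type*} {m : V → V} {E : Set (Sym2 V)}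

/-- An alternating path from `a` to `p` and the edge `s(a, p)` form an odd cycle, which is a blossom:
each of its vertices is reached from `a` in one of the two directions around the cycle. -/
lemma isBlossom_of_cycle (hm : Function.Involutive m) {a p : V} {l : List V} (ha : m a = a)
    (hap : s(a, p) ∈ E) (hs : Simple m (p :: (l ++ [a]))) (hl : ∀ v ∈ p :: l, m v ≠ v)
    (hE : altEdges m (p :: (l ++ [a])) ⊆ E) :
    IsBlossom m E {v | v ∈ p :: (l ++ [a]) ∨ m v ∈ p :: (l ++ [a])} a := by
  have hcov : ∀ v ∈ p :: (l ++ [a]), m v = v → v = a := by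
    intro v hv hvv
    rw [← List.cons_append, List.mem_append] at hv
    rcases hv with hv | hv
    · exact absurd hvv (hl v hv)
    · simpa using hv
  -- an initial part of a path, which is a suffix of its list, reaches each vertex of the list
  have hsuf : ∀ k : List V, ∀ q : V, Simple m (q :: (k ++ [a])) →
      altEdges m (q :: (k ++ [a])) ⊆ E → ∀ g ∈ q :: (k ++ [a]),
      ∃ l', (∀ z ∈ g :: l', z ∈ q :: (k ++ [a])) ∧ Simple m (g :: l') ∧ Rooted m (g :: l') ∧
        altEdges m (g :: l') ⊆ E := by
    intro k q h₁ h₂ g hg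
    obtain ⟨l₁, l₂, h⟩ := List.append_of_mem hg
    refine ⟨l₂, ?_, ?_, ?_, ?_⟩
    · rw [h]; simp +contextual
    · rw [h] at h₁; exact h₁.of_append_right
    · rcases List.eq_nil_or_concat (g :: l₂) with h' | ⟨l₃, x, h'⟩
      · simp at h'
      · rw [List.concat_eq_append] at h'
        rw [h', ← List.append_assoc, ← List.cons_append] at h
        obtain ⟨-, h⟩ := List.append_inj' h rfl
        simp only [List.cons.injEq, and_true] at h
        exact ⟨l₃, x, h', h ▸ ha⟩
    · rw [h] at h₂; exact (altEdges_subset_append_right _ _).trans h₂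
  refine ⟨Or.inl (by simp), ha, fun v hv => ?_, fun v hv hvv => ?_, fun g hg => ?_⟩
  · rcases hv with hv | hv
    · exact Or.inr (by rwa [hm])
    · exact Or.inl hv
  · rcases hv with hv | hv
    · exact hcov v hv hvv
    · rw [hvv] at hv; exact hcov v hv hvv
  · rcases hg with hg | hg
    · obtain ⟨l', h₁, h₂⟩ := hsuf l p hs hE g hg
      exact ⟨l', fun z hz => Or.inl (h₁ z hz), h₂⟩
    · -- the cycle traversed backwards
      by_cases hga : g = a
      · subst hga
        exact ⟨[], by simp, List.pairwise_singleton _ _, rooted_singleton.2 ha, by simp⟩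
      have hrev : ((p :: l).map m).reverse ≠ [] := by simp
      have hs' : Simple m ((p :: (l ++ [a])).map m).reverse := hs.reverse hm
      have hE' : altEdges m ((p :: (l ++ [a])).map m).reverse ⊆ E := by
        rwa [altEdges_reverse hm]
      have hcyc : Simple m (((p :: l).map m).reverse ++ [a]) ∧
          altEdges m (((p :: l).map m).reverse ++ [a]) ⊆ E := by
        have heq : ((p :: (l ++ [a])).map m).reverse = a :: ((p :: l).map m).reverse := by
          simp [ha]
        rw [heq] at hs' hE'
        constructor
        · unfold Simple at *
          rw [List.pairwise_append]
          refine ⟨(List.pairwise_cons.1 hs').2, List.pairwise_singleton _ _, fun x hx y hy => ?_⟩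
          rw [List.mem_singleton] at hy
          subst hy
          have := (List.pairwise_cons.1 hs').1 x hx
          refine ⟨this.1.symm, fun h => this.2 ?_⟩
          rw [h, hm]
        · rw [List.map_cons, List.reverse_cons, List.append_assoc, List.singleton_append,
            altEdges_append, Set.union_subset_iff]
          constructor
          · rw [List.map_cons, List.reverse_cons] at hE'
            refine Set.Subset.trans ?_ hE'
            exact altEdges_subset_append_right [a] _
          · simpa [hm p] using hap
      obtain ⟨q, k, hk⟩ := List.exists_cons_of_ne_nil hrev
      rw [hk] at hcyc
      have hg' : g ∈ q :: (k ++ [a]) := by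
        rw [← List.cons_append, ← hk]
        have : m g ∈ p :: l := by
          rw [← List.cons_append, List.mem_append] at hg
          rcases hg with hg | hg
          · exact hg
          · rw [List.mem_singleton] at hg
            exact absurd (by rw [← hm g, hg, ha]) hga
        rw [List.mem_append, List.mem_reverse, List.mem_map]
        exact Or.inl ⟨m g, this, hm g⟩
      obtain ⟨l', h₁, h₂⟩ := hsuf k q hcyc.1 hcyc.2 g hg'
      refine ⟨l', fun z hz => ?_, h₂⟩
      have := h₁ z hz
      rw [← List.cons_append, ← hk, List.mem_append, List.mem_reverse, List.mem_map] at this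
      rcases this with ⟨w, hw, rfl⟩ | hz
      · refine Or.inr ?_
        rw [hm, ← List.cons_append, List.mem_append]
        exact Or.inl hw
      · rw [List.mem_singleton] at hz
        exact Or.inl (by simp [hz])

/-- If a path reaches `p`, and `p` is adjacent to the uncovered vertex `a`, then either there is an
augmenting path or a path from `a` reaches `p`. -/
lemma exists_path_of_adj_free {a p : V} (ha : m a = a) (hp : m p ≠ p) (hap : s(a, p) ∈ E)
    (hE : ¬ HasAug m E) (h : p ∈ outer m E) :
    ∃ l, Simple m (p :: (l ++ [a])) ∧ (∀ v ∈ p :: l, m v ≠ v) ∧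
      altEdges m (p :: (l ++ [a])) ⊆ E := by
  obtain ⟨l, hs, hr, hlE⟩ := h
  have hr' := hr
  obtain ⟨l', c, hl, hc⟩ := hr'
  have hc' : c ∈ p :: l := by simp [hl]
  obtain ⟨l₁, d, l₂, heq, hd, h₁⟩ := exists_first (p := fun v => m v = v) (l := l) (by
    rcases List.mem_cons.1 hc' with rfl | h
    · exact absurd hc hp
    · exact ⟨c, h, hc⟩)
  have heq' : p :: l = (p :: (l₁ ++ [d])) ++ l₂ := by simp [heq]
  rw [heq'] at hs hlE
  have hs' := hs.of_append_left
  have hE' := (altEdges_subset_append_left _ _).trans hlE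
  have hcov : ∀ v ∈ p :: l₁, m v ≠ v := by simpa [hp] using h₁
  obtain rfl : d = a := by
    by_contra hda
    refine hE (hasAug_of_rooted (b := a) (x := p) (l := l₁ ++ [d]) ha ?_ ?_ ?_)
    · refine simple_cons.2 ⟨fun x hx => ?_, hs'⟩
      have : x ≠ a := by
        rintro rfl
        rw [← List.cons_append, List.mem_append] at hx
        rcases hx with hx | hx
        · exact hcov _ hx ha
        · exact hda (List.mem_singleton.1 hx).symm
      rw [ha]; exact ⟨this, this⟩
    · exact ⟨a :: p :: l₁, d, rfl, hd⟩
    · rw [altEdges_cons_cons, Set.insert_subset_iff, ha, Sym2.eq_swap]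
      exact ⟨hap, hE'⟩
  exact ⟨l₁, hs', hcov, hE'⟩

/-- A certificate for the contraction of a blossom gives one for the original edge set: the contracted
blossom becomes part of the blossom of its base. -/
lemma IsBlossom.exists_cert (hm : Function.Involutive m) {B : Set V} {a : V}
    (hB : IsBlossom m E B a) {β : V → V}
    (h : Cert (contractMate m B) (Sym2.map (contract B a) '' E)
      (outer (contractMate m B) (Sym2.map (contract B a) '' E)) β) :
    Cert m E (outer m E) (fun v => β (contract B a v)) := by
  set E' := Sym2.map (contract B a) '' E
  set O := outer (contractMate m B) E'
  have hBO : ∀ v ∈ B, v ∈ O := fun v hv => free_mem_outer (contractMate_of_mem hv)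
  have hiff : ∀ v, contract B a v ∈ O ↔ v ∈ O := by
    intro v
    by_cases hv : v ∈ B
    · exact ⟨fun _ => hBO v hv, fun _ => hBO _ (by rw [contract_of_mem hv]; exact hB.mem)⟩
    · rw [contract_of_notMem hv]
  have hmB : ∀ v ∉ B, m v ∉ B := fun v hv h' => hv (by simpa [hm v] using hB.mate _ h')
  have hβa : β a = a := (h.free a (contractMate_of_mem hB.mem)).2
  have hO : O ⊆ outer m E := by
    rintro v hv
    by_cases hvB : v ∈ B
    · obtain ⟨l, -, hl⟩ := hB.reach v hvB
      exact ⟨l, hl⟩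
    · obtain ⟨l, h₁, h₂, h₃⟩ := hv
      obtain ⟨l', h₁, h₂, h₃, -⟩ := hB.lift hm l v hvB h₁ h₂ h₃
      exact ⟨l', h₁, h₂, h₃⟩
  have hcert : Cert m E O (fun v => β (contract B a v)) := by
    refine ⟨fun v hv => ?_, fun v hv hne => ?_, fun x y hx hxy => ?_⟩
    · by_cases hvB : v ∈ B
      · rw [hB.eq_of_free v hvB hv]
        exact ⟨hBO a hB.mem, by rw [contract_of_mem hB.mem, hβa]⟩
      · have := h.free v (by rwa [contractMate_of_notMem hvB])
        exact ⟨this.1, by rw [contract_of_notMem hvB]; exact this.2⟩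
    · by_cases hvB : v ∈ B
      · refine ⟨hBO _ (hB.mate v hvB), ?_⟩
        simp only [contract_of_mem hvB, contract_of_mem (hB.mate v hvB)]
      · simp only [contract_of_notMem hvB] at hne
        have := h.mate v hv hne
        rw [contractMate_of_notMem hvB] at this
        simpa only [contract_of_notMem hvB, contract_of_notMem (hmB v hvB)] using this
    · have hxy' : s(contract B a x, contract B a y) ∈ E' := ⟨_, hxy, by simp⟩
      rcases h.edge _ _ ((hiff x).2 hx) hxy' with ⟨h₁, h₂⟩ | ⟨h₁, h₂⟩
      · exact Or.inl ⟨(hiff y).1 h₁, h₂⟩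
      · have hyO : y ∉ O := fun h' => h₁ ((hiff y).2 h')
        have hyB : y ∉ B := fun h' => hyO (hBO y h')
        rw [contract_of_notMem hyB, contractMate_of_notMem hyB] at h₂
        exact Or.inr ⟨hyO, h₂⟩
  rwa [hO.antisymm (hcert.outer_subset hm)] at hcert

/-- Existence of dual certificates, when no covered neighbour of an uncovered vertex is outer: the
uncovered vertices and their covered neighbours `N` are removed, and the mates of `N` become the new
uncovered vertices. Removal means that the edges at these vertices are dropped from `E`. -/
lemma exists_cert_of_reroot (hm : Function.Involutive m) (hE : ¬ HasAug m E) {N : Set V}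
    (hN : ∀ p, p ∈ N ↔ m p ≠ p ∧ ∃ a, m a = a ∧ s(a, p) ∈ E)
    (hNo : ∀ p ∈ N, p ∉ outer m E)
    (ih : ∀ E', ¬ HasAug (contractMate m {v | v ∈ N ∨ m v ∈ N}) E' →
      ∃ β, Cert (contractMate m {v | v ∈ N ∨ m v ∈ N}) E'
        (outer (contractMate m {v | v ∈ N ∨ m v ∈ N}) E') β) :
    ∃ β, Cert m E (outer m E) β := by
  set B : Set V := {v | v ∈ N ∨ m v ∈ N} with hBdef
  have hB : ∀ v ∈ B, m v ∈ B := by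
    rintro v (hv | hv)
    · exact Or.inr (by rwa [hm])
    · exact Or.inl hv
  set m' := contractMate m B with hm'
  set X : Set V := {v | m v = v ∨ v ∈ N} with hX
  set E' : Set (Sym2 V) := {e | e ∈ E ∧ ∀ v ∈ e, v ∉ X} with hE'
  have hmN : ∀ p, m p ∈ N → p ∈ outer m E := by
    intro p hp
    obtain ⟨h₁, a, ha, hap⟩ := (hN _).1 hp
    have : a ≠ p := by rintro rfl; exact h₁ (by rw [ha, ha])
    refine ⟨[a], simple_cons.2 ⟨?_, List.pairwise_singleton _ _⟩,
      rooted_cons_cons.2 (rooted_singleton.2 ha), by simpa using hap⟩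
    intro x hx
    rw [List.mem_singleton] at hx
    subst hx
    exact ⟨this, fun h => this (by rw [← ha, h, hm])⟩
  have hNN : ∀ p ∈ N, m p ∉ N := fun p hp h' => hNo p hp (hmN p h')
  have hNX : ∀ p, m p ∈ N → p ∉ X := by
    rintro p hp (h | h)
    · exact ((hN _).1 hp).1 (by rw [hm]; exact h.symm)
    · exact hNN p h hp
  have hm'free : ∀ v, m' v = v → m v = v ∨ v ∈ N ∨ m v ∈ N := by
    intro v hv
    by_cases h : v ∈ B
    · exact Or.inr h
    · rw [hm', contractMate_of_notMem h] at hv; exact Or.inl hv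
  have hiso : ∀ k : List V, ∀ w, altEdges m' (w :: k) ⊆ E' → ∀ z ∈ k, z ∉ X := by
    intro k w hw z hz
    obtain ⟨e, he, hze⟩ := exists_altEdge_of_mem_tail hz
    exact (hw he).2 z hze
  -- a path that avoids `X` lifts: it starts at the mate of some `p ∈ N`, and is preceded by an edge
  -- from an uncovered vertex to `p`
  have hlift : ∀ (l : List V) (v : V), v ∉ X → Simple m' (v :: l) → Rooted m' (v :: l) →
      altEdges m' (v :: l) ⊆ E' → ∃ l' a, Simple m (v :: l') ∧ Rooted m (v :: l') ∧
        altEdges m (v :: l') ⊆ E ∧ (∀ z ∈ l', z ∈ l ∨ z = a) ∧ m a = a := by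
    intro l
    induction l with
    | nil =>
      intro v hv hs hr hlE
      have : m v ∈ N := by
        rcases hm'free v (rooted_singleton.1 hr) with h | h | h
        · exact absurd (Or.inl h) hv
        · exact absurd (Or.inr h) hv
        · exact h
      obtain ⟨h₁, a, ha, hap⟩ := (hN _).1 this
      have hav : a ≠ v := by rintro rfl; exact h₁ (by rw [ha, ha])
      refine ⟨[a], a, simple_cons.2 ⟨?_, List.pairwise_singleton _ _⟩,
        rooted_cons_cons.2 (rooted_singleton.2 ha), by simpa using hap, by simp, ha⟩
      intro x hx
      rw [List.mem_singleton] at hx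
      subst hx
      exact ⟨hav, fun h => hav (by rw [← ha, h, hm])⟩
    | cons x l ih =>
      intro v hv hs hr hlE
      rw [simple_cons] at hs
      rw [rooted_cons_cons] at hr
      have hlE' := hlE
      rw [altEdges_cons_cons, Set.insert_subset_iff] at hlE
      have hxX : x ∉ X := hlE.1.2 x (by simp)
      have hv'X : m' v ∉ X := hlE.1.2 (m' v) (by simp)
      have hne : ∀ z ∈ x :: l, z ≠ v ∧ z ≠ m' v := hs.1
      obtain ⟨l', a, h₁, h₂, h₃, h₄, ha⟩ := ih x hxX hs.2 hr hlE.2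
      by_cases hvB : v ∈ B
      · have hvN : m v ∈ N := hvB.resolve_left fun h => hv (Or.inr h)
        -- here `m' v = v`, so the path has an edge to `v` itself and reaches `m v`, which is in `N`
        exfalso
        have hmv : m' v = v := contractMate_of_mem hvB
        rw [hmv] at hlE
        refine hNo (m v) hvN ⟨x :: l', simple_cons.2 ⟨?_, h₁⟩, rooted_cons_cons.2 h₂, ?_⟩
        · intro z hz
          rw [hm]
          have hva : v ≠ a := by rintro rfl; exact hv (Or.inl ha)
          have hmva : m v ≠ a := fun h => hva (by rw [← hm v, h, ha])
          have key : z ∈ x :: l ∨ z = a := by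
            rcases List.mem_cons.1 hz with rfl | hz
            · simp
            · exact (h₄ z hz).imp_left (List.mem_cons_of_mem _)
          rcases key with hz | rfl
          · refine ⟨?_, (hne z hz).1⟩
            -- vertices of the path avoid `X`
            rintro rfl
            exact hiso _ _ hlE' _ hz (Or.inr hvN)
          · exact ⟨hmva.symm, hva.symm⟩
        · rw [altEdges_cons_cons, Set.insert_subset_iff, hm]
          exact ⟨hlE.1.1, h₃⟩
      · have hmv : m' v = m v := contractMate_of_notMem hvB
        rw [hmv] at hlE hne
        have hva : v ≠ a := by rintro rfl; exact hv (Or.inl ha)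
        have key : ∀ z ∈ x :: l', z ∈ x :: l ∨ z = a := by
          intro z hz
          rcases List.mem_cons.1 hz with rfl | hz
          · simp
          · exact (h₄ z hz).imp_left (List.mem_cons_of_mem _)
        refine ⟨x :: l', a, simple_cons.2 ⟨fun z hz => ?_, h₁⟩, rooted_cons_cons.2 h₂, ?_, key, ha⟩
        · rcases key z hz with hz | rfl
          · exact hne z hz
          · exact ⟨hva.symm, fun h => hva (by rw [← hm v, ← h, ha])⟩
        · rw [altEdges_cons_cons, Set.insert_subset_iff]
          exact ⟨hlE.1.1, h₃⟩
  -- the remaining graph has no augmenting path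
  have haug : ¬ HasAug m' E' := by
    rintro ⟨L, hL, hLE⟩
    have hr := hL.rooted
    obtain ⟨hs, b, l, c, rfl, hb, hc, hl⟩ := hL
    obtain ⟨x, k, hx⟩ : ∃ x k, l ++ [c] = x :: k := by
      cases l with
      | nil => exact ⟨_, _, rfl⟩
      | cons x l => exact ⟨x, _, rfl⟩
    rw [hx] at hs hr hLE
    have h1 := hLE
    rw [altEdges_cons_cons, Set.insert_subset_iff, hb] at h1
    have hbX : b ∉ X := h1.1.2 b (by simp)
    have hbN : m b ∈ N := by
      rcases hm'free b hb with h | h | h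
      · exact absurd (Or.inl h) hbX
      · exact absurd (Or.inr h) hbX
      · exact h
    -- the lift of an augmenting path that ends in `b` reaches the mate of `b`, which is in `N`
    have hxX : x ∉ X := h1.1.2 x (by simp)
    obtain ⟨l', a, h₁, h₂, h₃, h₄, ha⟩ := hlift k x hxX (simple_cons.1 hs).2
      (rooted_cons_cons.1 hr) h1.2
    have hba : b ≠ a := by rintro rfl; exact hbX (Or.inl ha)
    refine hNo (m b) hbN ⟨x :: l', simple_cons.2 ⟨fun z hz => ?_, h₁⟩, rooted_cons_cons.2 h₂, ?_⟩
    · have key : z ∈ x :: k ∨ z = a := by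
        rcases List.mem_cons.1 hz with rfl | hz
        · simp
        · exact (h₄ z hz).imp_left (List.mem_cons_of_mem _)
      rw [hm]
      rcases key with hz | rfl
      · refine ⟨?_, ((simple_cons.1 hs).1 z hz).1⟩
        rintro rfl
        exact hiso _ _ hLE _ hz (Or.inr hbN)
      · exact ⟨fun h => hba (by rw [← hm b, ← h, ha]), hba.symm⟩
    · rw [altEdges_cons_cons, Set.insert_subset_iff, hm]
      exact ⟨h1.1.1, h₃⟩
  obtain ⟨β, hβ⟩ := ih E' haug
  set O' := outer m' E'
  have hO : O' \ N ⊆ outer m E := by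
    rintro v ⟨⟨l, h₁, h₂, h₃⟩, hvN⟩
    by_cases hv : m v = v
    · exact free_mem_outer hv
    · obtain ⟨l', a, h₁, h₂, h₃, -⟩ := hlift l v (by rintro (h | h); exacts [hv h, hvN h]) h₁ h₂ h₃
      exact ⟨l', h₁, h₂, h₃⟩
  have hcert : Cert m E (O' \ N) β := by
    have hBm' : ∀ v ∈ B, m' v = v := fun v hv => contractMate_of_mem hv
    refine ⟨fun v hv => ?_, fun v hv hne => ?_, fun x y hx hxy => ?_⟩
    · have hvN : v ∉ N := fun h => ((hN v).1 h).1 hv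
      have := hβ.free v (by rw [hm', contractMate_of_notMem (by
        rintro (h | h)
        · exact hvN h
        · rw [hv] at h; exact hvN h), hv])
      exact ⟨⟨this.1, hvN⟩, this.2⟩
    · have hvB : v ∉ B := fun h => hne ((hβ.free v (hBm' v h)).2).symm
      have := hβ.mate v hv.1 hne
      rw [hm', contractMate_of_notMem hvB] at this
      exact ⟨⟨this.1, fun h => hvB (Or.inr h)⟩, this.2⟩
    · have hNin : ∀ y ∈ N, y ∉ O' \ N ∧ m y ∈ O' \ N := fun y hy =>
        ⟨fun h => h.2 hy, (hβ.free (m y) (hBm' _ (Or.inr (by rwa [hm])))).1, hNN y hy⟩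
      by_cases hyN : y ∈ N
      · exact Or.inr (hNin y hyN)
      have hfree : ∀ u w, m u = u → s(u, w) ∈ E → w ∉ N → w = u := by
        intro u w hu huw hw
        have hww : m w = w := by
          by_contra h
          exact hw ((hN w).2 ⟨h, u, hu, huw⟩)
        by_contra hne
        refine hE (hasAug_of_rooted (b := w) (x := u) (l := []) hww ?_
          (rooted_cons_cons.2 (rooted_singleton.2 hu)) (by simpa [hww] using huw))
        refine simple_cons.2 ⟨?_, List.pairwise_singleton _ _⟩
        simp only [List.mem_singleton, forall_eq, hww]
        exact ⟨Ne.symm hne, Ne.symm hne⟩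
      by_cases hxf : m x = x
      · obtain rfl := hfree x y hxf hxy hyN
        exact Or.inl ⟨hx, rfl⟩
      by_cases hyf : m y = y
      · obtain rfl := hfree y x hyf (by rwa [Sym2.eq_swap]) hx.2
        exact absurd hyf hxf
      have : s(x, y) ∈ E' := by
        refine ⟨hxy, fun v hv => ?_⟩
        rcases Sym2.mem_iff.1 hv with rfl | rfl
        · rintro (h | h); exacts [hxf h, hx.2 h]
        · rintro (h | h); exacts [hyf h, hyN h]
      rcases hβ.edge x y hx.1 this with ⟨h₁, h₂⟩ | ⟨h₁, h₂⟩
      · exact Or.inl ⟨⟨h₁, hyN⟩, h₂⟩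
      · have hyB : y ∉ B := fun h => h₁ (hβ.free y (hBm' y h)).1
        rw [hm', contractMate_of_notMem hyB] at h₂
        exact Or.inr ⟨fun h => h₁ h.1, h₂, fun h => hyB (Or.inr h)⟩
  refine ⟨β, ?_⟩
  rwa [hO.antisymm (hcert.outer_subset hm)] at hcert

/-- A form of the Gallai–Edmonds structure theorem: in the absence of augmenting paths, the
vertices reached by alternating paths of even length carry a dual certificate. The proof is by
induction on the number of covered vertices. An edge between an uncovered and an outer covered
vertex closes a blossom, which is contracted; if there is none, the covered neighbours of the
uncovered vertices are removed together with the latter. -/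
theorem exists_cert (hm : Function.Involutive m) (hW : {v | m v ≠ v}.Finite)
    (hE : ¬ HasAug m E) : ∃ β, Cert m E (outer m E) β := by
  induction hn : {v | m v ≠ v}.ncard using Nat.strong_induction_on generalizing m E with
  | _ n ih =>
  have hsmall : ∀ B : Set V, (∀ v ∈ B, m v ∈ B) → (∃ p ∈ B, m p ≠ p) → ∀ E',
      ¬ HasAug (contractMate m B) E' →
      ∃ β, Cert (contractMate m B) E' (outer (contractMate m B) E') β := by
    intro B hB ⟨p, hpB, hp⟩ E' hE'
    have hss : {v | contractMate m B v ≠ v} ⊂ {v | m v ≠ v} := by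
      rw [Set.ssubset_iff_of_subset]
      · exact ⟨p, hp, fun h => h (contractMate_of_mem hpB)⟩
      · intro v hv
        by_cases hvB : v ∈ B
        · exact absurd (contractMate_of_mem hvB) hv
        · rwa [Set.mem_ofPred_eq, contractMate_of_notMem hvB] at hv
    exact ih _ (hn ▸ Set.ncard_lt_ncard hss hW) (contractMate_involutive hm hB)
      (hW.subset hss.subset) hE' rfl
  by_cases h : ∃ a p, m a = a ∧ m p ≠ p ∧ s(a, p) ∈ E ∧ p ∈ outer m E
  · obtain ⟨a, p, ha, hp, hap, hpo⟩ := h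
    obtain ⟨l, h₁, h₂, h₃⟩ := exists_path_of_adj_free ha hp hap hE hpo
    have hB := isBlossom_of_cycle hm ha hap h₁ h₂ h₃
    obtain ⟨β, hβ⟩ := hsmall _ hB.mate ⟨p, Or.inl (by simp), hp⟩ _
      fun h' => hE (hB.hasAug_lift hm h')
    exact ⟨_, hB.exists_cert hm hβ⟩
  · push Not at h
    by_cases hN : ∃ p, m p ≠ p ∧ ∃ a, m a = a ∧ s(a, p) ∈ E
    · obtain ⟨p, hp⟩ := hN
      refine exists_cert_of_reroot hm hE (N := {p | m p ≠ p ∧ ∃ a, m a = a ∧ s(a, p) ∈ E})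
        (fun _ => Iff.rfl) (fun p ⟨hp, a, ha, hap⟩ => h a p ha hp hap) ?_
      refine hsmall _ ?_ ⟨p, Or.inl hp, hp.1⟩
      rintro v (hv | hv)
      · exact Or.inr (by rwa [hm])
      · exact Or.inl hv
    · -- no edge leaves the set of uncovered vertices
      push Not at hN
      have hO : {v | m v = v} ⊆ outer m E := fun v hv => free_mem_outer hv
      have hcert : Cert m E {v | m v = v} id := by
        refine ⟨fun a ha => ⟨ha, rfl⟩, fun v _ hne => absurd rfl hne, fun x y hx hxy => ?_⟩
        have hy : m y = y := by
          by_contra hy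
          exact hN y hy x hx hxy
        by_cases hxy' : x = y
        · subst hxy'; exact Or.inl ⟨hx, rfl⟩
        · exfalso
          refine hE (hasAug_of_rooted (b := y) (x := x) (l := []) hy ?_
            (rooted_cons_cons.2 (rooted_singleton.2 hx)) (by simpa [hy] using hxy))
          refine simple_cons.2 ⟨?_, List.pairwise_singleton _ _⟩
          simp only [List.mem_singleton, forall_eq, hy]
          exact ⟨hxy', hxy'⟩
      refine ⟨id, ?_⟩
      rwa [hO.antisymm (hcert.outer_subset hm)] at hcert

/-- The augmentation step: if `E` has no augmenting path but `C` has one, then some edge of `C`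
added to `E` either creates an augmenting path or a new outer vertex. -/
theorem exists_edge_outer_ssubset (hm : Function.Involutive m) (hW : {v | m v ≠ v}.Finite)
    (hE : ¬ HasAug m E) {C : Set (Sym2 V)} (hC : HasAug m C) :
    ∃ e ∈ C, HasAug m (insert e E) ∨ outer m E ⊂ outer m (insert e E) := by
  obtain ⟨β, hβ⟩ := exists_cert hm hW hE
  by_contra! hcon
  -- the certificate for `E` is also one for `C`: adding an edge of `C` to `E` keeps the outer
  -- vertices, and the certificate for the larger set has the same blossoms
  refine Cert.not_hasAug hm (E := C) (O := outer m E) (β := β)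
    ⟨hβ.free, hβ.mate, fun x y hx hxy => ?_⟩ hC
  obtain ⟨h₁, h₂⟩ := hcon _ hxy
  have hsub : outer m E ⊆ outer m (insert s(x, y) E) := outer_mono (Set.subset_insert _ _)
  have heq : outer m (insert s(x, y) E) = outer m E := by
    by_contra hne
    exact h₂ (hsub.ssubset_of_ne (Ne.symm hne))
  obtain ⟨β', hβ'⟩ := exists_cert hm hW h₁
  rw [heq] at hβ'
  have hβ'' : Cert m E (outer m E) β' :=
    ⟨hβ'.free, hβ'.mate, fun u v hu huv => hβ'.edge u v hu (Set.mem_insert_of_mem _ huv)⟩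
  have huniq : ∀ v ∈ outer m E, β v = β' v := fun v ⟨l, a₁, a₂, a₃⟩ =>
    hβ.unique hm hβ'' l v a₁ a₂ a₃
  rcases hβ'.edge x y hx (Set.mem_insert _ _) with ⟨h₃, h₄⟩ | h
  · exact Or.inl ⟨h₃, by rw [huniq y h₃, huniq x hx, h₄]⟩
  · exact Or.inr h

end GallaiEdmonds

/-! ### Greedy choices and the bound on the number of colours -/

/-- No choice of edges from some of the sets `C i` with `i ∈ J` contains the non-matching edges of
an augmenting path. -/
def NoRainbow {V ι : Type*} (m : V → V) (C : ι → Set (Sym2 V)) (J : Finset ι) : Prop :=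
  ∀ K ⊆ J, ∀ x : ι → Sym2 V, (∀ i ∈ K, x i ∈ C i) → ¬ HasAug m (x '' K)

section Counting

variable {V ι : Type*} {m : V → V} {C : ι → Set (Sym2 V)} {J : Finset ι}

lemma ncard_altEdges (hm : Function.Involutive m) {L : List V} (hL : Simple m L) :
    (altEdges m L).ncard = L.length - 1 := by
  induction L with
  | nil => simp
  | cons y L ih =>
    cases L with
    | nil => simp
    | cons x L =>
      rw [simple_cons] at hL
      rw [altEdges_cons_cons, Set.ncard_insert_of_notMem _ (finite_altEdges _), ih hL.2]
      · simp
      · intro h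
        obtain ⟨u, v, hu, hv, h⟩ := exists_mem_of_mem_altEdges h
        rcases Sym2.eq_iff.1 h with ⟨-, h⟩ | ⟨-, h⟩
        · exact (hL.1 v hv).1 (hm.injective h).symm
        · exact (hL.1 u hu).2 h.symm

lemma nodup_append_map (hm : Function.Involutive m) {L : List V} (hL : Simple m L)
    (hcov : ∀ v ∈ L, m v ≠ v) : (L ++ L.map m).Nodup := by
  have hnd : L.Nodup := hL.imp fun h => h.1.symm
  rw [List.nodup_append]
  refine ⟨hnd, hnd.map hm.injective, fun u hu w hw h => ?_⟩
  obtain ⟨v, hv, rfl⟩ := List.mem_map.1 hw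
  by_cases huv : u = v
  · subst huv; exact hcov u hu h.symm
  · have hsymm : Std.Symm fun y x : V => x ≠ y ∧ x ≠ m y :=
      ⟨fun u v h => ⟨h.1.symm, fun h' => h.2 (by rw [h', hm])⟩⟩
    exact (hL.forall hv hu (Ne.symm huv)).2 h

/-- A set of chosen edges is chosen by equally many colours. -/
lemma exists_subset_image_eq {x : ι → Sym2 V} {T : Set (Sym2 V)} (hT : T ⊆ x '' J) :
    ∃ K ⊆ J, x '' K = T ∧ K.card = T.ncard := by
  classical
  obtain ⟨s, hs, hbij⟩ := Set.exists_subset_bijOn ((J : Set ι) ∩ x ⁻¹' T) x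
  have hsJ : s ⊆ (J : Set ι) := hs.trans Set.inter_subset_left
  have hfin : s.Finite := J.finite_toSet.subset hsJ
  have himg : x '' ((J : Set ι) ∩ x ⁻¹' T) = T := by
    rw [Set.image_inter_preimage]; exact Set.inter_eq_right.2 hT
  refine ⟨hfin.toFinset, ?_, ?_, ?_⟩
  · intro i hi; exact hsJ (hfin.mem_toFinset.1 hi)
  · rw [hfin.coe_toFinset, hbij.image_eq, himg]
  · rw [← Set.ncard_eq_toFinset_card s hfin, ← himg, ← hbij.image_eq,
      hbij.injOn.ncard_image]

/-- Greedy extension of a partial choice: each further colour contributes a new outer vertex. -/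
lemma NoRainbow.exists_extend (hm : Function.Involutive m) (hW : {v | m v ≠ v}.Finite)
    (h : NoRainbow m C J) (hC : ∀ i ∈ J, HasAug m (C i)) {K : Finset ι}
    (x : ι → Sym2 V) (hx : ∀ i ∈ K, x i ∈ C i) {L : Finset ι} (hKL : K ⊆ L) (hL : L ⊆ J) :
    ∃ x' : ι → Sym2 V, (∀ i ∈ K, x' i = x i) ∧ (∀ i ∈ L, x' i ∈ C i) ∧
      (outer m (x '' K) ∩ {v | m v ≠ v}).ncard + L.card ≤
        (outer m (x' '' L) ∩ {v | m v ≠ v}).ncard + K.card := by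
  classical
  suffices H : ∀ S : Finset ι, Disjoint K S → K ∪ S ⊆ J →
      ∃ x' : ι → Sym2 V, (∀ i ∈ K, x' i = x i) ∧ (∀ i ∈ K ∪ S, x' i ∈ C i) ∧
      (outer m (x '' K) ∩ {v | m v ≠ v}).ncard + S.card ≤
        (outer m (x' '' (K ∪ S : Finset ι)) ∩ {v | m v ≠ v}).ncard by
    obtain ⟨x', h₁, h₂, h₃⟩ := H (L \ K) Finset.disjoint_sdiff
      (by rwa [Finset.union_sdiff_of_subset hKL])
    rw [Finset.union_sdiff_of_subset hKL] at h₂ h₃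
    rw [Finset.card_sdiff_of_subset hKL] at h₃
    have := Finset.card_le_card hKL
    exact ⟨x', h₁, h₂, by omega⟩
  intro S
  induction S using Finset.induction_on with
  | empty => intro _ _; exact ⟨x, fun _ _ => rfl, by simpa using hx, by simp⟩
  | insert i S hi ih =>
    intro hdis hsub
    rw [Finset.disjoint_insert_right] at hdis
    have hsub' : K ∪ S ⊆ J := (Finset.union_subset_union_right (Finset.subset_insert _ _)).trans hsub
    obtain ⟨x', h₁, h₂, h₃⟩ := ih hdis.2 hsub'
    have hiJ : i ∈ J := hsub (by simp)
    have hiKS : i ∉ K ∪ S := by simp [hi, hdis.1]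
    obtain ⟨e, he, hcase⟩ := exists_edge_outer_ssubset hm hW (h _ hsub' x' h₂) (hC i hiJ)
    have himg : Function.update x' i e '' (K ∪ insert i S : Finset ι) =
        insert e (x' '' (K ∪ S : Finset ι)) := by
      rw [Finset.union_insert, Finset.coe_insert, Set.image_insert_eq, Function.update_self]
      congr 1
      apply Set.image_congr
      intro j hj
      exact Function.update_of_ne (by rintro rfl; exact hiKS hj) _ _
    have hval : ∀ j ∈ K ∪ insert i S, Function.update x' i e j ∈ C j := by
      intro j hj
      by_cases hji : j = i
      · subst hji; rwa [Function.update_self]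
      · rw [Function.update_of_ne hji]
        apply h₂
        simp only [Finset.mem_union, Finset.mem_insert, hji, false_or] at hj ⊢
        exact hj
    refine ⟨Function.update x' i e, fun j hj => ?_, hval, ?_⟩
    · rw [Function.update_of_ne (by rintro rfl; exact hdis.1 hj), h₁ j hj]
    · have hno := h _ hsub _ hval
      rw [himg] at hno ⊢
      have hss := hcase.resolve_left hno
      obtain ⟨v, hv, hv'⟩ := Set.exists_of_ssubset hss
      have hlt : (outer m (x' '' (K ∪ S : Finset ι)) ∩ {v | m v ≠ v}).ncard <
          (outer m (insert e (x' '' (K ∪ S : Finset ι))) ∩ {v | m v ≠ v}).ncard := by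
        refine Set.ncard_lt_ncard ?_ (hW.subset Set.inter_subset_right)
        rw [Set.ssubset_iff_of_subset (Set.inter_subset_inter_left _ hss.subset)]
        exact ⟨v, ⟨hv, fun hf => hv' (free_mem_outer hf)⟩, fun h => hv' h.1⟩
      rw [Finset.card_insert_of_notMem hi]
      omega

/-- There are at most as many colours as covered vertices. -/
theorem NoRainbow.card_le (hm : Function.Involutive m) (hW : {v | m v ≠ v}.Finite)
    (h : NoRainbow m C J) (hC : ∀ i ∈ J, HasAug m (C i)) : J.card ≤ {v | m v ≠ v}.ncard := by
  rcases J.eq_empty_or_nonempty with rfl | ⟨i₀, hi₀⟩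
  · simp
  obtain ⟨e, -⟩ : ∃ e, e ∈ C i₀ := by
    obtain ⟨L, hL, hE⟩ := hC i₀ hi₀
    obtain ⟨-, b, l, c, rfl, -⟩ := hL
    cases l with
    | nil => exact ⟨_, hE (Set.mem_insert _ _)⟩
    | cons => exact ⟨_, hE (Set.mem_insert _ _)⟩
  obtain ⟨x', -, -, h₃⟩ := h.exists_extend hm hW hC (K := ∅) (fun _ => e)
    (by simp) (Finset.empty_subset J) subset_rfl
  have := Set.ncard_le_ncard (s := outer m (x' '' J) ∩ {v | m v ≠ v}) Set.inter_subset_right hW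
  rw [Finset.card_empty] at h₃
  omega

/-- If there are as many colours as covered vertices, then no partial choice has more outer
covered vertices than colours. -/
lemma NoRainbow.ncard_outer_le (hm : Function.Involutive m) (hW : {v | m v ≠ v}.Finite)
    (h : NoRainbow m C J) (hC : ∀ i ∈ J, HasAug m (C i)) (hJ : J.card = {v | m v ≠ v}.ncard)
    {K : Finset ι} (hK : K ⊆ J) (x : ι → Sym2 V) (hx : ∀ i ∈ K, x i ∈ C i) :
    (outer m (x '' K) ∩ {v | m v ≠ v}).ncard ≤ K.card := by
  obtain ⟨x', -, -, h₃⟩ := h.exists_extend hm hW hC x hx hK subset_rfl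
  have := Set.ncard_le_ncard (s := outer m (x' '' J) ∩ {v | m v ≠ v}) Set.inter_subset_right hW
  omega

/-- If there are as many colours as covered vertices, then a rainbow blossom with `t` matching edges
needs at least `2 * t` colours. As it has `t + 1` edges outside the matching, it is a triangle. -/
lemma NoRainbow.cycle_length_le (hm : Function.Involutive m) (hW : {v | m v ≠ v}.Finite)
    (h : NoRainbow m C J) (hC : ∀ i ∈ J, HasAug m (C i)) (hJ : J.card = {v | m v ≠ v}.ncard)
    {K : Finset ι} (hK : K ⊆ J) (x : ι → Sym2 V) (hx : ∀ i ∈ K, x i ∈ C i) {a p : V} {l : List V}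
    (ha : m a = a) (hap : s(a, p) ∈ x '' K) (hs : Simple m (p :: (l ++ [a])))
    (hl : ∀ v ∈ p :: l, m v ≠ v) (hE : altEdges m (p :: (l ++ [a])) ⊆ x '' K) :
    2 * (l.length + 1) ≤ K.card := by
  classical
  refine le_trans ?_ (h.ncard_outer_le hm hW hC hJ hK x hx)
  have hB := isBlossom_of_cycle hm ha hap hs hl hE
  have hnd := nodup_append_map hm (L := p :: l)
    (by rw [← List.cons_append] at hs; exact hs.of_append_left) hl
  have hcard : ((p :: l ++ (p :: l).map m).toFinset : Set V).ncard = 2 * (l.length + 1) := by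
    rw [Set.ncard_coe_finset, List.toFinset_card_of_nodup hnd]
    simp; ring
  rw [← hcard]
  refine Set.ncard_le_ncard ?_ (hW.subset Set.inter_subset_right)
  intro v hv
  rw [Finset.mem_coe, List.mem_toFinset, List.mem_append] at hv
  have hvB : v ∈ outer m (x '' K) := by
    obtain ⟨l', -, h₁⟩ := hB.reach v (by
      rcases hv with hv | hv
      · left; rw [← List.cons_append, List.mem_append]; exact Or.inl hv
      · obtain ⟨w, hw, rfl⟩ := List.mem_map.1 hv
        right; rw [hm, ← List.cons_append, List.mem_append]; exact Or.inl hw)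
    exact ⟨l', h₁⟩
  refine ⟨hvB, ?_⟩
  rcases hv with hv | hv
  · exact hl v hv
  · obtain ⟨w, hw, rfl⟩ := List.mem_map.1 hv
    exact fun h => hl w hw (hm.injective h)

/-- If there are as many colours as covered vertices, then every coloured edge from an uncovered
vertex to a covered one is the side of a triangle with two colours and one matching edge. -/
lemma NoRainbow.exists_triangle (hm : Function.Involutive m) (hW : {v | m v ≠ v}.Finite)
    (h : NoRainbow m C J) (hC : ∀ i ∈ J, HasAug m (C i)) (hJ : J.card = {v | m v ≠ v}.ncard)
    {i : ι} (hi : i ∈ J) {a p : V} (ha : m a = a) (hp : m p ≠ p) (hap : s(a, p) ∈ C i) :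
    ∃ j ∈ J, j ≠ i ∧ s(a, m p) ∈ C j := by
  classical
  have hne : a ≠ p := by rintro rfl; exact hp ha
  have hne' : a ≠ m p := by rintro rfl; exact hp (by rw [hm] at ha; exact ha.symm)
  obtain ⟨x, h₁, h₂, h₃⟩ := h.exists_extend hm hW hC (K := {i})
    (fun _ => s(a, p)) (by simpa using hap) (L := J) (by simpa using hi) subset_rfl
  have hxi : x i = s(a, p) := h₁ i (by simp)
  -- the choice starting with `s(a, p)`, which makes `m p` outer, is tight, so that all covered
  -- vertices are outer for the full choice
  have hpo : p ∈ outer m (x '' J) := by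
    have hpos : 0 < (outer m ((fun _ : ι => s(a, p)) '' ({i} : Finset ι)) ∩
        {v | m v ≠ v}).ncard := by
      rw [Set.ncard_pos (hW.subset Set.inter_subset_right)]
      refine ⟨m p, ⟨[a], ?_, rooted_cons_cons.2 (rooted_singleton.2 ha), ?_⟩,
        fun h => hp (hm.injective h)⟩
      · refine simple_cons.2 ⟨?_, List.pairwise_singleton _ _⟩
        simp only [List.mem_singleton, forall_eq, hm p]
        exact ⟨hne', hne⟩
      · simp [hm p]
    have heq := Set.eq_of_subset_of_ncard_le (s := outer m (x '' J) ∩ {v | m v ≠ v})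
      Set.inter_subset_right (by rw [Finset.card_singleton] at h₃; omega) hW
    have : p ∈ {v | m v ≠ v} := hp
    rw [← heq] at this
    exact this.1
  have hapx : s(a, p) ∈ x '' J := ⟨i, hi, hxi⟩
  obtain ⟨l, hs, hl, hE⟩ := exists_path_of_adj_free ha hp hapx (h _ subset_rfl x h₂) hpo
  obtain ⟨K, hK, himg, hcard⟩ := exists_subset_image_eq hE
  rw [ncard_altEdges hm hs] at hcard
  have hKi : insert i K ⊆ J := Finset.insert_subset hi hK
  have := h.cycle_length_le hm hW hC hJ hKi x (fun j hj => h₂ j (hKi hj)) ha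
    (l := l) (p := p) ⟨i, by simp, hxi⟩ hs hl
    (himg.ge.trans (Set.image_mono (by simp)))
  have hle := Finset.card_insert_le i K
  simp only [List.length_cons, List.length_append, List.length_nil] at hcard
  have hlen : l.length = 0 := by omega
  obtain rfl := List.eq_nil_of_length_eq_zero hlen
  obtain ⟨j, hj, hxj⟩ := hE (show s(a, m p) ∈ altEdges m (p :: ([] ++ [a])) by simp)
  refine ⟨j, hj, ?_, hxj ▸ h₂ j hj⟩
  rintro rfl
  rw [hxi, Sym2.eq_iff] at hxj
  rcases hxj with ⟨-, h⟩ | ⟨h, -⟩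
  · exact hp h.symm
  · exact hne' h

end Counting

/-! ### Vertices and ends of augmenting paths -/

/-- The vertices lying on some edge of `C`. -/
def verts {V : Type*} (C : Set (Sym2 V)) : Set V := {v | ∃ e ∈ C, v ∈ e}

section AugLists

variable {V : Type*} {m : V → V}

lemma IsAug.exists_cons {L : List V} (h : IsAug m L) : ∃ b x l, L = b :: x :: l ∧ m b = b := by
  obtain ⟨-, b, l, c, rfl, hb, -⟩ := h
  cases l with
  | nil => exact ⟨b, c, [], rfl, hb⟩
  | cons x l => exact ⟨b, x, _, rfl, hb⟩

/-- The only edge outside the matching at the mate of the last vertex is the last such edge. -/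
lemma mem_altEdges_head (hm : Function.Involutive m) {y z : V} {l : List V}
    (hs : Simple m (y :: l)) (h : s(z, m y) ∈ altEdges m (y :: l)) : ∃ r, l = z :: r := by
  cases l with
  | nil => simp at h
  | cons x l =>
    rw [simple_cons] at hs
    refine ⟨l, ?_⟩
    congr 1
    rcases h with h | h
    · rcases Sym2.eq_iff.1 h with ⟨h, -⟩ | ⟨h₁, h₂⟩
      · exact h.symm
      · exact absurd h₂.symm (hs.1 x (by simp)).2
    · exfalso
      obtain ⟨u, v, hu, hv, h⟩ := exists_mem_of_mem_altEdges h
      rcases Sym2.eq_iff.1 h with ⟨-, h⟩ | ⟨-, h⟩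
      · exact (hs.1 v hv).1 (hm.injective h).symm
      · exact (hs.1 u hu).2 h.symm

/-- The covered vertices on an augmenting path are those on its list and their mates. -/
lemma IsAug.mem_verts_iff (hm : Function.Involutive m) {L : List V} (hL : IsAug m L) {v : V}
    (hv : m v ≠ v) : v ∈ verts (altEdges m L) ↔ v ∈ L ∨ m v ∈ L := by
  constructor
  · rintro ⟨e, he, hve⟩
    obtain ⟨x, y, hx, hy, rfl⟩ := exists_mem_of_mem_altEdges he
    rcases Sym2.mem_iff.1 hve with rfl | rfl
    · exact Or.inl hx
    · exact Or.inr (by rwa [hm])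
  · -- a covered vertex of the list is not its head, and its mate is not the head of the reverse
    have key : ∀ L, IsAug m L → ∀ v, m v ≠ v → v ∈ L → v ∈ verts (altEdges m L) := by
      rintro L ⟨-, b, l, c, rfl, hb, -⟩ v hv hvL
      rcases List.mem_cons.1 hvL with rfl | h
      · exact absurd hb hv
      · exact exists_altEdge_of_mem_tail h
    rintro (h | h)
    · exact key L hL v hv h
    · rw [← altEdges_reverse hm]
      refine key _ (hL.reverse hm) v hv ?_
      rw [List.mem_reverse, List.mem_map]
      exact ⟨m v, h, hm v⟩

/-- The first edge of an augmenting path with at least two non-matching edges is not on the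
companion path. -/
lemma IsAug.ne_image (hm : Function.Involutive m) {L : List V} (hL : IsAug m L)
    (h : 2 ≤ (altEdges m L).ncard) : altEdges m L ≠ Sym2.map m '' altEdges m L := by
  have hn := ncard_altEdges hm hL.1
  obtain ⟨hs, b, l, c, rfl, hb, hc, hl⟩ := hL
  cases l with
  | nil => rw [hn] at h; simp at h
  | cons x l =>
    intro heq
    have h₁ : s(m x, m b) ∈ altEdges m (b :: (x :: l ++ [c])) := by
      rw [heq]
      exact ⟨s(x, m b), Set.mem_insert _ _, by simp [hb]⟩
    obtain ⟨r, hr⟩ := mem_altEdges_head hm hs h₁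
    exact hl x (by simp) (List.cons.inj hr).1.symm

/-- An edge of an augmenting path at an uncovered vertex is its first or its last edge. -/
lemma IsAug.exists_head (hm : Function.Involutive m) {L : List V} (hL : IsAug m L) {a x : V}
    (ha : m a = a) (h : s(x, a) ∈ altEdges m L) :
    ∃ l, IsAug m (a :: x :: l) ∧ altEdges m (a :: x :: l) = altEdges m L := by
  have key : ∀ L, IsAug m L → s(x, a) ∈ altEdges m L → (∃ r, L = a :: r) →
      ∃ l, IsAug m (a :: x :: l) ∧ altEdges m (a :: x :: l) = altEdges m L := by
    rintro L hL h ⟨r, rfl⟩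
    obtain ⟨l, rfl⟩ := mem_altEdges_head hm hL.1 (by rwa [ha])
    exact ⟨l, hL, rfl⟩
  have haL : a ∈ L := by
    obtain ⟨u, v, hu, hv, h⟩ := exists_mem_of_mem_altEdges h
    rcases Sym2.eq_iff.1 h with ⟨-, h⟩ | ⟨-, h⟩
    · have : v = a := hm.injective (by rw [← h, ha])
      rwa [← this]
    · rwa [h]
  by_cases hhead : ∃ r, L = a :: r
  · exact key L hL h hhead
  · obtain ⟨l, h₁, h₂⟩ := key _ (hL.reverse hm) (by rwa [altEdges_reverse hm]) (by
      obtain ⟨-, b, l, c, rfl, hb, hc, hl⟩ := hL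
      rcases List.mem_cons.1 haL with rfl | h
      · exact absurd ⟨_, rfl⟩ hhead
      · rcases List.mem_append.1 h with h | h
        · exact absurd ha (hl a h)
        · rw [List.mem_singleton] at h
          exact ⟨(l.map m).reverse ++ [m b], by simp [hc, h]⟩)
    exact ⟨l, h₁, by rw [h₂, altEdges_reverse hm]⟩

end AugLists

/-! ### Edges at uncovered vertices -/

section FreeEdges

variable {V ι : Type*} {m : V → V} {C : ι → Set (Sym2 V)} {J : Finset ι}

/-- If the set `S` is available in enough colours, then its subset `T` can be chosen. -/
lemma exists_choice_superset {A : Finset ι} {T S : Set (Sym2 V)} (hT : T.Finite) (hTS : T ⊆ S)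
    (hne : S.Nonempty) (hcard : T.ncard ≤ A.card) :
    ∃ x : ι → Sym2 V, (∀ i ∈ A, x i ∈ S) ∧ T ⊆ x '' A := by
  classical
  obtain ⟨A₀, hA₀, hc⟩ := Finset.exists_subset_card_eq hcard
  obtain ⟨s₀, hs₀⟩ := hne
  have e := Finset.equivOfCardEq (s := A₀) (t := hT.toFinset)
    (by rw [hc, Set.ncard_eq_toFinset_card T hT])
  refine ⟨fun i => if h : i ∈ A₀ then (e ⟨i, h⟩ : Sym2 V) else s₀, fun i _ => ?_, fun t ht => ?_⟩
  · by_cases h : i ∈ A₀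
    · simp only [h, dif_pos]
      exact hTS (hT.mem_toFinset.1 (e ⟨i, h⟩).2)
    · simpa only [h, dif_neg, not_false_eq_true] using hs₀
  · obtain ⟨⟨i, hi⟩, h⟩ := e.surjective ⟨t, hT.mem_toFinset.2 ht⟩
    exact ⟨i, hA₀ hi, by simp only [hi, dif_pos, h]⟩

lemma NoRainbow.not_free_edge (h : NoRainbow m C J) {q : ι} (hq : q ∈ J) {a b : V} (ha : m a = a)
    (hb : m b = b) (hab : a ≠ b) : s(a, b) ∉ C q := by
  intro hq'
  refine h {q} (by simpa using hq) (fun _ => s(a, b)) (by simpa using hq') ?_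
  refine hasAug_of_rooted (b := b) (x := a) (l := []) hb ?_
    (rooted_cons_cons.2 (rooted_singleton.2 ha)) (by simp [hb])
  refine simple_cons.2 ⟨?_, List.pairwise_singleton _ _⟩
  simp only [List.mem_singleton, forall_eq, hb]
  exact ⟨hab, hab⟩

/-- If a path `L` is available in enough colours, then no other colour joins a vertex that it
reaches to an uncovered vertex different from its starting point. -/
lemma NoRainbow.not_edge_of_reached (hm : Function.Involutive m) (h : NoRainbow m C J)
    {L : List V} (hL : IsAug m L) {A : Finset ι} (hA : A ⊆ J)
    (hAC : ∀ i ∈ A, altEdges m L ⊆ C i) (hcard : L.length ≤ A.card + 2) {q : ι} (hq : q ∈ J)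
    (hqA : q ∉ A) {s b : V} (hs : m s ≠ s) (hsL : s ∈ L) (hb : m b = b)
    (hlast : ∀ l c, L = l ++ [c] → c ≠ b) : s(s, b) ∉ C q := by
  classical
  intro hsb
  obtain ⟨hL₁, b₀, l₀, c, rfl, hb₀, hc, hl₀⟩ := hL
  have hsl : s ∈ l₀ := by
    rcases List.mem_cons.1 hsL with rfl | h
    · exact absurd hb₀ hs
    · rcases List.mem_append.1 h with h | h
      · exact h
      · rw [List.mem_singleton] at h; subst h; exact absurd hc hs
  obtain ⟨l₁, l₂, rfl⟩ := List.append_of_mem hsl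
  have hcb : c ≠ b := hlast (b₀ :: (l₁ ++ s :: l₂)) c (by simp)
  have heq : b₀ :: (l₁ ++ s :: l₂ ++ [c]) = (b₀ :: l₁) ++ (s :: (l₂ ++ [c])) := by simp
  rw [heq] at hL₁ hAC hcard
  have hS := hL₁.of_append_right
  have hE : altEdges m (s :: (l₂ ++ [c])) ⊆ altEdges m ((b₀ :: l₁) ++ (s :: (l₂ ++ [c]))) :=
    altEdges_subset_append_right _ _
  have hn := ncard_altEdges hm hS
  obtain ⟨x, hx, hxT⟩ := exists_choice_superset (A := A) (finite_altEdges (m := m)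
    (s :: (l₂ ++ [c]))) hE (by
      rw [List.cons_append]
      cases l₁ with
      | nil => exact ⟨_, Set.mem_insert _ _⟩
      | cons => exact ⟨_, Set.mem_insert _ _⟩) (by
      simp only [List.length_append, List.length_cons, List.length_nil] at hcard hn ⊢
      omega)
  refine h (insert q A) (Finset.insert_subset hq hA) (Function.update x q s(s, b)) ?_ ?_
  · intro i hi
    by_cases hiq : i = q
    · subst hiq; rwa [Function.update_self]
    · rw [Function.update_of_ne hiq]
      have hiA := (Finset.mem_insert.1 hi).resolve_left hiq
      exact hAC i hiA (hx i hiA)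
  · have himg : Function.update x q s(s, b) '' (insert q A : Finset ι) =
        insert s(s, b) (x '' A) := by
      rw [Finset.coe_insert, Set.image_insert_eq, Function.update_self]
      congr 1
      apply Set.image_congr
      intro j hj
      exact Function.update_of_ne (by rintro rfl; exact hqA hj) _ _
    rw [himg]
    refine hasAug_of_rooted (b := b) (x := s) (l := l₂ ++ [c]) hb
      (simple_cons.2 ⟨fun z hz => ?_, hS⟩) ⟨b :: s :: l₂, c, by simp, hc⟩ ?_
    · have : z ≠ b := by
        rintro rfl
        rw [← List.cons_append, List.mem_append] at hz
        rcases hz with hz | hz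
        · exact hl₀ z (List.mem_append_right _ hz) hb
        · rw [List.mem_singleton] at hz; exact hcb hz.symm
      rw [hb]; exact ⟨this, this⟩
    · rw [altEdges_cons_cons, hb]
      exact Set.insert_subset_insert hxT

/-- If a path and its companion are both available in enough colours, then no further colour joins
a covered vertex of the path to an uncovered vertex. -/
lemma NoRainbow.not_edge_to_free (hm : Function.Involutive m) (h : NoRainbow m C J)
    {L : List V} (hL : IsAug m L) {A A' : Finset ι} (hA : A ⊆ J) (hA' : A' ⊆ J)
    (hAC : ∀ i ∈ A, altEdges m L ⊆ C i) (hAC' : ∀ i ∈ A', Sym2.map m '' altEdges m L ⊆ C i)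
    (hcard : L.length ≤ A.card + 2) (hcard' : L.length ≤ A'.card + 2) {q : ι} (hq : q ∈ J)
    (hqA : q ∉ A) (hqA' : q ∉ A') {s b : V} (hs : m s ≠ s) (hsL : s ∈ verts (altEdges m L))
    (hb : m b = b) : s(s, b) ∉ C q := by
  have hsL' := (hL.mem_verts_iff hm hs).1 hsL
  have hends : ∀ l c l' c', L = l ++ [c] → L.reverse = l' ++ [c'] → c ≠ c' := by
    obtain ⟨hs, b₀, l₀, c₀, rfl, -⟩ := hL
    intro l c l' c' h₁ h₂ hcc
    rw [← List.cons_append] at h₁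
    have e₁ := (List.append_inj' h₁ rfl).2
    rw [List.reverse_cons] at h₂
    have e₂ := (List.append_inj' h₂ rfl).2
    simp only [List.cons.injEq, and_true] at e₁ e₂
    exact ((simple_cons.1 hs).1 c₀ (by simp)).1 (by rw [e₁, e₂, hcc])
  have hrev : IsAug m L.reverse := by
    have := (hL.map hm).reverse hm
    rwa [List.map_map, hm.comp_self, List.map_id] at this
  have hrevE : altEdges m L.reverse = Sym2.map m '' altEdges m L := by
    have := altEdges_reverse hm (L.map m)
    rwa [List.map_map, hm.comp_self, List.map_id, altEdges_map] at this
  have hlast : ∀ L' : List V, IsAug m L' → ∀ l c, L'.map m = l ++ [c] → ∃ l', L' = l' ++ [c] := by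
    rintro L' ⟨-, b₀, l₀, c₀, rfl, -, hc₀, -⟩ l c h
    refine ⟨b₀ :: l₀, ?_⟩
    have : (b₀ :: (l₀ ++ [c₀])).map m = (b₀ :: l₀).map m ++ [c₀] := by simp [hc₀]
    rw [this] at h
    rw [← (List.append_inj' h rfl).2]
    rfl
  by_cases hbl : ∃ l, L = l ++ [b]
  · obtain ⟨l, hl⟩ := hbl
    have hne : ∀ l' c', L.reverse = l' ++ [c'] → c' ≠ b := fun l' c' h h' =>
      hends l b l' c' hl h h'.symm
    rcases hsL' with hsL' | hsL'
    · exact h.not_edge_of_reached hm hrev hA' (by rwa [hrevE]) (by simpa using hcard') hq hqA' hs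
        (by simpa using hsL') hb hne
    · refine h.not_edge_of_reached hm (hL.reverse hm) hA (by rwa [altEdges_reverse hm])
        (by simpa using hcard) hq hqA hs ?_ hb ?_
      · rw [List.mem_reverse, List.mem_map]; exact ⟨m s, hsL', hm s⟩
      · intro l' c' h'
        rw [← List.map_reverse] at h'
        obtain ⟨l'', h''⟩ := hlast _ hrev _ _ h'
        exact hne l'' c' h''
  · rcases hsL' with hsL' | hsL'
    · exact h.not_edge_of_reached hm hL hA hAC hcard hq hqA hs hsL' hb
        fun l c hl hcb => hbl ⟨l, hcb ▸ hl⟩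
    · refine h.not_edge_of_reached hm (hL.map hm) hA' (by rwa [altEdges_map])
        (by simpa using hcard') hq hqA' hs (List.mem_map.2 ⟨m s, hsL', hm s⟩) hb ?_
      intro l c hl hcb
      obtain ⟨l', hl'⟩ := hlast _ hL _ _ hl
      exact hbl ⟨l', hcb ▸ hl'⟩

end FreeEdges

/-! ### Projection of augmenting paths to a contraction -/

section Project

variable {V : Type*} {m : V → V} {B : Set V} {a : V}

lemma altEdges_contract_subset (hm : Function.Involutive m) (hB : ∀ v ∈ B, m v ∈ B) {l : List V}
    {g h : V} (hl : ∀ v ∈ l, v ∉ B) (hg : contract B a g = h) :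
    altEdges (contractMate m B) (l ++ [h]) ⊆ Sym2.map (contract B a) '' altEdges m (l ++ [g]) := by
  have hmB : ∀ v ∉ B, m v ∉ B := fun v hv h' => hv (by simpa [hm v] using hB _ h')
  induction l with
  | nil => simp
  | cons y l ih =>
    have hy := hl y (by simp)
    cases l with
    | nil =>
      simp [contractMate_of_notMem hy, contract_of_notMem (hmB y hy), hg]
    | cons x l =>
      have ih := ih (fun v hv => hl v (List.mem_cons_of_mem _ hv))
      have hx := hl x (by simp)
      simp only [List.cons_append, altEdges_cons_cons] at ih ⊢
      rw [Set.image_insert_eq, Sym2.map_mk, contractMate_of_notMem hy, contract_of_notMem hx,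
        contract_of_notMem (hmB y hy)]
      exact Set.insert_subset_insert ih

/-- The contraction of an augmenting path contains an augmenting path: an end of the path is outside
`B`, and the path is followed from there to its first vertex in `B`. -/
lemma IsAug.project (hm : Function.Involutive m) (hB : ∀ v ∈ B, m v ∈ B) (haB : a ∈ B)
    (hfree : ∀ v ∈ B, m v = v → v = a) {L : List V} (hL : IsAug m L) :
    ∃ L', IsAug (contractMate m B) L' ∧
      altEdges (contractMate m B) L' ⊆ Sym2.map (contract B a) '' altEdges m L := by
  have key : ∀ b l c, IsAug m (b :: (l ++ [c])) → m b = b → m c = c → (∀ v ∈ l, m v ≠ v) →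
      b ∉ B → ∃ L', IsAug (contractMate m B) L' ∧ altEdges (contractMate m B) L' ⊆
        Sym2.map (contract B a) '' altEdges m (b :: (l ++ [c])) := by
    intro b l c hL hb hc hl hbB
    -- `g` is the last vertex in `B`, or the start of the path, and `l₁` lists the vertices after it
    obtain ⟨l₁, g, l₂, heq, hl₁, hg, hgc⟩ : ∃ l₁ g l₂, l ++ [c] = (l₁ ++ [g]) ++ l₂ ∧
        (∀ v ∈ l₁, v ∉ B ∧ v ∈ l) ∧
        contractMate m B (contract B a g) = contract B a g ∧
        ∀ v ∉ B, v ≠ g → v ≠ contract B a g := by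
      have hc' : contractMate m B (contract B a c) = contract B a c := by
        by_cases hcB : c ∈ B
        · rw [contract_of_mem hcB, contractMate_of_mem haB]
        · rw [contract_of_notMem hcB, contractMate_of_notMem hcB, hc]
      have hne : ∀ g, ∀ v ∉ B, v ≠ g → v ≠ contract B a g := by
        intro g v hv hvg
        by_cases hgB : g ∈ B
        · rw [contract_of_mem hgB]; rintro rfl; exact hv haB
        · rwa [contract_of_notMem hgB]
      by_cases h : ∃ v ∈ l, v ∈ B
      · obtain ⟨l₁, g, l₂, rfl, hg, h₁⟩ := exists_first h
        refine ⟨l₁, g, l₂ ++ [c], by simp, fun v hv => ⟨h₁ v hv, by simp [hv]⟩, ?_, hne g⟩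
        rw [contract_of_mem hg, contractMate_of_mem haB]
      · push Not at h
        exact ⟨l, c, [], by simp, fun v hv => ⟨h v hv, hv⟩, hc', hne c⟩
    rw [heq, ← List.cons_append] at hL
    have hs : Simple m (b :: l₁ ++ [g]) := hL.1.of_append_left
    refine ⟨b :: (l₁ ++ [contract B a g]), ⟨?_, b, l₁, contract B a g, rfl, ?_, hg, ?_⟩, ?_⟩
    · rw [← List.cons_append]
      unfold Simple at hs ⊢
      rw [List.pairwise_append] at hs ⊢
      have hlB : ∀ v ∈ b :: l₁, v ∉ B := by
        intro v hv
        rcases List.mem_cons.1 hv with rfl | hv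
        · exact hbB
        · exact (hl₁ v hv).1
      refine ⟨hs.1.imp_of_mem fun {u v} hu _ huv => ?_, List.pairwise_singleton _ _, ?_⟩
      · rwa [contractMate_of_notMem (hlB u hu)]
      · intro u hu v hv
        rw [List.mem_singleton] at hv
        subst hv
        have h₁ := hs.2.2 u hu g (by simp)
        have huB := hlB u hu
        have hmu : m u ∉ B := fun h' => huB (by simpa [hm u] using hB _ h')
        rw [contractMate_of_notMem huB]
        exact ⟨(hgc u huB h₁.1.symm).symm, (hgc (m u) hmu h₁.2.symm).symm⟩
    · rw [contractMate_of_notMem hbB, hb]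
    · intro v hv
      rw [contractMate_of_notMem (hl₁ v hv).1]
      exact hl v (hl₁ v hv).2
    · rw [heq, ← List.cons_append, ← List.cons_append]
      refine (altEdges_contract_subset hm hB (l := b :: l₁) ?_ rfl).trans
        (Set.image_mono (altEdges_subset_append_left _ _))
      intro v hv
      rcases List.mem_cons.1 hv with rfl | hv
      · exact hbB
      · exact (hl₁ v hv).1
  have hL' := hL
  obtain ⟨hs, b, l, c, rfl, hb, hc, hl⟩ := hL'
  by_cases hbB : b ∈ B
  · have hrev := hL.reverse hm
    have heq : ((b :: (l ++ [c])).map m).reverse = c :: ((l.map m).reverse ++ [b]) := by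
      simp [hb, hc]
    rw [heq] at hrev
    rw [← altEdges_reverse hm, heq]
    refine key _ _ _ hrev hc hb ?_ ?_
    · intro v hv h
      obtain ⟨w, hw, rfl⟩ := List.mem_map.1 (List.mem_reverse.1 hv)
      exact hl w hw (hm.injective h)
    · intro hcB
      exact ((simple_cons.1 hs).1 c (by simp)).1 (by rw [hfree b hbB hb, hfree c hcB hc])
  · exact key b l c hL hb hc hl hbB

/-- A path of the contraction whose edges come from the edges of a path in the original graph with
the same end follows that path until it enters the blossom. -/
lemma exists_append_of_altEdges_subset (hm : Function.Involutive m) (hB : ∀ v ∈ B, m v ∈ B)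
    (haB : a ∈ B) {c : V} : ∀ (l' : List V) (y : V) (l : List V), Simple m (y :: l) →
      (∀ v ∈ y :: l', v ∉ B) → Simple (contractMate m B) (y :: (l' ++ [c])) →
      altEdges (contractMate m B) (y :: (l' ++ [c])) ⊆
        Sym2.map (contract B a) '' altEdges m (y :: l) →
      ∃ g r, l = l' ++ g :: r ∧ contract B a g = c
  | [], y, l, hs, hl', _, hE => by
    have hy := hl' y (by simp)
    have hmy : m y ∉ B := fun h' => hy (by simpa [hm y] using hB _ h')
    have h₁ := hE (Set.mem_insert _ _)
    rw [contractMate_of_notMem hy] at h₁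
    obtain ⟨g, h, hgh, hg, hh⟩ := exists_of_mem_contract h₁
    obtain rfl : h = m y := (contract_notMem (by rwa [hh]) haB).trans hh
    obtain ⟨r, rfl⟩ := mem_altEdges_head hm hs hgh
    exact ⟨g, r, rfl, hg⟩
  | w :: l', y, l, hs, hl', hs', hE => by
    have hy := hl' y (by simp)
    have hw := hl' w (by simp)
    have hmy : m y ∉ B := fun h' => hy (by simpa [hm y] using hB _ h')
    have h₁ := hE (Set.mem_insert _ _)
    rw [contractMate_of_notMem hy] at h₁
    obtain ⟨g, h, hgh, hg, hh⟩ := exists_of_mem_contract h₁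
    obtain rfl : h = m y := (contract_notMem (by rwa [hh]) haB).trans hh
    obtain rfl : g = w := (contract_notMem (by rwa [hg]) haB).trans hg
    obtain ⟨r, rfl⟩ := mem_altEdges_head hm hs hgh
    rw [simple_cons] at hs hs'
    obtain ⟨g', r', h₂, h₃⟩ := exists_append_of_altEdges_subset hm hB haB l' g r hs.2
      (fun v hv => hl' v (List.mem_cons_of_mem _ hv)) hs'.2 (by
        intro e he
        obtain ⟨e', he', rfl⟩ := hE (Set.mem_insert_of_mem _ he)
        rcases he' with rfl | he'
        · exfalso
          rw [Sym2.map_mk, contract_of_notMem hw, contract_of_notMem hmy] at he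
          obtain ⟨u, v, hu, hv, h⟩ := exists_mem_of_mem_altEdges he
          rw [contractMate_of_notMem hy] at hs'
          have hmv : ∀ v, contractMate m B v = m y → v = y := by
            intro v hv
            by_cases hvB : v ∈ B
            · rw [contractMate_of_mem hvB] at hv; exact absurd (hv ▸ hvB) hmy
            · rw [contractMate_of_notMem hvB] at hv; exact hm.injective hv
          rcases Sym2.eq_iff.1 h with ⟨-, h⟩ | ⟨-, h⟩
          · exact (hs'.1 v hv).1 (hmv v h.symm)
          · exact (hs'.1 u hu).2 h.symm
        · exact ⟨e', he', rfl⟩)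
    exact ⟨g', r', by rw [h₂]; rfl, h₃⟩

end Project

/-! ### Badges and contractions of triangles -/

/-- The combinatorial form of a badge: `m` encodes the matching, and `C i` for `i ∈ J` are the sets
of non-matching edges of its paths.  The companion of a path, that is, the other path of the same
origamistrip, has the image under `m` as its set of non-matching edges; a strip of weight `w` has
`w + 1` edges on each path, and each path occurs `w` times.  Different strips share no covered
vertex, and all covered vertices are used. -/
structure IsBadgeFamily {V ι : Type*} (m : V → V) (C : ι → Set (Sym2 V)) (J : Finset ι) :
    Prop where
  aug : ∀ i ∈ J, ∃ L, IsAug m L ∧ C i = altEdges m L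
  count : ∀ i ∈ J, {j ∈ (J : Set ι) | C j = C i}.ncard + 1 = (C i).ncard
  count_image : ∀ i ∈ J, {j ∈ (J : Set ι) | C j = Sym2.map m '' C i}.ncard + 1 = (C i).ncard
  disj : ∀ i ∈ J, ∀ j ∈ J, C j = C i ∨ C j = Sym2.map m '' C i ∨
    ∀ v, m v ≠ v → v ∈ verts (C i) → v ∉ verts (C j)
  cover : ∀ v, m v ≠ v → ∃ i ∈ J, v ∈ verts (C i)

/-- The triangle formed by the uncovered vertex `a` and the matching edge at `p`. -/
def triangle {V : Type*} (m : V → V) (a p : V) : Set V := {a, p, m p}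

/-- The inverse of contracting the triangle on `a`, `g`, `m g`, for a path ending in `a`: its last
edge `s(z, a)` is replaced by `s(z, g)`, the matching edge at `g`, and `s(m g, a)`. -/
def expand {V : Type*} (m : V → V) (a g : V) (C : Set (Sym2 V)) : Set (Sym2 V) :=
  {e | (e ∈ C ∧ a ∉ e) ∨ (∃ z, s(z, a) ∈ C ∧ e = s(z, g)) ∨ e = s(a, m g)}

/-- The situation of the inductive step: a family of as many augmenting paths as there are covered
vertices, without rainbow augmenting path, and paths `C'` contained in their contractions along a
triangle.  Whenever two colours `i` and `j` provide the sides of the triangle, the other paths form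
a badge after the contraction. -/
structure TriangleContraction {V ι : Type*} (m : V → V) (C C' : ι → Set (Sym2 V)) (J : Finset ι)
    (a p : V) : Prop where
  invol : Function.Involutive m
  finite : {v | m v ≠ v}.Finite
  noRainbow : NoRainbow m C J
  aug : ∀ i ∈ J, ∃ L, IsAug m L ∧ C i = altEdges m L
  card : J.card = {v | m v ≠ v}.ncard
  free : m a = a
  covered : m p ≠ p
  aug' : ∀ i ∈ J, ∃ L, IsAug (contractMate m (triangle m a p)) L ∧
    C' i = altEdges (contractMate m (triangle m a p)) L
  sub : ∀ i ∈ J, C' i ⊆ Sym2.map (contract (triangle m a p) a) '' C i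
  badge : ∀ i ∈ J, ∀ j ∈ J, s(a, p) ∈ C i → s(a, m p) ∈ C j →
    ∀ J' : Finset ι, (∀ q, q ∈ J' ↔ q ∈ J ∧ q ≠ i ∧ q ≠ j) →
      IsBadgeFamily (contractMate m (triangle m a p)) C' J'

section Triangle

variable {V ι : Type*} {m : V → V} {C C' : ι → Set (Sym2 V)} {J : Finset ι} {a p : V}

lemma mem_triangle {v : V} : v ∈ triangle m a p ↔ v = a ∨ v = p ∨ v = m p := Iff.rfl

lemma triangle_symm (hm : Function.Involutive m) : triangle m a (m p) = triangle m a p := by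
  ext v
  rw [mem_triangle, mem_triangle, hm]
  tauto

lemma triangle_mate (hm : Function.Involutive m) (ha : m a = a) :
    ∀ v ∈ triangle m a p, m v ∈ triangle m a p := by
  rintro v (rfl | rfl | rfl)
  · rw [ha]; exact Or.inl rfl
  · exact Or.inr (Or.inr rfl)
  · rw [hm]; exact Or.inr (Or.inl rfl)

lemma triangle_eq_of_free (hm : Function.Involutive m) (hp : m p ≠ p) :
    ∀ v ∈ triangle m a p, m v = v → v = a := by
  rintro v (rfl | rfl | rfl) h
  · rfl
  · exact absurd h hp
  · exact absurd (hm.injective h) hp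

lemma isBlossom_triangle (hm : Function.Involutive m) (ha : m a = a) (hp : m p ≠ p)
    {E : Set (Sym2 V)} (h₁ : s(a, p) ∈ E) (h₂ : s(a, m p) ∈ E) :
    IsBlossom m E (triangle m a p) a := by
  have hne : a ≠ p := by rintro rfl; exact hp ha
  have hne' : a ≠ m p := by rintro rfl; exact hp (by rw [hm] at ha; exact ha.symm)
  have h := isBlossom_of_cycle (l := []) hm ha h₁
    (simple_cons.2 ⟨by simp [hne, hne'], List.pairwise_singleton _ _⟩) (by simpa using hp)
    (by simpa using h₂)
  convert h using 1
  ext v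
  simp only [mem_triangle, List.nil_append, List.mem_cons, List.not_mem_nil, or_false,
    Set.mem_ofPred_eq]
  constructor
  · rintro (rfl | rfl | rfl)
    · simp
    · simp
    · simp [hm p]
  · rintro ((rfl | rfl) | (h | h))
    · simp
    · simp
    · right; right; rw [← h, hm]
    · left; rw [← hm v, h, ha]

lemma diag_notMem_altEdges {L : List V} (hL : Simple m L) {v : V} :
    s(v, v) ∉ altEdges m L := by
  induction L with
  | nil => simp
  | cons y L ih =>
    cases L with
    | nil => simp
    | cons x L =>
      rw [simple_cons] at hL
      rintro (h | h)
      · rcases Sym2.eq_iff.1 h with ⟨h₁, h₂⟩ | ⟨h₁, h₂⟩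
        · exact (hL.1 x (by simp)).2 (h₁.symm.trans h₂)
        · exact (hL.1 x (by simp)).2 (h₂.symm.trans h₁)
      · exact ih hL.2 h

lemma altEdges_congr {m' : V → V} {L : List V} (h : ∀ v ∈ L, m v = m' v) (x : V) :
    altEdges m (L ++ [x]) = altEdges m' (L ++ [x]) := by
  induction L with
  | nil => simp
  | cons y L ih =>
    have ih := ih fun v hv => h v (List.mem_cons_of_mem _ hv)
    cases L with
    | nil => simp [h y (by simp)]
    | cons z L =>
      simp only [List.cons_append, altEdges_cons_cons] at ih ⊢
      rw [ih, h y (by simp)]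

lemma altEdges_append_pair (L : List V) (w x : V) :
    altEdges m (L ++ [w, x]) = insert s(x, m w) (altEdges m (L ++ [w])) := by
  rw [altEdges_append, Set.union_comm]
  simp

lemma image_image_mate (hm : Function.Involutive m) (X : Set (Sym2 V)) :
    Sym2.map m '' (Sym2.map m '' X) = X := by
  rw [← Set.image_comp, ← Sym2.map_comp, hm.comp_self, Sym2.map_id, Set.image_id]

lemma mem_image_mate (hm : Function.Involutive m) {X : Set (Sym2 V)} {x y : V} :
    s(x, y) ∈ Sym2.map m '' X ↔ s(m x, m y) ∈ X := by
  constructor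
  · rintro ⟨e, he, h⟩
    have : Sym2.map m (Sym2.map m e) = e := by
      rw [← Function.comp_apply (f := Sym2.map m), ← Sym2.map_comp, hm.comp_self, Sym2.map_id, id]
    rw [← Sym2.map_mk, ← h, this]
    exact he
  · intro h
    exact ⟨_, h, by simp [hm x, hm y]⟩

lemma expand_image (hm : Function.Involutive m) (ha : m a = a) (g : V) (X : Set (Sym2 V)) :
    Sym2.map m '' expand m a g X = expand m a (m g) (Sym2.map m '' X) := by
  ext e
  induction e with
  | _ x y =>
    rw [mem_image_mate hm]
    have h₁ : ∀ z, a = m z ↔ a = z := fun z =>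
      ⟨fun h => by rw [← hm z, ← h, ha], fun h => by rw [← h, ha]⟩
    refine or_congr (and_congr (mem_image_mate hm).symm (not_congr ?_)) (or_congr ?_ ?_)
    · rw [Sym2.mem_iff, Sym2.mem_iff, h₁, h₁]
    · constructor
      · rintro ⟨z, hz, h⟩
        refine ⟨m z, ?_, ?_⟩
        · rw [mem_image_mate hm, hm, ha]; exact hz
        · rw [← Sym2.map_mk, ← h, Sym2.map_mk, hm, hm]
      · rintro ⟨z, hz, h⟩
        rw [mem_image_mate hm, ha] at hz
        refine ⟨m z, hz, ?_⟩
        rw [← Sym2.map_mk, h, Sym2.map_mk, hm]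
    · constructor
      · intro h
        rw [← hm x, ← hm y, ← Sym2.map_mk, h, Sym2.map_mk, ha]
      · intro h
        rw [← Sym2.map_mk, h, Sym2.map_mk, ha, hm]

namespace TriangleContraction

variable (T : TriangleContraction m C C' J a p)

include T

/-- The two covered vertices of the triangle play the same role. -/
lemma symm : TriangleContraction m C C' J a (m p) := by
  have h := triangle_symm (a := a) (p := p) T.invol
  exact ⟨T.invol, T.finite, T.noRainbow, T.aug, T.card, T.free,
    fun h => T.covered (T.invol.injective h), by rw [h]; exact T.aug', by rw [h]; exact T.sub, by
      rw [h, T.invol]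
      exact fun i hi j hj h₁ h₂ J' hJ' => T.badge j hj i hi h₂ h₁ J' fun q => by
        rw [hJ']; tauto⟩

end TriangleContraction

end Triangle

/-! ### Lifting and classifying the paths of a contraction -/

section Step

variable {V ι : Type*} {m : V → V} {C C' : ι → Set (Sym2 V)} {J : Finset ι} {a p : V}

lemma verts_expand_iff {g v : V} {X : Set (Sym2 V)} (hva : v ≠ a) (hvg : v ≠ g) (hvg' : v ≠ m g) :
    v ∈ verts (expand m a g X) ↔ v ∈ verts X := by
  constructor
  · rintro ⟨e, ⟨he, -⟩ | ⟨z, hz, rfl⟩ | rfl, hve⟩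
    · exact ⟨e, he, hve⟩
    · rcases Sym2.mem_iff.1 hve with rfl | rfl
      · exact ⟨_, hz, by simp⟩
      · exact absurd rfl hvg
    · rcases Sym2.mem_iff.1 hve with rfl | rfl
      · exact absurd rfl hva
      · exact absurd rfl hvg'
  · rintro ⟨e, he, hve⟩
    by_cases hae : a ∈ e
    · induction e with
      | _ x y =>
        rcases Sym2.mem_iff.1 hae with rfl | rfl
        · rcases Sym2.mem_iff.1 hve with rfl | rfl
          · exact absurd rfl hva
          · exact ⟨s(v, g), Or.inr (Or.inl ⟨v, by rwa [Sym2.eq_swap], rfl⟩), by simp⟩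
        · rcases Sym2.mem_iff.1 hve with rfl | rfl
          · exact ⟨s(v, g), Or.inr (Or.inl ⟨v, he, rfl⟩), by simp⟩
          · exact absurd rfl hva
    · exact ⟨e, Or.inl ⟨he, hae⟩, hve⟩

lemma ncard_mem_or_eq {A B : Set ι} {l : ι} (hl : l ∉ B) (h : ∀ q, q ∈ A ↔ q ∈ B ∨ q = l)
    (hB : B.Finite) : A.ncard = B.ncard + 1 := by
  have : A = insert l B := by ext q; rw [h, Set.mem_insert_iff, or_comm]
  rw [this, Set.ncard_insert_of_notMem hl hB]

/-- The two sides of a triangle have different colours. -/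
lemma ne_of_sides (hm : Function.Involutive m) (ha : m a = a) (hp : m p ≠ p) {i j : ι}
    (haug : ∃ L, IsAug m L ∧ C i = altEdges m L) (h₁ : s(a, p) ∈ C i) (h₂ : s(a, m p) ∈ C j) :
    i ≠ j := by
  rintro rfl
  obtain ⟨L, hL, h⟩ := haug
  rw [h, Sym2.eq_swap] at h₁ h₂
  obtain ⟨l, hl, hE⟩ := hL.exists_head hm ha h₁
  rw [← hE] at h₂
  obtain ⟨r, hr⟩ := mem_altEdges_head hm hl.1 (z := m p) (by rwa [ha])
  exact hp (List.cons.inj hr).1.symm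

/-- A rainbow augmenting path of the contraction of a triangle with sides of colours `i` and `j`
lifts to a rainbow augmenting path. -/
lemma NoRainbow.contract_triangle (hm : Function.Involutive m) (h : NoRainbow m C J)
    (ha : m a = a) (hp : m p ≠ p) {i j : ι} (hi : i ∈ J) (hj : j ∈ J) (hij : i ≠ j)
    (h₁ : s(a, p) ∈ C i) (h₂ : s(a, m p) ∈ C j) {J' : Finset ι}
    (hJ' : ∀ q, q ∈ J' → q ∈ J ∧ q ≠ i ∧ q ≠ j)
    (hsub : ∀ q ∈ J', C' q ⊆ Sym2.map (contract (triangle m a p) a) '' C q) :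
    NoRainbow (contractMate m (triangle m a p)) C' J' := by
  classical
  intro K hK x hx haug
  have : Nonempty (Sym2 V) := ⟨s(a, p)⟩
  have hx' : ∀ q ∈ K, ∃ e ∈ C q, Sym2.map (contract (triangle m a p) a) e = x q :=
    fun q hq => hsub q (hK hq) (hx q hq)
  choose! y hy hyx using hx'
  set y' : ι → Sym2 V := fun q => if q = i then s(a, p) else if q = j then s(a, m p) else y q
  have hi' : y' i = s(a, p) := if_pos rfl
  have hj' : y' j = s(a, m p) := by simp [y', hij.symm]
  have hq' : ∀ q ∈ K, y' q = y q := fun q hq => by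
    have := hJ' q (hK hq)
    simp [y', this.2.1, this.2.2]
  refine h (insert i (insert j K)) ?_ y' ?_ ?_
  · exact Finset.insert_subset hi (Finset.insert_subset hj fun q hq => (hJ' q (hK hq)).1)
  · intro q hq
    rw [Finset.mem_insert, Finset.mem_insert] at hq
    rcases hq with rfl | rfl | hq
    · rwa [hi']
    · rwa [hj']
    · rw [hq' q hq]; exact hy q hq
  · refine (isBlossom_triangle hm ha hp (E := y' '' (insert i (insert j K) :
      Finset ι)) ⟨i, by simp, hi'⟩ ⟨j, by simp, hj'⟩).hasAug_lift hm (haug.mono ?_)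
    rintro _ ⟨q, hq, rfl⟩
    exact ⟨_, ⟨q, by simp [Finset.mem_coe.1 hq], rfl⟩, by rw [hq' q hq, hyx q hq]⟩

namespace TriangleContraction

variable (T : TriangleContraction m C C' J a p)

include T

lemma a_ne_p : a ≠ p := by
  have := T.covered
  have ha := T.free
  rintro rfl; exact this ha

lemma a_ne_mate : a ≠ m p := T.symm.a_ne_p

lemma invol' : Function.Involutive (contractMate m (triangle m a p)) :=
  contractMate_involutive T.invol (triangle_mate T.invol T.free)

lemma mate_notMem {v : V} (hv : v ∉ triangle m a p) : m v ∉ triangle m a p := fun h =>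
  hv (by simpa [T.invol v] using triangle_mate T.invol T.free _ h)

lemma hasAug {i : ι} (hi : i ∈ J) : HasAug m (C i) := by
  obtain ⟨L, hL, h⟩ := T.aug i hi
  exact ⟨L, hL, h.ge⟩

lemma ne {i j : ι} (hi : i ∈ J) (h₁ : s(a, p) ∈ C i) (h₂ : s(a, m p) ∈ C j) : i ≠ j :=
  ne_of_sides T.invol T.free T.covered (T.aug i hi) h₁ h₂

/-- The base is the only vertex of the triangle on the contracted paths. -/
lemma eq_of_mem {q : ι} (hq : q ∈ J) {e : Sym2 V} (he : e ∈ C' q) {v : V} (hv : v ∈ e)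
    (hvB : v ∈ triangle m a p) : v = a := by
  obtain ⟨e', -, rfl⟩ := T.sub q hq he
  obtain ⟨w, -, rfl⟩ := Sym2.mem_map.1 hv
  exact (contract_mem hvB).2

lemma not_diag {q : ι} (hq : q ∈ J) (v : V) : s(v, v) ∉ C' q := by
  obtain ⟨L, hL, h⟩ := T.aug' q hq
  rw [h]
  exact diag_notMem_altEdges hL.1

lemma p_notMem {q : ι} (hq : q ∈ J) (z : V) : s(z, p) ∉ C' q := fun h =>
  T.a_ne_p (T.eq_of_mem hq h (Sym2.mem_mk_right _ _) (Or.inr (Or.inl rfl))).symm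

lemma mate_p_notMem {q : ι} (hq : q ∈ J) (z : V) : s(z, m p) ∉ C' q := T.symm.p_notMem hq z

/-- On the contracted paths, the contracted matching and the original one agree. -/
lemma image_contractMate {q : ι} (hq : q ∈ J) :
    Sym2.map (contractMate m (triangle m a p)) '' C' q = Sym2.map m '' C' q := by
  apply Set.image_congr
  intro e he
  apply Sym2.map_congr
  intro v hv
  by_cases hvB : v ∈ triangle m a p
  · rw [contractMate_of_mem hvB, T.eq_of_mem hq he hv hvB, T.free]
  · exact contractMate_of_notMem hvB

lemma noRainbow' {i j : ι} (hi : i ∈ J) (hj : j ∈ J) (h₁ : s(a, p) ∈ C i)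
    (h₂ : s(a, m p) ∈ C j) {J' : Finset ι} (hJ' : ∀ q, q ∈ J' → q ∈ J ∧ q ≠ i ∧ q ≠ j) :
    NoRainbow (contractMate m (triangle m a p))
      (fun q => Sym2.map (contract (triangle m a p) a) '' C q) J' :=
  T.noRainbow.contract_triangle T.invol T.free T.covered hi hj (T.ne hi h₁ h₂) h₁ h₂ hJ'
    fun _ _ => subset_rfl

/-- For a colour other than the two providing the sides of the triangle, the path is its contracted
path, or arises from it by inserting the matching edge and one of the sides of the triangle at the
end. -/
lemma classify_aux {i j : ι} (hi : i ∈ J) (hj : j ∈ J) (h₁ : s(a, p) ∈ C i)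
    (h₂ : s(a, m p) ∈ C j) {q : ι} (hq : q ∈ J) (hqi : q ≠ i) (hqj : q ≠ j) :
    C q = C' q ∨ ∃ g, (g = p ∨ g = m p) ∧ C q = expand m a g (C' q) ∧
      (C q).ncard = (C' q).ncard + 1 ∧
      ∃ z, s(z, a) ∈ C' q := by
  classical
  set B := triangle m a p with hB
  set m' := contractMate m B with hm'
  have hmate := triangle_mate (p := p) T.invol T.free
  have haB : a ∈ B := Or.inl rfl
  -- choose orientations such that both paths have the same head, which is not `a`
  obtain ⟨L', hL', hC', hhead⟩ : ∃ L', IsAug m' L' ∧ C' q = altEdges m' L' ∧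
      ∀ l, L' ≠ a :: l := by
    obtain ⟨L', hL', hC'⟩ := T.aug' q hq
    by_cases h : ∃ l, L' = a :: l
    · obtain ⟨l, rfl⟩ := h
      refine ⟨_, hL'.reverse T.invol', by rw [altEdges_reverse T.invol', hC'], fun r hr => ?_⟩
      obtain ⟨hs, b, l₀, c, heq, hb, hc, -⟩ := hL'
      rw [heq] at hr hs
      simp [hc] at hr
      have := (List.cons.inj heq).1
      exact ((simple_cons.1 hs).1 c (by simp)).1 (hr.1.trans this)
    · exact ⟨L', hL', hC', fun l hl => h ⟨l, hl⟩⟩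
  have hL'₀ := hL'
  obtain ⟨hs', b, l', c, rfl, hb, hc, hl'⟩ := hL'
  have hba : b ≠ a := fun h => hhead _ (by rw [h])
  have hl'B : ∀ v ∈ l', v ∉ B := fun v hv h => hl' v hv (contractMate_of_mem h)
  have hbfirst : ∃ x, s(x, b) ∈ C' q := by
    obtain ⟨b₀, x, l₀, heq, hb₀⟩ := hL'₀.exists_cons
    obtain rfl := (List.cons.inj heq).1
    refine ⟨x, ?_⟩
    rw [hC', heq, altEdges_cons_cons, hb₀]
    exact Set.mem_insert _ _
  obtain ⟨x, hx⟩ := hbfirst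
  have hbB : b ∉ B := fun h => hba (T.eq_of_mem hq hx (Sym2.mem_mk_right _ _) h)
  have hbm : m b = b := by rw [hm', contractMate_of_notMem hbB] at hb; exact hb
  obtain ⟨l, hL, hC⟩ : ∃ l, IsAug m (b :: l) ∧ C q = altEdges m (b :: l) := by
    obtain ⟨L, hL, hC⟩ := T.aug q hq
    obtain ⟨g, h, hgh, -, hh⟩ := exists_of_mem_contract (T.sub q hq hx)
    obtain rfl : h = b := (contract_notMem (by rwa [hh]) haB).trans hh
    rw [hC] at hgh
    obtain ⟨l, hl, hE⟩ := hL.exists_head T.invol hbm hgh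
    exact ⟨_, hl, by rw [hC, hE]⟩
  obtain ⟨g, r, rfl, hg⟩ := exists_append_of_altEdges_subset T.invol hmate haB l' b l hL.1
    (fun v hv => (List.mem_cons.1 hv).elim (fun h => h ▸ hbB) (hl'B v)) hs' (by rw [← hC', ← hC]; exact T.sub q hq)
  -- an uncovered vertex other than `b` is at the other end of the path
  have hfree : m g = g → r = [] := by
    intro hgg
    obtain ⟨-, b₁, l₁, c₁, heq, -, -, hl₁⟩ := hL
    have heq := (List.cons.inj heq).2
    rcases List.eq_nil_or_concat r with rfl | ⟨r', d, rfl⟩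
    · rfl
    · rw [List.concat_eq_append, ← List.cons_append, ← List.append_assoc] at heq
      have := (List.append_inj' heq rfl).1
      exact absurd hgg (hl₁ g (by rw [← this]; simp))
  have hblB : ∀ v ∈ b :: l', m v = m' v := by
    intro v hv
    rw [hm', contractMate_of_notMem]
    rcases List.mem_cons.1 hv with rfl | hv
    · exact hbB
    · exact hl'B v hv
  have hsame : g = c → m g = g → C q = C' q := by
    rintro rfl hgg
    obtain rfl := hfree hgg
    rw [hC, hC', ← List.cons_append]
    exact altEdges_congr hblB g
  by_cases hgB : g ∈ B
  swap
  · rw [contract_of_notMem hgB] at hg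
    subst hg
    rw [hm', contractMate_of_notMem hgB] at hc
    exact Or.inl (hsame rfl hc)
  rw [contract_of_mem hgB] at hg
  subst hg
  by_cases hga : g = a
  · exact Or.inl (hsame hga (by rw [hga, T.free]))
  have hgp : g = p ∨ g = m p := (mem_triangle.1 hgB).resolve_left hga
  have hgcov : m g ≠ g := fun h => hga (triangle_eq_of_free T.invol T.covered g hgB h)
  have hmgB := hmate g hgB
  obtain ⟨h, r, rfl⟩ : ∃ h r', r = h :: r' := by
    cases r with
    | nil =>
      obtain ⟨l₁, c₁, hl₁, hc₁⟩ := hL.rooted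
      rw [← List.cons_append] at hl₁
      have := (List.append_inj' hl₁ rfl).2
      simp only [List.cons.injEq, and_true] at this
      exact absurd (this ▸ hc₁) hgcov
    | cons h r => exact ⟨h, r, rfl⟩
  have hsL : Simple m ((b :: l') ++ g :: h :: r) := by
    rw [List.cons_append]; exact hL.1
  have hgh := (simple_cons.1 hsL.of_append_right).1 h (by simp)
  have hedge : s(h, m g) ∈ C q := by
    rw [hC, ← List.cons_append]
    exact altEdges_subset_append_right _ _ (Set.mem_insert _ _)
  have hab : h = a := by
    by_contra hha
    -- otherwise the contraction of this edge joins `a` to a vertex `h` off the contracted path, which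
    -- is uncovered or on another strip of the contracted badge
    have hhB : h ∉ B := by
      rintro (h₃ | h₃ | h₃)
      · exact hha h₃
      · rcases hgp with rfl | rfl
        · exact hgh.1 h₃
        · exact hgh.2 (by rw [h₃, T.invol])
      · rcases hgp with rfl | rfl
        · exact hgh.2 h₃
        · exact hgh.1 h₃
    set J' := J.filter (fun r => r ≠ i ∧ r ≠ j) with hJ'
    have hJ'mem : ∀ r, r ∈ J' ↔ r ∈ J ∧ r ≠ i ∧ r ≠ j := fun r => by rw [hJ', Finset.mem_filter]
    have hno := T.noRainbow' hi hj h₁ h₂ (J' := J') (fun r hr => (hJ'mem r).1 hr)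
    have hqJ' : q ∈ J' := (hJ'mem q).2 ⟨hq, hqi, hqj⟩
    have hcontr : s(h, a) ∈ Sym2.map (contract B a) '' C q := by
      refine ⟨_, hedge, ?_⟩
      rw [Sym2.map_mk, contract_of_notMem hhB, contract_of_mem hmgB]
    have ha' : m' a = a := contractMate_of_mem haB
    by_cases hhm : m' h = h
    · exact hno.not_free_edge hqJ' hhm ha' hha hcontr
    · have hbadge := T.badge i hi j hj h₁ h₂ J' hJ'mem
      -- `h` is not on the contracted path
      have hhq : h ∉ verts (C' q) := by
        rw [hC', hL'₀.mem_verts_iff T.invol' hhm, contractMate_of_notMem hhB]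
        have key : ∀ v ∈ b :: l', h ≠ v ∧ h ≠ m v := fun v hv =>
          (List.pairwise_append.1 hsL).2.2 v hv h (by simp)
        rw [← List.cons_append, List.mem_append, List.mem_append]
        simp only [List.mem_singleton]
        rintro ((h₃ | h₃) | (h₃ | h₃))
        · exact (key h h₃).1 rfl
        · exact hha h₃
        · exact (key _ h₃).2 (by rw [T.invol])
        · exact hha (by rw [← T.invol h, h₃, T.free])
      obtain ⟨r₀, hr₀, hhr₀⟩ := hbadge.cover h hhm
      obtain ⟨L₀, hL₀, hC₀⟩ := hbadge.aug r₀ hr₀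
      have hcount := hbadge.count r₀ hr₀
      have hcount' : {r ∈ (J' : Set ι) | C' r = Sym2.map m' '' C' r₀}.ncard + 1 = (C' r₀).ncard :=
        hbadge.count_image r₀ hr₀
      have hlen := ncard_altEdges T.invol' hL₀.1
      rw [← hC₀] at hlen
      have hne : C' q ≠ C' r₀ := fun h' => hhq (h' ▸ hhr₀)
      have hne' : C' q ≠ Sym2.map m' '' C' r₀ := by
        intro h'
        apply hhq
        rw [h', hC₀, ← altEdges_map, (hL₀.map T.invol').mem_verts_iff T.invol' hhm]
        rw [hC₀, hL₀.mem_verts_iff T.invol' hhm] at hhr₀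
        rcases hhr₀ with h₃ | h₃
        · exact Or.inr (List.mem_map_of_mem h₃)
        · exact Or.inl (List.mem_map.2 ⟨_, h₃, T.invol' h⟩)
      refine hno.not_edge_to_free T.invol' hL₀ (A := J'.filter fun r => C' r = C' r₀)
        (A' := J'.filter fun r => C' r = Sym2.map m' '' C' r₀) (Finset.filter_subset _ _)
        (Finset.filter_subset _ _) ?_ ?_ ?_ ?_ hqJ' ?_ ?_ hhm (hC₀ ▸ hhr₀) ha' hcontr
      · intro r hr
        rw [Finset.mem_filter] at hr
        rw [← hC₀, ← hr.2]
        exact T.sub r ((hJ'mem r).1 hr.1).1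
      · intro r hr
        rw [Finset.mem_filter] at hr
        rw [← hC₀, ← hr.2]
        exact T.sub r ((hJ'mem r).1 hr.1).1
      · rw [← Set.ncard_coe_finset, Finset.coe_filter]
        simp only [Finset.mem_coe] at hcount
        omega
      · rw [← Set.ncard_coe_finset, Finset.coe_filter]
        simp only [Finset.mem_coe] at hcount'
        omega
      · simp [hne]
      · simp [hne']
  subst hab
  have hr : r = [] := by
    obtain ⟨-, b₁, l₁, c₁, heq, -, -, hl₁⟩ := hL
    have heq := (List.cons.inj heq).2
    rcases List.eq_nil_or_concat r with rfl | ⟨r', d, rfl⟩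
    · rfl
    · rw [List.concat_eq_append, ← List.cons_append, ← List.cons_append, ← List.append_assoc]
        at heq
      have := (List.append_inj' heq rfl).1
      exact absurd T.free (hl₁ h (by rw [← this]; simp))
  subst hr
  obtain ⟨k, w, hkw⟩ : ∃ k w, b :: l' = k ++ [w] := by
    rcases List.eq_nil_or_concat (b :: l') with h | ⟨k, w, h⟩
    · simp at h
    · exact ⟨k, w, by rw [h, List.concat_eq_append]⟩
  have hCk : C q = insert s(h, m g) (insert s(g, m w) (altEdges m (k ++ [w]))) := by
    rw [hC, ← List.cons_append, hkw, List.append_assoc, List.singleton_append]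
    have := altEdges_append_pair (m := m) (k ++ [w]) g h
    rw [List.append_assoc, List.append_assoc] at this
    rw [← altEdges_append_pair]
    exact this
  have hC'k : C' q = insert s(h, m w) (altEdges m (k ++ [w])) := by
    rw [hC', ← List.cons_append, ← altEdges_congr hblB, hkw, List.append_assoc,
      List.singleton_append, altEdges_append_pair]
  have hkB : ∀ e ∈ altEdges m (k ++ [w]), h ∉ e := by
    intro e he hhe
    obtain ⟨u, v, hu, hv, rfl⟩ := exists_mem_of_mem_altEdges he
    have key : ∀ v ∈ b :: l', v ∉ B := by
      intro v hv
      rcases List.mem_cons.1 hv with rfl | hv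
      · exact hbB
      · exact hl'B v hv
    rw [← hkw] at hu hv
    rcases Sym2.mem_iff.1 hhe with rfl | rfl
    · exact key _ hu haB
    · exact T.mate_notMem (key v hv) haB
  have hwh : m w ≠ h := fun h' => by
    have : s(h, h) ∈ C' q := by rw [hC'k, h']; exact Set.mem_insert _ _
    exact T.not_diag hq h this
  refine Or.inr ⟨g, hgp, ?_, ?_, m w, ?_⟩
  · ext e
    simp only [expand, Set.mem_ofPred_eq, hCk, hC'k, Set.mem_insert_iff]
    constructor
    · rintro (rfl | rfl | he)
      · exact Or.inr (Or.inr rfl)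
      · exact Or.inr (Or.inl ⟨m w, Or.inl Sym2.eq_swap, Sym2.eq_swap⟩)
      · exact Or.inl ⟨Or.inr he, hkB e he⟩
    · rintro (⟨rfl | he, hhe⟩ | ⟨z, hz | hz, rfl⟩ | rfl)
      · simp at hhe
      · exact Or.inr (Or.inr he)
      · rcases Sym2.eq_iff.1 hz with ⟨h₃, h₄⟩ | ⟨h₃, -⟩
        · exact absurd h₄.symm hwh
        · rw [h₃]; exact Or.inr (Or.inl Sym2.eq_swap)
      · exact absurd (Sym2.mem_mk_right _ _) (hkB _ hz)
      · exact Or.inl rfl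
  · rw [hC, hC', ncard_altEdges T.invol hL.1, ncard_altEdges T.invol' hL'₀.1]
    simp
  · rw [hC'k, Sym2.eq_swap]; exact Set.mem_insert _ _

end TriangleContraction

end Step

/-! ### The inductive step -/

/-- The colours of `J` other than `i` and `j`. -/
noncomputable def others {ι : Type*} (J : Finset ι) (i j : ι) : Finset ι :=
  open Classical in J.filter fun q => q ≠ i ∧ q ≠ j

section Step

variable {V ι : Type*} {m : V → V} {C C' : ι → Set (Sym2 V)} {J : Finset ι} {a p : V}

lemma mem_others {i j q : ι} : q ∈ others J i j ↔ q ∈ J ∧ q ≠ i ∧ q ≠ j := by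
  classical
  exact Finset.mem_filter

namespace TriangleContraction

variable (T : TriangleContraction m C C' J a p)

include T

lemma badge_others {i j : ι} (hi : i ∈ J) (hj : j ∈ J) (h₁ : s(a, p) ∈ C i)
    (h₂ : s(a, m p) ∈ C j) :
    IsBadgeFamily (contractMate m (triangle m a p)) C' (others J i j) :=
  T.badge i hi j hj h₁ h₂ _ fun _ => mem_others

lemma two_le_ncard {i j : ι} (hi : i ∈ J) (hj : j ∈ J) (h₁ : s(a, p) ∈ C i)
    (h₂ : s(a, m p) ∈ C j) {q : ι} (hq : q ∈ others J i j) : 2 ≤ (C' q).ncard := by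
  have h := (T.badge_others hi hj h₁ h₂).count q hq
  have : 0 < {j_1 ∈ (others J i j : Set ι) | C' j_1 = C' q}.ncard := by
    rw [Set.ncard_pos ((Finset.finite_toSet _).subset (Set.sep_subset _ _))]
    exact ⟨q, hq, rfl⟩
  omega

lemma ne_image {i j : ι} (hi : i ∈ J) (hj : j ∈ J) (h₁ : s(a, p) ∈ C i)
    (h₂ : s(a, m p) ∈ C j) {q : ι} (hq : q ∈ others J i j) : C' q ≠ Sym2.map m '' C' q := by
  have h := T.two_le_ncard hi hj h₁ h₂ hq
  have hqJ := (mem_others.1 hq).1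
  obtain ⟨L, hL, hC⟩ := T.aug' q hqJ
  have := hL.ne_image T.invol' (hC ▸ h)
  rwa [← hC, T.image_contractMate hqJ] at this

lemma count {i j : ι} (hi : i ∈ J) (hj : j ∈ J) (h₁ : s(a, p) ∈ C i)
    (h₂ : s(a, m p) ∈ C j) {q : ι} (hq : q ∈ others J i j) :
    {r ∈ (others J i j : Set ι) | C' r = C' q}.ncard + 1 = (C' q).ncard ∧
    {r ∈ (others J i j : Set ι) | C' r = Sym2.map m '' C' q}.ncard + 1 = (C' q).ncard := by
  have h := T.badge_others hi hj h₁ h₂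
  rw [← T.image_contractMate (mem_others.1 hq).1]
  exact ⟨h.count q hq, h.count_image q hq⟩

/-- Every path occurring in the contracted badge has a companion there. -/
lemma exists_companion {i j : ι} (hi : i ∈ J) (hj : j ∈ J) (h₁ : s(a, p) ∈ C i)
    (h₂ : s(a, m p) ∈ C j) {q : ι} (hq : q ∈ others J i j) :
    ∃ r ∈ others J i j, C' r = Sym2.map m '' C' q := by
  have h := (T.count hi hj h₁ h₂ hq).2
  have h' := T.two_le_ncard hi hj h₁ h₂ hq
  have : 0 < {r ∈ (others J i j : Set ι) | C' r = Sym2.map m '' C' q}.ncard := by omega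
  rw [Set.ncard_pos ((Finset.finite_toSet _).subset (Set.sep_subset _ _))] at this
  exact this

/-- Two colours that provide the same side of the triangle have the same contracted path: removing
one or the other leaves a badge, and in a badge a path occurs as often as its companion. -/
lemma eq_of_same_side {i j l : ι} (hi : i ∈ J) (hj : j ∈ J) (hl : l ∈ J) (h₁ : s(a, p) ∈ C i)
    (h₂ : s(a, m p) ∈ C j) (h₃ : s(a, m p) ∈ C l) : C' j = C' l := by
  by_cases hjl : j = l
  · rw [hjl]
  have hij := T.ne hi h₁ h₂
  have hil := T.ne hi h₁ h₃
  have hlo : l ∈ others J i j := mem_others.2 ⟨hl, hil.symm, Ne.symm hjl⟩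
  by_contra hne
  set S : Set (Sym2 V) → Set ι := fun X => {q | q ∈ J ∧ q ≠ i ∧ q ≠ j ∧ q ≠ l ∧ C' q = X} with hS
  have hfin : ∀ X, (S X).Finite := fun X => J.finite_toSet.subset fun q hq => hq.1
  have c₁ := T.count hi hj h₁ h₂ hlo
  have hX := T.ne_image hi hj h₁ h₂ hlo
  -- without `j`, the path of `l` is counted, and its companions are those in `S`
  have e₁ : {r ∈ (others J i j : Set ι) | C' r = C' l}.ncard = (S (C' l)).ncard + 1 := by
    refine ncard_mem_or_eq (l := l) (fun h => h.2.2.2.1 rfl) (fun q => ?_) (hfin _)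
    simp only [hS, Set.mem_ofPred_eq, Finset.mem_coe, mem_others]
    by_cases hql : q = l
    · subst hql; simp [hl, hil.symm, Ne.symm hjl]
    · simp only [hql, or_false]; tauto
  have e₂ : {r ∈ (others J i j : Set ι) | C' r = Sym2.map m '' C' l} =
      S (Sym2.map m '' C' l) := by
    ext q
    simp only [hS, Set.mem_ofPred_eq, Finset.mem_coe, mem_others]
    by_cases hql : q = l
    · subst hql; simp [hX]
    · tauto
  rw [e₁, e₂] at c₁
  have hpos : 0 < (S (Sym2.map m '' C' l)).ncard := by omega
  rw [Set.ncard_pos (hfin _)] at hpos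
  obtain ⟨r, hrJ, hri, hrj, hrl, hr⟩ := hpos
  have hro : r ∈ others J i l := mem_others.2 ⟨hrJ, hri, hrl⟩
  have c₂ := T.count hi hl h₁ h₃ hro
  rw [hr, image_image_mate T.invol] at c₂
  -- without `l`, the class of `C' l` loses a path, while its companions remain
  have e₃ : {q ∈ (others J i l : Set ι) | C' q = C' l} = S (C' l) := by
    ext q
    simp only [hS, Set.mem_ofPred_eq, Finset.mem_coe, mem_others]
    by_cases hqj : q = j
    · subst hqj; simp [hne]
    · tauto
  have e₄ : (S (Sym2.map m '' C' l)).ncard ≤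
      {q ∈ (others J i l : Set ι) | C' q = Sym2.map m '' C' l}.ncard := by
    refine Set.ncard_le_ncard (fun q hq => ?_)
      ((Finset.finite_toSet _).subset (Set.sep_subset _ _))
    exact ⟨mem_others.2 ⟨hq.1, hq.2.1, hq.2.2.2.1⟩, hq.2.2.2.2⟩
  rw [e₃] at c₂
  omega

lemma side_notMem_expand {q : ι} (hq : q ∈ J) : s(a, p) ∉ expand m a p (C' q) := by
  rintro (⟨-, h⟩ | ⟨z, hz, h⟩ | h)
  · simp at h
  · rcases Sym2.eq_iff.1 h with ⟨rfl, -⟩ | ⟨h, -⟩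
    · exact T.not_diag hq _ hz
    · exact T.a_ne_p h
  · rcases Sym2.eq_iff.1 h with ⟨-, h⟩ | ⟨h, -⟩
    · exact T.covered h.symm
    · exact T.a_ne_mate h

/-- A path ending with a side of the triangle expands its contracted path. -/
lemma eq_expand {i j : ι} (hi : i ∈ J) (hj : j ∈ J) (h₁ : s(a, p) ∈ C i)
    (h₂ : s(a, m p) ∈ C j) {q : ι} (hq : q ∈ others J i j) (h : s(a, m p) ∈ C q) :
    C q = expand m a p (C' q) ∧ (C q).ncard = (C' q).ncard + 1 ∧ ∃ z, s(z, a) ∈ C' q := by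
  obtain ⟨hqJ, hqi, hqj⟩ := mem_others.1 hq
  rcases T.classify_aux hi hj h₁ h₂ hqJ hqi hqj with h' | ⟨g, rfl | rfl, h₃, h₄⟩
  · rw [h'] at h; exact absurd h (T.mate_p_notMem hqJ a)
  · exact ⟨h₃, h₄⟩
  · rw [h₃] at h; exact absurd h (T.symm.side_notMem_expand hqJ)

/-- A path without side of the triangle is its contracted path. -/
lemma eq_of_no_side {i j : ι} (hi : i ∈ J) (hj : j ∈ J) (h₁ : s(a, p) ∈ C i)
    (h₂ : s(a, m p) ∈ C j) {q : ι} (hq : q ∈ others J i j) (h : s(a, p) ∉ C q)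
    (h' : s(a, m p) ∉ C q) : C q = C' q := by
  obtain ⟨hqJ, hqi, hqj⟩ := mem_others.1 hq
  rcases T.classify_aux hi hj h₁ h₂ hqJ hqi hqj with h₃ | ⟨g, rfl | rfl, h₃, -⟩
  · exact h₃
  · exact absurd (h₃ ▸ Or.inr (Or.inr rfl)) h'
  · refine absurd (h₃ ▸ Or.inr (Or.inr ?_)) h
    rw [T.invol]

/-- If a further path uses the side `s(a, m p)`, then it and the path providing this side expand the
same contracted path, and all companions of the latter are expanded with the other side. -/
lemma expand_of_side {i j l : ι} (hi : i ∈ J) (hj : j ∈ J) (h₁ : s(a, p) ∈ C i)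
    (h₂ : s(a, m p) ∈ C j) (hl : l ∈ others J i j) (h₃ : s(a, m p) ∈ C l) :
    C' j = C' l ∧ C j = expand m a p (C' l) ∧ C l = expand m a p (C' l) ∧
      (C l).ncard = (C' l).ncard + 1 ∧
      ∀ r ∈ others J i j, C' r = Sym2.map m '' C' l →
        s(a, p) ∈ C r ∧ C r = expand m a (m p) (C' r) := by
  classical
  obtain ⟨hlJ, hli, hlj⟩ := mem_others.1 hl
  have hij := T.ne hi h₁ h₂
  have hjl := T.eq_of_same_side hi hj hlJ h₁ h₂ h₃
  obtain ⟨e₁, e₂, z, hz⟩ := T.eq_expand hi hj h₁ h₂ hl h₃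
  obtain ⟨e₃, -⟩ := T.eq_expand hi hlJ h₁ h₃ (q := j)
    (mem_others.2 ⟨hj, hij.symm, Ne.symm hlj⟩) h₂
  refine ⟨hjl, by rw [e₃, hjl], e₁, e₂, fun r hr hrl => ?_⟩
  obtain ⟨hrJ, hri, hrj⟩ := mem_others.1 hr
  have hne := T.ne_image hi hj h₁ h₂ hl
  have hmp : s(a, m p) ∉ C r := by
    intro h
    have := T.eq_of_same_side hi hj hrJ h₁ h₂ h
    exact hne (by rw [← hrl, ← this, hjl])
  have hp : s(a, p) ∈ C r := by
    by_contra h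
    have hdir := T.eq_of_no_side hi hj h₁ h₂ hr h hmp
    -- otherwise there is a rainbow blossom with two matching edges and three colours, on the cycle
    -- `a`, `m p`, `p`, `z`, `m z`
    have hza : z ≠ a := by rintro rfl; exact T.not_diag hlJ _ hz
    have hzB : z ∉ triangle m a p := fun h => hza (T.eq_of_mem hlJ hz (by simp) h)
    have hza' : s(a, m z) ∈ C r := by
      rw [hdir, hrl, mem_image_mate T.invol, T.free, T.invol, Sym2.eq_swap]; exact hz
    have hzp : s(p, z) ∈ C l := by
      rw [e₁, Sym2.eq_swap]; exact Or.inr (Or.inl ⟨z, hz, rfl⟩)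
    have hzcov : m z ≠ z := by
      intro h
      exact T.noRainbow.not_free_edge hrJ T.free h hza.symm (by rwa [h] at hza')
    have hrl' : r ≠ l := by rintro rfl; exact hne hrl
    set x : ι → Sym2 V := fun q =>
      if q = j then s(a, m p) else if q = l then s(p, z) else s(a, m z) with hx
    have xj : x j = s(a, m p) := if_pos rfl
    have xl : x l = s(p, z) := by simp [hx, hlj]
    have xr : x r = s(a, m z) := by simp [hx, hrj, hrl']
    have hK : ({j, l, r} : Finset ι) ⊆ J := by
      intro q hq
      simp only [Finset.mem_insert, Finset.mem_singleton] at hq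
      rcases hq with rfl | rfl | rfl <;> assumption
    have hmza : m z ≠ a := fun h => hza (by rw [← T.invol z, h, T.free])
    have hzp' : z ≠ p := fun h => hzB (Or.inr (Or.inl h))
    have hzmp : z ≠ m p := fun h => hzB (Or.inr (Or.inr h))
    have hmzp : p ≠ m z := fun h => hzmp (by rw [h, T.invol])
    have := T.noRainbow.cycle_length_le T.invol T.finite (fun q hq => T.hasAug hq) T.card hK x
      (by
        intro q hq
        simp only [Finset.mem_insert, Finset.mem_singleton] at hq
        rcases hq with rfl | rfl | rfl
        · rwa [xj]
        · rwa [xl]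
        · rwa [xr]) (a := a) (p := m z) (l := [p]) T.free ⟨r, by simp, xr⟩
      (by
        simp only [Simple, List.cons_append, List.nil_append, List.pairwise_cons,
          List.mem_cons, List.not_mem_nil, or_false, forall_eq_or_imp, forall_eq, T.invol z,
          List.Pairwise.nil, and_true, false_imp_iff, implies_true]
        exact ⟨⟨⟨hmzp, hzp'.symm⟩, hmza.symm, hza.symm⟩, T.a_ne_p, T.a_ne_mate⟩)
      (by
        simp only [List.mem_cons, List.not_mem_nil, or_false, forall_eq_or_imp, forall_eq]
        exact ⟨fun h => hzcov (T.invol.injective h), T.covered⟩)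
      (by
        simp only [List.cons_append, List.nil_append, altEdges_cons_cons, altEdges_singleton,
          Set.insert_subset_iff, Set.empty_subset, and_true, T.invol z]
        exact ⟨⟨l, by simp, xl⟩, ⟨j, by simp, xj⟩⟩)
    have hcard := Finset.card_le_three (a := j) (b := l) (c := r)
    simp only [List.length_cons, List.length_nil] at this
    omega
  refine ⟨hp, (T.symm.eq_expand hj hi h₂ (by rwa [T.invol]) (q := r)
    (mem_others.2 ⟨hrJ, hrj, hri⟩) (by rwa [T.invol])).1⟩

/-- The inductive step when the contracted triangle is part of a longer strip. -/
lemma isBadgeFamily_of_side {i j l : ι} (hi : i ∈ J) (hj : j ∈ J) (h₁ : s(a, p) ∈ C i)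
    (h₂ : s(a, m p) ∈ C j) (hl : l ∈ others J i j) (h₃ : s(a, m p) ∈ C l) :
    IsBadgeFamily m C J := by
  have hij := T.ne hi h₁ h₂
  have hbadge := T.badge_others hi hj h₁ h₂
  have hne := T.ne_image hi hj h₁ h₂ hl
  have hsymm : ∀ q, q ∈ others J i j ↔ q ∈ others J j i := fun q => by
    simp only [mem_others]; tauto
  obtain ⟨r, hr, hrl⟩ := T.exists_companion hi hj h₁ h₂ hl
  obtain ⟨f₁, f₂, f₃, f₄, f₅⟩ := T.expand_of_side hi hj h₁ h₂ hl h₃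
  obtain ⟨hr₁, hr₂⟩ := f₅ r hr hrl
  obtain ⟨g₁, g₂, g₃, g₄, g₅⟩ := T.symm.expand_of_side hj hi h₂ (by rwa [T.invol])
    ((hsymm r).1 hr) (by rwa [T.invol])
  obtain ⟨hlJ, hli, hlj⟩ := mem_others.1 hl
  obtain ⟨hrJ, hri, hrj⟩ := mem_others.1 hr
  set X := C' l with hX
  set Y := Sym2.map m '' X with hY
  have hYX : Sym2.map m '' Y = X := image_image_mate T.invol X
  rw [hrl] at g₁ g₂ g₃ g₄ g₅
  -- the two types of extended paths, and the other paths
  have htri : ∀ q ∈ J, (C' q = X ∧ C q = expand m a p X) ∨ (C' q = Y ∧ C q = expand m a (m p) Y) ∨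
      (C' q ≠ X ∧ C' q ≠ Y ∧ C q = C' q) := by
    intro q hq
    by_cases hqi : q = i
    · subst hqi; exact Or.inr (Or.inl ⟨g₁, g₂⟩)
    by_cases hqj : q = j
    · subst hqj; exact Or.inl ⟨f₁, f₂⟩
    have hqo : q ∈ others J i j := mem_others.2 ⟨hq, hqi, hqj⟩
    by_cases hqX : C' q = X
    · refine Or.inl ⟨hqX, ?_⟩
      have := (g₅ q ((hsymm q).1 hqo) (by rw [hYX, hqX])).2
      rwa [T.invol, hqX] at this
    by_cases hqY : C' q = Y
    · refine Or.inr (Or.inl ⟨hqY, ?_⟩)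
      rw [(f₅ q hqo hqY).2, hqY]
    refine Or.inr (Or.inr ⟨hqX, hqY, T.eq_of_no_side hi hj h₁ h₂ hqo (fun h => hqY ?_)
      (fun h => hqX ?_)⟩)
    · rw [← g₁]
      exact (T.symm.eq_of_same_side hj hi hq h₂ (by rwa [T.invol]) (by rwa [T.invol])).symm
    · rw [← f₁]
      exact (T.eq_of_same_side hi hj hq h₁ h₂ h).symm
  have hsX : s(a, m p) ∈ expand m a p X := Or.inr (Or.inr rfl)
  have hsX' : s(a, p) ∉ expand m a p X := T.side_notMem_expand hlJ
  have hsY : s(a, p) ∈ expand m a (m p) Y := Or.inr (Or.inr (by rw [T.invol]))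
  have hsY' : s(a, m p) ∉ expand m a (m p) Y := by
    rw [← hrl]; exact T.symm.side_notMem_expand hrJ
  have himX : Sym2.map m '' expand m a p X = expand m a (m p) Y := expand_image T.invol T.free _ _
  have himY : Sym2.map m '' expand m a (m p) Y = expand m a p X := by
    rw [← himX, image_image_mate T.invol]
  have hXY : expand m a p X ≠ expand m a (m p) Y := fun h => hsX' (h ▸ hsY)
  have hdir : ∀ q ∈ J, C' q ≠ expand m a p X ∧ C' q ≠ expand m a (m p) Y := fun q hq =>
    ⟨fun h => T.mate_p_notMem hq a (h ▸ hsX), fun h => T.p_notMem hq a (h ▸ hsY)⟩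
  have hdir' : ∀ q ∈ J, Sym2.map m '' C' q ≠ expand m a p X ∧
      Sym2.map m '' C' q ≠ expand m a (m p) Y := fun q hq =>
    ⟨fun h => (hdir q hq).2 (by rw [← himX, ← h, image_image_mate T.invol]),
      fun h => (hdir q hq).1 (by rw [← himY, ← h, image_image_mate T.invol])⟩
  have hinj : ∀ A A' : Set (Sym2 V), Sym2.map m '' A = A' → A = Sym2.map m '' A' := by
    rintro A _ rfl; rw [image_image_mate T.invol]
  -- two paths agree, or are companions, if and only if this holds for their contractions
  have iff₁ : ∀ q ∈ J, ∀ s ∈ J, C s = C q ↔ C' s = C' q := by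
    intro q hq s hs
    rcases htri q hq with ⟨q₁, q₂⟩ | ⟨q₁, q₂⟩ | ⟨q₁, q₁', q₂⟩ <;>
    rcases htri s hs with ⟨s₁, s₂⟩ | ⟨s₁, s₂⟩ | ⟨s₁, s₁', s₂⟩ <;> rw [q₂, s₂]
    · rw [q₁, s₁]; simp
    · rw [q₁, s₁]; exact iff_of_false hXY.symm hne.symm
    · rw [q₁]; exact iff_of_false (hdir s hs).1 s₁
    · rw [q₁, s₁]; exact iff_of_false hXY hne
    · rw [q₁, s₁]; simp
    · rw [q₁]; exact iff_of_false (hdir s hs).2 s₁'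
    · rw [s₁]; exact iff_of_false (hdir q hq).1.symm q₁.symm
    · rw [s₁]; exact iff_of_false (hdir q hq).2.symm q₁'.symm
  have iff₂ : ∀ q ∈ J, ∀ s ∈ J, C s = Sym2.map m '' C q ↔ C' s = Sym2.map m '' C' q := by
    intro q hq s hs
    rcases htri q hq with ⟨q₁, q₂⟩ | ⟨q₁, q₂⟩ | ⟨q₁, q₁', q₂⟩ <;>
    rcases htri s hs with ⟨s₁, s₂⟩ | ⟨s₁, s₂⟩ | ⟨s₁, s₁', s₂⟩ <;> rw [q₂, s₂]
    · rw [himX, q₁, s₁]; exact iff_of_false hXY hne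
    · rw [himX, q₁, s₁]; simp [hY]
    · rw [himX, q₁]; exact iff_of_false (hdir s hs).2 s₁'
    · rw [himY, q₁, s₁, hYX]; simp
    · rw [himY, q₁, s₁, hYX]; exact iff_of_false hXY.symm hne.symm
    · rw [himY, q₁, hYX]; exact iff_of_false (hdir s hs).1 s₁
    · rw [s₁]
      refine iff_of_false (hdir' q hq).1.symm fun h => q₁' (hinj _ _ h.symm)
    · rw [s₁]
      refine iff_of_false (hdir' q hq).2.symm fun h => q₁ ?_
      rw [hinj _ _ h.symm, hYX]
  -- each path is represented by a path of the contracted badge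
  have hrep : ∀ q ∈ J, ∃ s ∈ others J i j, C' s = C' q := by
    intro q hq
    by_cases hqi : q = i
    · subst hqi; exact ⟨r, hr, by rw [hrl, g₁]⟩
    by_cases hqj : q = j
    · subst hqj; exact ⟨l, hl, f₁.symm⟩
    exact ⟨q, mem_others.2 ⟨hq, hqi, hqj⟩, rfl⟩
  have hfin : ∀ Z, {s ∈ (others J i j : Set ι) | C' s = Z}.Finite := fun Z =>
    (Finset.finite_toSet _).subset (Set.sep_subset _ _)
  -- the colours `j` and `i` add one path to the class of `X` and to that of `Y`, respectively, in
  -- accordance with the additional edge on the extended paths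
  have hcX : {s ∈ (J : Set ι) | C' s = X}.ncard =
      {s ∈ (others J i j : Set ι) | C' s = X}.ncard + 1 := by
    refine ncard_mem_or_eq (l := j) (fun h => (mem_others.1 h.1).2.2 rfl) (fun q => ?_) (hfin _)
    simp only [Set.mem_ofPred_eq, Finset.mem_coe, mem_others]
    by_cases hqj : q = j
    · subst hqj; simp [hj, f₁]
    · by_cases hqi : q = i
      · subst hqi; simp [hqj, g₁, hne.symm]
      · simp [hqi, hqj]
  have hcY : {s ∈ (J : Set ι) | C' s = Y}.ncard =
      {s ∈ (others J i j : Set ι) | C' s = Y}.ncard + 1 := by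
    refine ncard_mem_or_eq (l := i) (fun h => (mem_others.1 h.1).2.1 rfl) (fun q => ?_) (hfin _)
    simp only [Set.mem_ofPred_eq, Finset.mem_coe, mem_others]
    by_cases hqi : q = i
    · subst hqi; simp [hi, g₁]
    · by_cases hqj : q = j
      · subst hqj; simp [hqi, f₁, hne]
      · simp [hqi, hqj]
  have hcZ : ∀ Z, Z ≠ X → Z ≠ Y → {s ∈ (J : Set ι) | C' s = Z} =
      {s ∈ (others J i j : Set ι) | C' s = Z} := by
    intro Z hZX hZY
    ext q
    simp only [Set.mem_ofPred_eq, Finset.mem_coe, mem_others]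
    by_cases hqi : q = i
    · subst hqi; simp [g₁, hZY.symm]
    · by_cases hqj : q = j
      · subst hqj; simp [f₁, hZX.symm]
      · simp [hqi, hqj]
  have hncX : (expand m a p X).ncard = X.ncard + 1 := by rw [← f₃]; exact f₄
  have hncY : (expand m a (m p) Y).ncard = Y.ncard + 1 := by rw [← g₃]; exact g₄
  have hcounts : ∀ q ∈ J, {s ∈ (J : Set ι) | C' s = C' q}.ncard + 1 = (C q).ncard ∧
      {s ∈ (J : Set ι) | C' s = Sym2.map m '' C' q}.ncard + 1 = (C q).ncard := by
    intro q hq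
    obtain ⟨q₀, hq₀, hqq⟩ := hrep q hq
    have hc := T.count hi hj h₁ h₂ hq₀
    rw [hqq] at hc
    rcases htri q hq with ⟨q₁, q₂⟩ | ⟨q₁, q₂⟩ | ⟨q₁, q₁', q₂⟩
    · rw [q₁, ← hY] at hc ⊢
      rw [q₂, hncX, hcX, hcY]; omega
    · rw [q₁, hYX] at hc
      rw [q₁, hYX, q₂, hncY, hcX, hcY]; omega
    · rw [q₂, hcZ _ q₁ q₁', hcZ _ (fun h => q₁' (hinj _ _ h)) (fun h => q₁ ?_)]
      · exact hc
      · rw [hinj _ _ h, hYX]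
  have hsep₁ : ∀ q ∈ J, {s ∈ (J : Set ι) | C s = C q} = {s ∈ (J : Set ι) | C' s = C' q} :=
    fun q hq => by ext s; exact and_congr_right fun hs => iff₁ q hq s hs
  have hsep₂ : ∀ q ∈ J, {s ∈ (J : Set ι) | C s = Sym2.map m '' C q} =
      {s ∈ (J : Set ι) | C' s = Sym2.map m '' C' q} :=
    fun q hq => by ext s; exact and_congr_right fun hs => iff₂ q hq s hs
  have hverts : ∀ q ∈ J, ∀ v, v ∉ triangle m a p → (v ∈ verts (C q) ↔ v ∈ verts (C' q)) := by
    intro q hq v hv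
    have hva : v ≠ a := fun h => hv (Or.inl h)
    have hvp : v ≠ p := fun h => hv (Or.inr (Or.inl h))
    have hvp' : v ≠ m p := fun h => hv (Or.inr (Or.inr h))
    rcases htri q hq with ⟨q₁, q₂⟩ | ⟨q₁, q₂⟩ | ⟨-, -, q₂⟩
    · rw [q₁, q₂, verts_expand_iff hva hvp hvp']
    · rw [q₁, q₂, verts_expand_iff hva hvp' (by rwa [T.invol])]
    · rw [q₂]
  refine ⟨T.aug, fun q hq => by rw [hsep₁ q hq]; exact (hcounts q hq).1,
    fun q hq => by rw [hsep₂ q hq]; exact (hcounts q hq).2, fun q hq s hs => ?_, fun v hv => ?_⟩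
  · rw [iff₁ q hq s hs, iff₂ q hq s hs]
    by_contra! hcon
    obtain ⟨n₁, n₂, v, hv, hvq, hvs⟩ := hcon
    -- vertices of the triangle only lie on extended paths, which are companions
    have hvB : v ∉ triangle m a p := by
      intro hvB
      have hva : v ≠ a := by rintro rfl; exact hv T.free
      have hin : ∀ q ∈ J, v ∈ verts (C q) → C' q = X ∨ C' q = Y := by
        intro q hq hvq
        rcases htri q hq with ⟨q₁, -⟩ | ⟨q₁, -⟩ | ⟨-, -, q₂⟩
        · exact Or.inl q₁
        · exact Or.inr q₁
        · rw [q₂] at hvq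
          obtain ⟨e, he, hve⟩ := hvq
          exact absurd (T.eq_of_mem hq he hve hvB) hva
      rcases hin q hq hvq with h | h <;> rcases hin s hs hvs with h' | h'
      · exact n₁ (by rw [h, h'])
      · exact n₂ (by rw [h, h'])
      · exact n₂ (by rw [h, h', hYX])
      · exact n₁ (by rw [h, h'])
    have hv' : contractMate m (triangle m a p) v ≠ v := by rwa [contractMate_of_notMem hvB]
    obtain ⟨q₀, hq₀, hqq⟩ := hrep q hq
    obtain ⟨s₀, hs₀, hss⟩ := hrep s hs
    rcases hbadge.disj q₀ hq₀ s₀ hs₀ with h | h | h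
    · exact n₁ (by rw [← hqq, ← hss, h])
    · rw [T.image_contractMate (mem_others.1 hq₀).1] at h
      exact n₂ (by rw [← hqq, ← hss, h])
    · rw [hqq, hss] at h
      exact h v hv' ((hverts q hq v hvB).1 hvq) ((hverts s hs v hvB).1 hvs)
  · by_cases hvB : v ∈ triangle m a p
    · rcases hvB with rfl | rfl | rfl
      · exact absurd T.free hv
      · exact ⟨i, hi, _, h₁, by simp⟩
      · exact ⟨j, hj, _, h₂, by simp⟩
    · obtain ⟨q, hq, hvq⟩ := hbadge.cover v (by rwa [contractMate_of_notMem hvB])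
      have hqJ := (mem_others.1 hq).1
      exact ⟨q, hqJ, (hverts q hqJ v hvB).2 hvq⟩

/-- If no further path uses a side of the triangle, then the path providing the side `s(a, p)` has
only one more edge outside the matching: a longer path would end with an edge from an uncovered
vertex to a strip of the badge formed by the other paths. -/
lemma eq_pair {i j : ι} (hi : i ∈ J) (hj : j ∈ J) (h₁ : s(a, p) ∈ C i)
    (h₂ : s(a, m p) ∈ C j) (hdir : ∀ q ∈ others J i j, C q = C' q) :
    ∃ d, m d = d ∧ d ≠ a ∧ C i = {s(p, a), s(d, m p)} := by
  classical
  have hbadge := T.badge_others hi hj h₁ h₂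
  obtain ⟨L, hL, hC⟩ := T.aug i hi
  have h₁' := h₁
  rw [hC, Sym2.eq_swap] at h₁
  obtain ⟨l, hl, hE⟩ := hL.exists_head T.invol T.free h₁
  rw [← hE] at hC
  obtain ⟨hs, b, l', c, heq, -, hc, hl'⟩ := hl
  obtain ⟨rfl, heq'⟩ := List.cons.inj heq
  cases l' with
  | nil =>
    obtain ⟨rfl, -⟩ := List.cons.inj heq'
    exact absurd hc T.covered
  | cons p' l' =>
    obtain ⟨rfl, rfl⟩ := List.cons.inj heq'
    rcases List.eq_nil_or_concat l' with rfl | ⟨k, w, rfl⟩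
    · refine ⟨c, hc, ?_, ?_⟩
      · exact ((simple_cons.1 hs).1 c (by simp)).1
      · simp [hC, T.free]
    · exfalso
      rw [List.concat_eq_append] at hs hl' hC
      -- the other end of the path is `c`, and `w` is the covered vertex of the list next to it
      have hw := hl' w (by simp)
      have hedge : s(m w, c) ∈ C i := by
        have : altEdges m ([w, c]) ⊆ C i := by
          rw [hC]
          have := altEdges_subset_append_right (m := m) (a :: p :: k) [w, c]
          simpa using this
        rw [Sym2.eq_swap]
        exact this (Set.mem_insert _ _)
      have hwp := (simple_cons.1 (simple_cons.1 hs).2).1 w (by simp)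
      have hwB : w ∉ triangle m a p := by
        rintro (h | h | h)
        · exact ((simple_cons.1 hs).1 w (by simp)).1 h
        · exact hwp.1 h
        · exact hwp.2 h
      have hmwB := T.mate_notMem hwB
      have hmw : m (m w) ≠ m w := fun h => hw (T.invol.injective h)
      obtain ⟨r, hr, hwr⟩ := hbadge.cover (m w) (by rwa [contractMate_of_notMem hmwB])
      obtain ⟨hrJ, hri, hrj⟩ := mem_others.1 hr
      obtain ⟨L₀, hL₀, hC₀⟩ := T.aug r hrJ
      have hcount := T.count hi hj h₁' h₂ hr
      rw [← hdir r hr] at hcount hwr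
      have hlen := ncard_altEdges T.invol hL₀.1
      rw [← hC₀] at hlen
      refine T.noRainbow.not_edge_to_free T.invol hL₀
        (A := (others J i j).filter fun s => C' s = C r)
        (A' := (others J i j).filter fun s => C' s = Sym2.map m '' C r)
        (fun s hs => (mem_others.1 (Finset.mem_filter.1 hs).1).1)
        (fun s hs => (mem_others.1 (Finset.mem_filter.1 hs).1).1) ?_ ?_ ?_ ?_ hi
        (fun h => (mem_others.1 (Finset.mem_filter.1 h).1).2.1 rfl)
        (fun h => (mem_others.1 (Finset.mem_filter.1 h).1).2.1 rfl) hmw (hC₀ ▸ hwr) hc hedge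
      · intro s hs
        rw [Finset.mem_filter] at hs
        rw [hdir s hs.1, hs.2, hC₀]
      · intro s hs
        rw [Finset.mem_filter] at hs
        rw [hdir s hs.1, hs.2, hC₀]
      · rw [← Set.ncard_coe_finset, Finset.coe_filter]
        simp only [Finset.mem_coe] at hcount
        omega
      · rw [← Set.ncard_coe_finset, Finset.coe_filter]
        simp only [Finset.mem_coe] at hcount
        omega

/-- The inductive step when the contracted triangle belongs to a strip of weight one. -/
lemma isBadgeFamily_of_no_side {i j : ι} (hi : i ∈ J) (hj : j ∈ J) (h₁ : s(a, p) ∈ C i)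
    (h₂ : s(a, m p) ∈ C j) (hdir : ∀ q ∈ others J i j, C q = C' q) :
    IsBadgeFamily m C J := by
  classical
  have hij := T.ne hi h₁ h₂
  have hbadge := T.badge_others hi hj h₁ h₂
  obtain ⟨d, hd, hda, hCi⟩ := T.eq_pair hi hj h₁ h₂ hdir
  obtain ⟨d', hd', hda', hCj⟩ := T.symm.eq_pair hj hi h₂ (by rwa [T.invol]) (fun q hq => hdir q
    (mem_others.2 ⟨(mem_others.1 hq).1, (mem_others.1 hq).2.2, (mem_others.1 hq).2.1⟩))
  rw [T.invol] at hCj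
  have hdp : d ≠ p := by rintro rfl; exact T.covered hd
  have hdmp : d ≠ m p := by rintro rfl; exact T.covered (T.invol.injective hd)
  -- if the two ends differed, `d`, `m p`, `p`, `d'` would be a rainbow augmenting path
  obtain rfl : d = d' := by
    by_contra hdd
    have hdp' : d' ≠ p := by rintro rfl; exact T.covered hd'
    have hdmp' : d' ≠ m p := by rintro rfl; exact T.covered (T.invol.injective hd')
    set x : ι → Sym2 V := fun q => if q = i then s(d, m p) else s(p, d') with hx
    have xi : x i = s(d, m p) := if_pos rfl
    have xj : x j = s(p, d') := by simp [hx, hij.symm]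
    refine T.noRainbow {i, j} (by simp [Finset.insert_subset_iff, hi, hj]) x ?_ ?_
    · intro q hq
      simp only [Finset.mem_insert, Finset.mem_singleton] at hq
      rcases hq with rfl | rfl
      · rw [xi, hCi]; simp
      · rw [xj, hCj, Sym2.eq_swap]; simp
    · refine hasAug_of_rooted (b := d') (x := p) (l := [d]) hd' ?_
        (rooted_cons_cons.2 (rooted_cons_cons.2 (rooted_singleton.2 hd))) ?_
      · simp only [Simple, List.pairwise_cons, List.mem_cons, List.not_mem_nil, or_false,
          forall_eq_or_imp, forall_eq, List.Pairwise.nil, and_true, hd', false_imp_iff,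
          implies_true]
        exact ⟨⟨⟨hdp'.symm, hdp'.symm⟩, hdd, hdd⟩, hdp, hdmp⟩
      · simp only [altEdges_cons_cons, altEdges_singleton, Set.insert_subset_iff,
          Set.empty_subset, and_true, hd']
        exact ⟨⟨j, by simp, xj⟩, ⟨i, by simp, xi⟩⟩
  have himi : Sym2.map m '' C i = C j := by
    rw [hCi, hCj, Set.image_pair, Sym2.map_mk, Sym2.map_mk, T.free, hd, T.invol]
  have himj : Sym2.map m '' C j = C i := by rw [← himi, image_image_mate T.invol]
  have hCij : C i ≠ C j := by
    intro h
    exact T.ne hi h₁ (h ▸ h₂ : s(a, m p) ∈ C i) rfl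
  have hnci : (C i).ncard = 2 := by
    rw [hCi, Set.ncard_pair]
    intro h
    rcases Sym2.eq_iff.1 h with ⟨h, -⟩ | ⟨h, -⟩
    · exact hdp h.symm
    · exact T.covered h.symm
  have hncj : (C j).ncard = 2 := by
    rw [hCj, Set.ncard_pair]
    intro h
    rcases Sym2.eq_iff.1 h with ⟨h, -⟩ | ⟨h, -⟩
    · exact hdmp h.symm
    · exact T.covered h
  have hni : ∀ q ∈ others J i j, C q ≠ C i ∧ C q ≠ C j := fun q hq =>
    ⟨fun h => T.p_notMem (mem_others.1 hq).1 a (by rw [← hdir q hq, h]; exact h₁),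
      fun h => T.mate_p_notMem (mem_others.1 hq).1 a (by rw [← hdir q hq, h]; exact h₂)⟩
  have hcases : ∀ q ∈ J, q = i ∨ q = j ∨ q ∈ others J i j := by
    intro q hq
    rw [mem_others]; tauto
  have hsing₁ : {s ∈ (J : Set ι) | C s = C i} = {i} := by
    ext q
    simp only [Set.mem_ofPred_eq, Finset.mem_coe, Set.mem_singleton_iff]
    constructor
    · rintro ⟨hq, h⟩
      rcases hcases q hq with rfl | rfl | hq
      · rfl
      · exact absurd h.symm hCij
      · exact absurd h (hni q hq).1
    · rintro rfl; exact ⟨hi, rfl⟩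
  have hsing₂ : {s ∈ (J : Set ι) | C s = C j} = {j} := by
    ext q
    simp only [Set.mem_ofPred_eq, Finset.mem_coe, Set.mem_singleton_iff]
    constructor
    · rintro ⟨hq, h⟩
      rcases hcases q hq with rfl | rfl | hq
      · exact absurd h hCij
      · rfl
      · exact absurd h (hni q hq).2
    · rintro rfl; exact ⟨hj, rfl⟩
  have hsep : ∀ Z, Z ≠ C i → Z ≠ C j → {s ∈ (J : Set ι) | C s = Z} =
      {s ∈ (others J i j : Set ι) | C' s = Z} := by
    intro Z hZi hZj
    ext q
    simp only [Set.mem_ofPred_eq, Finset.mem_coe]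
    constructor
    · rintro ⟨hq, rfl⟩
      rcases hcases q hq with rfl | rfl | hq
      · exact absurd rfl hZi
      · exact absurd rfl hZj
      · exact ⟨hq, (hdir q hq).symm⟩
    · rintro ⟨hq, rfl⟩; exact ⟨(mem_others.1 hq).1, hdir q hq⟩
  have hcount : ∀ q ∈ J, {s ∈ (J : Set ι) | C s = C q}.ncard + 1 = (C q).ncard ∧
      {s ∈ (J : Set ι) | C s = Sym2.map m '' C q}.ncard + 1 = (C q).ncard := by
    intro q hq
    rcases hcases q hq with rfl | rfl | hqo
    · rw [himi, hsing₁, hsing₂, hnci]; simp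
    · rw [himj, hsing₁, hsing₂, hncj]; simp
    · have hc := T.count hi hj h₁ h₂ hqo
      rw [← hdir q hqo] at hc
      rwa [hsep _ (hni q hqo).1 (hni q hqo).2, hsep]
      · intro h
        exact (hni q hqo).2 (by rw [← himi, ← h, image_image_mate T.invol])
      · intro h
        exact (hni q hqo).1 (by rw [← himj, ← h, image_image_mate T.invol])
  have hvB : ∀ q, q = i ∨ q = j → ∀ v, m v ≠ v → v ∈ verts (C q) → v ∈ triangle m a p := by
    have hvd : ∀ v, m v ≠ v → v ≠ d := by rintro v hv rfl; exact hv hd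
    rintro q (rfl | rfl) v hv ⟨e, he, hve⟩
    · rw [hCi] at he
      rcases he with rfl | rfl
      · rcases Sym2.mem_iff.1 hve with rfl | rfl <;> simp [triangle]
      · rcases Sym2.mem_iff.1 hve with rfl | rfl
        · exact absurd hd hv
        · simp [triangle]
    · rw [hCj] at he
      rcases he with rfl | rfl
      · rcases Sym2.mem_iff.1 hve with rfl | rfl <;> simp [triangle]
      · rcases Sym2.mem_iff.1 hve with rfl | rfl
        · exact absurd hd hv
        · simp [triangle]
  have hvB' : ∀ q ∈ others J i j, ∀ v, m v ≠ v → v ∈ verts (C q) → v ∉ triangle m a p := by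
    rintro q hq v hv ⟨e, he, hve⟩ hvB
    rw [hdir q hq] at he
    have := T.eq_of_mem (mem_others.1 hq).1 he hve hvB
    exact hv (this ▸ T.free)
  refine ⟨T.aug, fun q hq => (hcount q hq).1, fun q hq => (hcount q hq).2, fun q hq s hs => ?_,
    fun v hv => ?_⟩
  · by_cases hq' : q ∈ others J i j <;> by_cases hs' : s ∈ others J i j
    · rw [hdir q hq', hdir s hs']
      rcases hbadge.disj q hq' s hs' with h | h | h
      · exact Or.inl h
      · rw [T.image_contractMate hq] at h
        exact Or.inr (Or.inl h)
      · refine Or.inr (Or.inr fun v hv hvq hvs => ?_)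
        have := hvB' q hq' v hv (by rwa [hdir q hq'])
        exact h v (by rwa [contractMate_of_notMem this]) hvq hvs
    · refine Or.inr (Or.inr fun v hv hvq hvs => hvB' q hq' v hv hvq (hvB s ?_ v hv hvs))
      rcases hcases s hs with h | h | h
      · exact Or.inl h
      · exact Or.inr h
      · exact absurd h hs'
    · refine Or.inr (Or.inr fun v hv hvq hvs => hvB' s hs' v hv hvs (hvB q ?_ v hv hvq))
      rcases hcases q hq with h | h | h
      · exact Or.inl h
      · exact Or.inr h
      · exact absurd h hq'
    · rcases hcases q hq with rfl | rfl | h <;> rcases hcases s hs with rfl | rfl | h'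
      · exact Or.inl rfl
      · exact Or.inr (Or.inl himi.symm)
      · exact absurd h' hs'
      · exact Or.inr (Or.inl himj.symm)
      · exact Or.inl rfl
      · exact absurd h' hs'
      all_goals exact absurd h hq'
  · by_cases hvB : v ∈ triangle m a p
    · rcases hvB with rfl | rfl | rfl
      · exact absurd T.free hv
      · exact ⟨i, hi, _, h₁, by simp⟩
      · exact ⟨j, hj, _, h₂, by simp⟩
    · obtain ⟨q, hq, hvq⟩ := hbadge.cover v (by rwa [contractMate_of_notMem hvB])
      exact ⟨q, (mem_others.1 hq).1, by rwa [hdir q hq]⟩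

lemma isBadgeFamily {i j : ι} (hi : i ∈ J) (hj : j ∈ J) (h₁ : s(a, p) ∈ C i)
    (h₂ : s(a, m p) ∈ C j) : IsBadgeFamily m C J := by
  by_cases h : ∃ l ∈ others J i j, s(a, m p) ∈ C l
  · obtain ⟨l, hl, h⟩ := h
    exact T.isBadgeFamily_of_side hi hj h₁ h₂ hl h
  by_cases h' : ∃ l ∈ others J i j, s(a, p) ∈ C l
  · obtain ⟨l, hl, h'⟩ := h'
    refine T.symm.isBadgeFamily_of_side hj hi h₂ (by rwa [T.invol]) (l := l) ?_ (by rwa [T.invol])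
    rw [mem_others] at hl ⊢; tauto
  push Not at h h'
  exact T.isBadgeFamily_of_no_side hi hj h₁ h₂ fun q hq =>
    T.eq_of_no_side hi hj h₁ h₂ hq (h' q hq) (h q hq)

end TriangleContraction

end Step

/-! ### Tight families are badges -/

section Main

variable {V ι : Type*}

/-- A family of as many augmenting paths as there are covered vertices, without rainbow augmenting
path, is a badge. -/
theorem isBadgeFamily_of_noRainbow {m : V → V} (hm : Function.Involutive m)
    (hW : {v | m v ≠ v}.Finite) {C : ι → Set (Sym2 V)} {J : Finset ι} (h : NoRainbow m C J)
    (haug : ∀ i ∈ J, ∃ L, IsAug m L ∧ C i = altEdges m L)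
    (hJ : J.card = {v | m v ≠ v}.ncard) : IsBadgeFamily m C J := by
  classical
  induction hn : J.card using Nat.strong_induction_on generalizing m C J with
  | _ n ih =>
  rcases J.eq_empty_or_nonempty with rfl | ⟨i, hi⟩
  · rw [Finset.card_empty, eq_comm, Set.ncard_eq_zero hW] at hJ
    refine ⟨by simp, by simp, by simp, by simp, fun v hv => ?_⟩
    have : v ∈ {v | m v ≠ v} := hv
    rw [hJ] at this
    simp at this
  have hC : ∀ i ∈ J, HasAug m (C i) := fun i hi => by
    obtain ⟨L, hL, hE⟩ := haug i hi
    exact ⟨L, hL, hE.ge⟩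
  -- the first edge of a path is a side of a triangle
  obtain ⟨a, p, ha, hp, hap⟩ : ∃ a p, m a = a ∧ m p ≠ p ∧ s(a, p) ∈ C i := by
    obtain ⟨L, hL, hE⟩ := haug i hi
    obtain ⟨hs, b, l, c, rfl, hb, hc, hl⟩ := hL
    cases l with
    | nil =>
      refine absurd ?_ (h.not_free_edge hi hc hb ((simple_cons.1 hs).1 c (by simp)).1)
      rw [hE]
      simp [hb]
    | cons x l =>
      refine ⟨b, x, hb, hl x (by simp), ?_⟩
      rw [hE, Sym2.eq_swap]
      nth_rw 2 [← hb]
      exact Set.mem_insert _ _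
  obtain ⟨j, hj, hji, hajp⟩ := h.exists_triangle hm hW hC hJ hi ha hp hap
  set B := triangle m a p
  have hmate := triangle_mate (p := p) hm ha
  have hproj : ∀ q, ∃ X, q ∈ J → (∃ L, IsAug (contractMate m B) L ∧
      X = altEdges (contractMate m B) L) ∧ X ⊆ Sym2.map (contract B a) '' C q := by
    intro q
    by_cases hq : q ∈ J
    · obtain ⟨L, hL, hE⟩ := haug q hq
      obtain ⟨L', hL', hE'⟩ := hL.project hm hmate (Or.inl rfl)
        (triangle_eq_of_free hm hp)
      exact ⟨_, fun _ => ⟨⟨L', hL', rfl⟩, by rwa [hE]⟩⟩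
    · exact ⟨∅, fun h => absurd h hq⟩
  choose C' hC' using hproj
  have hcard : ∀ K : Finset ι, ∀ i ∈ J, ∀ j ∈ J, i ≠ j → (∀ q, q ∈ K ↔ q ∈ J ∧ q ≠ i ∧ q ≠ j) →
      K.card + 2 = J.card := by
    intro K i hi j hj hij hK
    have : J = insert i (insert j K) := by
      ext q
      rw [Finset.mem_insert, Finset.mem_insert, hK]
      constructor
      · tauto
      · rintro (rfl | rfl | h)
        exacts [hi, hj, h.1]
    rw [this, Finset.card_insert_of_notMem, Finset.card_insert_of_notMem]
    · intro h; exact ((hK j).1 h).2.2 rfl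
    · rw [Finset.mem_insert, hK]
      rintro (h | h)
      exacts [hij h, h.2.1 rfl]
  have hW' : {v | contractMate m B v ≠ v} ⊆ {v | m v ≠ v} := by
    intro v hv
    by_cases hvB : v ∈ B
    · exact absurd (contractMate_of_mem hvB) hv
    · rwa [Set.mem_ofPred_eq, contractMate_of_notMem hvB] at hv
  have hWcard : {v | contractMate m B v ≠ v}.ncard + 2 = {v | m v ≠ v}.ncard := by
    have : {v | m v ≠ v} = insert p (insert (m p) {v | contractMate m B v ≠ v}) := by
      ext v
      simp only [Set.mem_ofPred_eq, Set.mem_insert_iff]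
      by_cases hvB : v ∈ B
      · rw [contractMate_of_mem hvB]
        rcases hvB with rfl | rfl | rfl
        · simp only [ha, ne_eq, not_true_eq_false, or_false, false_iff]
          rintro (rfl | h)
          · exact hp ha
          · exact hp (hm.injective (by rw [← h]; exact ha))
        · simpa using hp
        · simpa using fun h => hp (hm.injective h)
      · rw [contractMate_of_notMem hvB]
        have h₁ : v ≠ p := fun h => hvB (Or.inr (Or.inl h))
        have h₂ : v ≠ m p := fun h => hvB (Or.inr (Or.inr h))
        simp [h₁, h₂]
    rw [this, Set.ncard_insert_of_notMem _ ((hW.subset hW').insert _),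
      Set.ncard_insert_of_notMem _ (hW.subset hW')]
    · exact fun h => h (contractMate_of_mem (Or.inr (Or.inr rfl)))
    · rintro (h | h)
      · exact hp h.symm
      · exact h (contractMate_of_mem (Or.inr (Or.inl rfl)))
  have T₀ : TriangleContraction m C C' J a p := by
    refine ⟨hm, hW, h, haug, hJ, ha, hp, fun q hq => (hC' q hq).1, fun q hq => (hC' q hq).2, ?_⟩
    intro i hi j hj h₁ h₂ K hK
    have hij := ne_of_sides hm ha hp (haug i hi) h₁ h₂
    have hKcard := hcard K i hi j hj hij hK
    have hKW : K.card = {v | contractMate m B v ≠ v}.ncard := by omega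
    exact ih K.card (by omega) (contractMate_involutive hm hmate) (hW.subset hW')
      (h.contract_triangle hm ha hp hi hj hij h₁ h₂ (fun q hq => (hK q).1 hq)
        fun q hq => (hC' q ((hK q).1 hq).1).2) (fun q hq => (hC' q ((hK q).1 hq).1).1) hKW rfl
  exact T₀.isBadgeFamily hi hj hap hajp

end Main

/-! ### Matchings of graphs and walks -/

section Matching

variable {V : Type*} {G : SimpleGraph V} {F : G.Subgraph}

/-- The involution exchanging the ends of each edge of the matching `F` and fixing the vertices that
`F` does not cover. -/
noncomputable def mate (hF : F.IsMatching) (v : V) : V :=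
  open Classical in if h : v ∈ F.verts then (hF h).choose else v

lemma adj_iff_mate (hF : F.IsMatching) {v w : V} : F.Adj v w ↔ mate hF v = w ∧ v ≠ w := by
  constructor
  · intro h
    have hv := F.edge_vert h
    refine ⟨?_, h.ne⟩
    rw [mate, dif_pos hv]
    exact ((hF hv).choose_spec.2 w h).symm
  · rintro ⟨rfl, hne⟩
    by_cases hv : v ∈ F.verts
    · rw [mate, dif_pos hv]
      exact (hF hv).choose_spec.1
    · rw [mate, dif_neg hv] at hne
      exact absurd rfl hne

lemma mate_ne_iff (hF : F.IsMatching) {v : V} : mate hF v ≠ v ↔ v ∈ F.verts := by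
  constructor
  · intro h
    by_contra hv
    exact h (by rw [mate, dif_neg hv])
  · intro hv h
    obtain ⟨w, hw, -⟩ := hF hv
    obtain ⟨h', hne⟩ := (adj_iff_mate hF).1 hw
    exact hne (by rw [← h', h])

lemma mate_involutive (hF : F.IsMatching) : Function.Involutive (mate hF) := by
  intro v
  by_cases hv : v ∈ F.verts
  · have h := (adj_iff_mate hF).2 ⟨rfl, ((mate_ne_iff hF).2 hv).symm⟩
    exact ((adj_iff_mate hF).1 h.symm).1
  · have : mate hF v = v := by
      by_contra h
      exact hv ((mate_ne_iff hF).1 h)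
    rw [this, this]

lemma mem_edgeSet_iff_mate (hF : F.IsMatching) {v w : V} :
    s(v, w) ∈ F.edgeSet ↔ mate hF v = w ∧ v ≠ w := by
  rw [SimpleGraph.Subgraph.mem_edgeSet, adj_iff_mate hF]

lemma ncard_covered (hF : F.IsMatching) {k : ℕ} (hk : F.edgeSet.encard = k) :
    {v | mate hF v ≠ v}.Finite ∧ {v | mate hF v ≠ v}.ncard = 2 * k := by
  classical
  have hfin : F.edgeSet.Finite := Set.finite_of_encard_eq_coe hk
  have hW : {v | mate hF v ≠ v}.Finite := by
    refine (hfin.biUnion (t := fun e => {v | v ∈ e}) fun e _ => ?_).subset ?_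
    · induction e with
      | _ x y =>
        refine (Set.toFinite {x, y}).subset fun v hv => ?_
        simpa using hv
    · intro v hv
      exact Set.mem_biUnion ((mem_edgeSet_iff_mate hF).2 ⟨rfl, Ne.symm hv⟩) (by simp)
  refine ⟨hW, ?_⟩
  have hE : hfin.toFinset.card = k := by
    rw [hfin.encard_eq_coe_toFinset_card] at hk
    exact_mod_cast hk
  rw [Set.ncard_eq_toFinset_card _ hW,
    Finset.card_eq_sum_card_fiberwise (f := fun v => s(v, mate hF v)) (t := hfin.toFinset)]
  · rw [← hE, mul_comm, ← smul_eq_mul, ← Finset.sum_const]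
    refine Finset.sum_congr rfl fun e he => ?_
    rw [Set.Finite.mem_toFinset] at he
    induction e with
    | _ x y =>
      obtain ⟨rfl, hne⟩ := (mem_edgeSet_iff_mate hF).1 he
      rw [Finset.card_eq_two]
      refine ⟨x, mate hF x, hne, ?_⟩
      ext v
      simp only [Finset.mem_filter, Set.Finite.mem_toFinset, Set.mem_ofPred_eq, Finset.mem_insert,
        Finset.mem_singleton]
      constructor
      · rintro ⟨-, h⟩
        rcases Sym2.eq_iff.1 h with ⟨h, -⟩ | ⟨h, -⟩
        · exact Or.inl h
        · exact Or.inr h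
      · rintro (rfl | rfl)
        · exact ⟨hne.symm, rfl⟩
        · rw [mate_involutive]
          exact ⟨hne, Sym2.eq_swap⟩
  · intro v hv
    simp only [Set.Finite.coe_toFinset, Set.mem_ofPred_eq] at hv ⊢
    exact (mem_edgeSet_iff_mate hF).2 ⟨rfl, hv.symm⟩

/-- The matching edges at the covered vertices that lie on `C`. -/
def matchEdges (m : V → V) (C : Set (Sym2 V)) : Set (Sym2 V) :=
  {e | ∃ v ∈ verts C, m v ≠ v ∧ e = s(v, m v)}

lemma not_mem_support_of_cons {u x b : V} {h : G.Adj u x} {q : G.Walk x b}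
    (hp : (SimpleGraph.Walk.cons h q).IsPath) : u ∉ q.support :=
  ((SimpleGraph.Walk.cons_isPath_iff _ _).1 hp).2

/-- The list encoding an alternating walk that starts with an edge outside the matching and ends in
an uncovered vertex. It is prolonged by `mate hF u`, which accounts for the first edge of the walk.
In the induction, the first two edges of the walk are removed. -/
lemma exists_list_of_walk (hF : F.IsMatching) (n : ℕ) : ∀ {u b : V} (p : G.Walk u b),
    p.length ≤ n → p.IsPath → IsAlternating F p → (∀ e ∈ p.edges.head?, e ∉ F.edgeSet) →
    b ∉ F.verts → ∃ l, (∀ v ∈ l, v ∈ p.support.tail ∧ mate hF v ∈ p.support.tail) ∧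
      Simple (mate hF) (mate hF u :: l) ∧
      ((l = [] ∧ p.length = 0) ∨ ∃ l', l = l' ++ [b] ∧ ∀ v ∈ l', mate hF v ≠ v) ∧
      altEdges (mate hF) (mate hF u :: l) = {e | e ∈ p.edges} \ F.edgeSet ∧
      {e | e ∈ p.edges} ∩ F.edgeSet = {e | ∃ v ∈ l, mate hF v ≠ v ∧ e = s(v, mate hF v)} := by
  have hm := mate_involutive hF
  induction n with
  | zero =>
    intro u b p hn hp halt hhead hb
    cases p with
    | nil => exact ⟨[], by simp, List.pairwise_singleton _ _, Or.inl ⟨rfl, rfl⟩, by simp, by simp⟩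
    | cons h q => simp at hn
  | succ n ih =>
    intro u b p hn hp halt hhead hb
    cases p with
    | nil => exact ⟨[], by simp, List.pairwise_singleton _ _, Or.inl ⟨rfl, rfl⟩, by simp, by simp⟩
    | @cons _ x _ h q =>
      have hux : s(u, x) ∉ F.edgeSet := hhead _ (by simp)
      have huq := not_mem_support_of_cons hp
      cases q with
      | nil =>
        have hbm : mate hF b = b := by
          by_contra h; exact hb ((mate_ne_iff hF).1 h)
        refine ⟨[b], by simp [hbm], ?_, Or.inr ⟨[], by simp⟩, ?_, ?_⟩
        · refine simple_cons.2 ⟨?_, List.pairwise_singleton _ _⟩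
          simp only [List.mem_singleton, forall_eq, hm u]
          have hub : b ≠ u := by simpa using Ne.symm (by simpa using huq : ¬ u = b)
          exact ⟨fun h' => hub (by rw [← hm u, ← h', hbm]), hub⟩
        · ext e
          simp only [altEdges_cons_cons, altEdges_singleton, hm u, Set.mem_insert_iff,
            Set.mem_empty_iff_false, or_false, SimpleGraph.Walk.edges_cons,
            SimpleGraph.Walk.edges_nil, List.mem_singleton, Set.mem_sdiff, Set.mem_ofPred_eq]
          constructor
          · rintro rfl; exact ⟨Sym2.eq_swap, by rwa [Sym2.eq_swap]⟩
          · rintro ⟨rfl, -⟩; exact Sym2.eq_swap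
        · ext e
          simp only [SimpleGraph.Walk.edges_cons, SimpleGraph.Walk.edges_nil, List.mem_singleton,
            Set.mem_inter_iff, Set.mem_ofPred_eq]
          constructor
          · rintro ⟨rfl, h⟩; exact absurd h hux
          · rintro ⟨v, rfl, h, -⟩; exact absurd hbm h
      | @cons _ z _ h' r =>
        have hchain : (s(u, x) ∈ F.edgeSet ↔ s(x, z) ∉ F.edgeSet) ∧
            IsAlternating F (SimpleGraph.Walk.cons h' r) := by
          unfold IsAlternating at halt ⊢
          simpa using halt
        have hxz : s(x, z) ∈ F.edgeSet := by
          by_contra h; exact hux (hchain.1.2 h)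
        obtain ⟨hz, hne⟩ := (mem_edgeSet_iff_mate hF).1 hxz
        have hzx : mate hF z = x := by rw [← hz, hm]
        have hpq := hp.of_cons
        have hxr := not_mem_support_of_cons hpq
        have hr : IsAlternating F r ∧ ∀ e ∈ r.edges.head?, e ∉ F.edgeSet := by
          have h₂ := hchain.2
          unfold IsAlternating at h₂ ⊢
          rw [SimpleGraph.Walk.edges_cons, List.isChain_cons] at h₂
          exact ⟨h₂.2, fun e he => (h₂.1 e he).1 hxz⟩
        obtain ⟨l, h₁, h₂, h₃, h₄, h₅⟩ := ih r (by simp at hn; omega) hpq.of_cons hr.1 hr.2 hb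
        rw [hzx] at h₂ h₄
        have hsup : ∀ v ∈ l, v ∈ r.support ∧ mate hF v ∈ r.support := fun v hv =>
          ⟨List.mem_of_mem_tail (h₁ v hv).1, List.mem_of_mem_tail (h₁ v hv).2⟩
        have hux' : u ≠ x ∧ u ∉ r.support := by simpa using huq
        refine ⟨x :: l, ?_, ?_, ?_, ?_, ?_⟩
        · intro v hv
          rcases List.mem_cons.1 hv with rfl | hv
          · rw [hz]; simp
          · simp [hsup v hv]
        · refine simple_cons.2 ⟨fun v hv => ?_, h₂⟩
          rw [hm]
          rcases List.mem_cons.1 hv with rfl | hv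
          · refine ⟨fun h => hux'.2 ?_, hux'.1.symm⟩
            rw [← hm u, ← h, hz]; exact r.start_mem_support
          · refine ⟨?_, ?_⟩
            · rintro rfl
              exact hux'.2 (by simpa [hm u] using (hsup _ hv).2)
            · rintro rfl
              exact hux'.2 (hsup _ hv).1
        · right
          have hxcov : mate hF x ≠ x := by rw [hz]; exact hne.symm
          rcases h₃ with ⟨rfl, h₃⟩ | ⟨l', rfl, h₃⟩
          · exfalso
            have := SimpleGraph.Walk.eq_of_length_eq_zero h₃
            subst this
            exact hb (F.edge_vert (SimpleGraph.Subgraph.Adj.symm hxz))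
          · exact ⟨x :: l', rfl, by simpa [hxcov] using h₃⟩
        · ext e
          rw [altEdges_cons_cons, h₄, hm u]
          simp only [Set.mem_insert_iff, Set.mem_sdiff, Set.mem_ofPred_eq,
            SimpleGraph.Walk.edges_cons, List.mem_cons]
          constructor
          · rintro (rfl | ⟨h₆, h₇⟩)
            · exact ⟨Or.inl Sym2.eq_swap, by rwa [Sym2.eq_swap]⟩
            · exact ⟨Or.inr (Or.inr h₆), h₇⟩
          · rintro ⟨rfl | rfl | h₆, h₇⟩
            · exact Or.inl Sym2.eq_swap
            · exact absurd hxz h₇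
            · exact Or.inr ⟨h₆, h₇⟩
        · ext e
          have h₅ := Set.ext_iff.1 h₅ e
          simp only [Set.mem_inter_iff, Set.mem_ofPred_eq, SimpleGraph.Walk.edges_cons,
            List.mem_cons] at h₅ ⊢
          constructor
          · rintro ⟨rfl | rfl | h₆, h₇⟩
            · exact absurd h₇ hux
            · exact ⟨x, Or.inl rfl, by rw [hz]; exact hne.symm, by rw [hz]⟩
            · obtain ⟨v, hv, h⟩ := h₅.1 ⟨h₆, h₇⟩
              exact ⟨v, Or.inr hv, h⟩
          · rintro ⟨v, rfl | hv, h₆, rfl⟩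
            · rw [hz]; exact ⟨Or.inr (Or.inl rfl), hxz⟩
            · have := h₅.2 ⟨v, hv, h₆, rfl⟩
              exact ⟨Or.inr (Or.inr this.1), this.2⟩

/-- Each augmenting path of the graph is encoded by a list, and is determined by its edges outside the
matching. -/
lemma exists_list_of_isAAP (hF : F.IsMatching) {S : Set (Sym2 V)} (hS : IsAAP F S) :
    S ⊆ G.edgeSet ∧ ∃ L, IsAug (mate hF) L ∧ S \ F.edgeSet = altEdges (mate hF) L ∧
      S = altEdges (mate hF) L ∪ matchEdges (mate hF) (altEdges (mate hF) L) := by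
  have hm := mate_involutive hF
  obtain ⟨a, b, p, hp, hlen, halt, ha, hb, rfl⟩ := hS
  have ham : mate hF a = a := by
    by_contra h; exact ha ((mate_ne_iff hF).1 h)
  have hbm : mate hF b = b := by
    by_contra h; exact hb ((mate_ne_iff hF).1 h)
  refine ⟨fun e he => p.edges_subset_edgeSet he, ?_⟩
  obtain ⟨l, h₁, h₂, h₃, h₄, h₅⟩ := exists_list_of_walk hF _ p le_rfl hp halt (by
    cases p with
    | nil => simp
    | cons h q =>
      simp only [SimpleGraph.Walk.edges_cons, List.head?_cons, Option.mem_def, Option.some.injEq,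
        forall_eq']
      exact fun h => ha (F.edge_vert h)) hb
  rw [ham] at h₂ h₄
  obtain ⟨l', rfl, hl'⟩ := h₃.resolve_left fun h => by omega
  have hL : IsAug (mate hF) (a :: (l' ++ [b])) := ⟨h₂, a, l', b, rfl, ham, hbm, hl'⟩
  refine ⟨_, hL, h₄.symm, ?_⟩
  rw [h₄]
  nth_rw 1 [← Set.sdiff_union_inter {e | e ∈ p.edges} F.edgeSet]
  congr 1
  rw [h₅, ← h₄]
  ext e
  constructor
  · rintro ⟨v, hv, hvc, rfl⟩
    exact ⟨v, (hL.mem_verts_iff hm hvc).2 (Or.inl (List.mem_cons_of_mem _ hv)), hvc, rfl⟩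
  · rintro ⟨v, hv, hvc, rfl⟩
    rcases (hL.mem_verts_iff hm hvc).1 hv with h | h
    · rcases List.mem_cons.1 h with rfl | h
      · exact absurd ham hvc
      · exact ⟨v, h, hvc, rfl⟩
    · rcases List.mem_cons.1 h with h | h
      · exact absurd ham (hm.injective (h.trans ham.symm) ▸ hvc)
      · exact ⟨_, h, fun h => hvc (hm.injective h), by rw [hm, Sym2.eq_swap]⟩

/-- The alternating walk encoded by a list, from the mate of its first element to its last element. -/
lemma exists_walk_of_list (hF : F.IsMatching) {c : V} (l : List V) :
    ∀ y : V, (∀ v ∈ l, mate hF v ≠ v) → Simple (mate hF) (y :: (l ++ [c])) →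
    altEdges (mate hF) (y :: (l ++ [c])) ⊆ G.edgeSet →
    ∃ p : G.Walk (mate hF y) c, p.IsPath ∧ IsAlternating F p ∧ 0 < p.length ∧
      (∀ e ∈ p.edges.head?, e ∉ F.edgeSet) ∧
      (∀ w ∈ p.support, w = mate hF y ∨ ∃ v ∈ l ++ [c], w = v ∨ w = mate hF v) ∧
      {e | e ∈ p.edges} \ F.edgeSet = altEdges (mate hF) (y :: (l ++ [c])) := by
  have hm := mate_involutive hF
  have hnF : ∀ {x y : V}, x ≠ y → s(mate hF y, x) ∉ F.edgeSet := by
    intro x y hxy h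
    exact hxy (by rw [← ((mem_edgeSet_iff_mate hF).1 h).1, hm])
  induction l with
  | nil =>
    intro y _ hs hE
    have hcy := (simple_cons.1 hs).1 c (by simp)
    have hadj : G.Adj (mate hF y) c := by
      rw [← SimpleGraph.mem_edgeSet, Sym2.eq_swap]; exact hE (Set.mem_insert _ _)
    refine ⟨SimpleGraph.Walk.cons hadj SimpleGraph.Walk.nil, ?_, ?_, by simp, ?_, ?_, ?_⟩
    · simp [SimpleGraph.Walk.cons_isPath_iff, hcy.2.symm]
    · simp [IsAlternating]
    · simpa using hnF hcy.1
    · simp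
    · ext e
      simp only [SimpleGraph.Walk.edges_cons, SimpleGraph.Walk.edges_nil, List.mem_singleton,
        Set.mem_sdiff, Set.mem_ofPred_eq, List.nil_append, altEdges_cons_cons, altEdges_singleton,
        Set.mem_insert_iff, Set.mem_empty_iff_false, or_false]
      constructor
      · rintro ⟨rfl, -⟩; exact Sym2.eq_swap
      · rintro rfl; exact ⟨Sym2.eq_swap, by rw [Sym2.eq_swap]; exact hnF hcy.1⟩
  | cons x l ih =>
    intro y hl hs hE
    have hs' := simple_cons.1 hs
    have hxy := hs'.1 x (by simp)
    rw [List.cons_append, altEdges_cons_cons, Set.insert_subset_iff] at hE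
    have hxcov := hl x (by simp)
    obtain ⟨q, h₁, h₂, h₃, h₄, h₅, h₆⟩ := ih x (fun v hv => hl v (List.mem_cons_of_mem _ hv))
      hs'.2 hE.2
    have hadj : G.Adj (mate hF y) x := by
      rw [← SimpleGraph.mem_edgeSet, Sym2.eq_swap]; exact hE.1
    have hFx : F.Adj x (mate hF x) := (adj_iff_mate hF).2 ⟨rfl, hxcov.symm⟩
    have hxq : x ∉ q.support := by
      intro h
      rcases h₅ x h with h | ⟨v, hv, h⟩
      · exact hxcov h.symm
      · have hxv := (simple_cons.1 hs'.2).1 v hv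
        rcases h with h | h
        · exact hxv.1 h.symm
        · exact hxv.2 (by rw [h, hm])
    have hyq : mate hF y ∉ q.support := by
      intro h
      rcases h₅ _ h with h | ⟨v, hv, h⟩
      · exact hxy.1 (hm.injective h).symm
      · have hyv := hs'.1 v (List.mem_cons_of_mem _ hv)
        rcases h with h | h
        · exact hyv.2 h.symm
        · exact hyv.1 (hm.injective h).symm
    refine ⟨SimpleGraph.Walk.cons hadj (SimpleGraph.Walk.cons hFx.adj_sub q), ?_, ?_, by simp, ?_,
      ?_, ?_⟩
    · simp only [SimpleGraph.Walk.cons_isPath_iff, SimpleGraph.Walk.support_cons, List.mem_cons,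
        not_or]
      exact ⟨⟨h₁, hxq⟩, hxy.2.symm, hyq⟩
    · unfold IsAlternating at h₂ ⊢
      rw [SimpleGraph.Walk.edges_cons, SimpleGraph.Walk.edges_cons, List.isChain_cons_cons,
        List.isChain_cons]
      exact ⟨iff_of_false (hnF hxy.1) (not_not.2 hFx), fun e he => iff_of_true hFx (h₄ e he), h₂⟩
    · simpa using hnF hxy.1
    · intro w hw
      rw [SimpleGraph.Walk.support_cons, List.mem_cons, SimpleGraph.Walk.support_cons,
        List.mem_cons] at hw
      rcases hw with rfl | rfl | hw
      · exact Or.inl rfl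
      · exact Or.inr ⟨w, by simp, Or.inl rfl⟩
      · rcases h₅ w hw with rfl | ⟨v, hv, h⟩
        · exact Or.inr ⟨x, by simp, Or.inr rfl⟩
        · exact Or.inr ⟨v, List.mem_cons_of_mem _ hv, h⟩
    · ext e
      have h₆ := Set.ext_iff.1 h₆ e
      rw [List.cons_append, altEdges_cons_cons, Set.mem_insert_iff, ← h₆]
      simp only [SimpleGraph.Walk.edges_cons, List.mem_cons, Set.mem_sdiff, Set.mem_ofPred_eq]
      constructor
      · rintro ⟨rfl | rfl | h, h'⟩
        · exact Or.inl Sym2.eq_swap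
        · exact absurd hFx h'
        · exact Or.inr ⟨h, h'⟩
      · rintro (rfl | ⟨h, h'⟩)
        · exact ⟨Or.inl Sym2.eq_swap, by rw [Sym2.eq_swap]; exact hnF hxy.1⟩
        · exact ⟨Or.inr (Or.inr h), h'⟩

lemma exists_isAAP_of_isAug (hF : F.IsMatching) {L : List V} (hL : IsAug (mate hF) L)
    (hE : altEdges (mate hF) L ⊆ G.edgeSet) :
    ∃ S, IsAAP F S ∧ S \ F.edgeSet = altEdges (mate hF) L := by
  obtain ⟨hs, b, l, c, rfl, hb, hc, hl⟩ := hL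
  obtain ⟨p, h₁, h₂, h₃, -, -, h₆⟩ := exists_walk_of_list hF l b hl hs hE
  refine ⟨_, ⟨_, _, p, h₁, h₃, h₂, ?_, ?_, rfl⟩, h₆⟩
  · rw [hb]; exact fun h => (mate_ne_iff hF).2 h hb
  · exact fun h => (mate_ne_iff hF).2 h hc

lemma noRainbow_of_not_isRainbowAAP (hF : F.IsMatching) {ι : Type*} {P : ι → Set (Sym2 V)}
    (hP : ∀ i, IsAAP F (P i)) (hR : ¬ ∃ S, IsRainbowAAP F P S) (J : Finset ι) :
    NoRainbow (mate hF) (fun i => P i \ F.edgeSet) J := by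
  rintro K - x hx ⟨L, hL, hE⟩
  obtain ⟨S, hS, hSE⟩ := exists_isAAP_of_isAug hF hL (hE.trans (by
    rintro _ ⟨i, hi, rfl⟩
    exact (exists_list_of_isAAP hF (hP i)).1 (hx i hi).1))
  -- only the colours of the edges on the path are kept
  refine hR ⟨S, hS, {i | i ∈ K ∧ x i ∈ S \ F.edgeSet}, fun i => x i, fun i => (hx i i.2.1).1, ?_⟩
  ext e
  constructor
  · rintro ⟨i, rfl⟩; exact i.2.2
  · intro he
    obtain ⟨i, hi, rfl⟩ := hE (hSE ▸ he)
    exact ⟨⟨i, hi, he⟩, rfl⟩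

end Matching

/-! ### Origamistrips from lists -/

section Strips

variable {V : Type*} {m : V → V}

lemma mem_altEdges_iff {L : List V} {e : Sym2 V} :
    e ∈ altEdges m L ↔ ∃ (t : ℕ) (h : t + 1 < L.length), e = s(L[t + 1], m L[t]) := by
  induction L with
  | nil => simp
  | cons y L ih =>
    cases L with
    | nil => simp
    | cons x L =>
      rw [altEdges_cons_cons, Set.mem_insert_iff, ih]
      constructor
      · rintro (rfl | ⟨t, h, rfl⟩)
        · exact ⟨0, by simp, rfl⟩
        · exact ⟨t + 1, by simpa using h, rfl⟩
      · rintro ⟨t, h, rfl⟩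
        cases t with
        | zero => exact Or.inl rfl
        | succ t => exact Or.inr ⟨t, by simpa using h, rfl⟩

lemma mem_verts_image (hm : Function.Involutive m) {C : Set (Sym2 V)} {v : V} :
    v ∈ verts (Sym2.map m '' C) ↔ m v ∈ verts C := by
  constructor
  · rintro ⟨_, ⟨e, he, rfl⟩, hv⟩
    obtain ⟨w, hw, rfl⟩ := Sym2.mem_map.1 hv
    exact ⟨e, he, by rwa [hm]⟩
  · rintro ⟨e, he, hv⟩
    exact ⟨_, ⟨e, he, rfl⟩, Sym2.mem_map.2 ⟨_, hv, hm v⟩⟩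

lemma IsAug.mate_mem_verts (hm : Function.Involutive m) {L : List V} (hL : IsAug m L) {v : V}
    (hv : m v ≠ v) : m v ∈ verts (altEdges m L) ↔ v ∈ verts (altEdges m L) := by
  rw [hL.mem_verts_iff hm hv, hL.mem_verts_iff hm (fun h => hv (hm.injective h)), hm, or_comm]

lemma matchEdges_image (hm : Function.Involutive m) (C : Set (Sym2 V)) :
    matchEdges m (Sym2.map m '' C) = matchEdges m C := by
  have key : ∀ C : Set (Sym2 V), matchEdges m (Sym2.map m '' C) ⊆ matchEdges m C := by
    rintro C e ⟨v, hv, hvc, rfl⟩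
    exact ⟨m v, (mem_verts_image hm).1 hv, fun h => hvc (hm.injective h),
      by rw [hm, Sym2.eq_swap]⟩
  refine (key C).antisymm ?_
  nth_rw 1 [← image_image_mate hm C]
  exact key _

lemma matchEdges_altEdges (hm : Function.Involutive m) {b c : V} {l : List V}
    (hL : IsAug m (b :: (l ++ [c]))) (hb : m b = b) (hc : m c = c) (hl : ∀ v ∈ l, m v ≠ v) :
    matchEdges m (altEdges m (b :: (l ++ [c]))) = {e | ∃ v ∈ l, e = s(v, m v)} := by
  have hmem : ∀ v, m v ≠ v → v ∈ b :: (l ++ [c]) → v ∈ l := by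
    intro v hv hvl
    rcases List.mem_cons.1 hvl with rfl | h
    · exact absurd hb hv
    · rcases List.mem_append.1 h with h | h
      · exact h
      · rw [List.mem_singleton] at h; subst h; exact absurd hc hv
  ext e
  constructor
  · rintro ⟨v, hv, hvc, rfl⟩
    rcases (hL.mem_verts_iff hm hvc).1 hv with h | h
    · exact ⟨v, hmem v hvc h, rfl⟩
    · exact ⟨m v, hmem _ (fun h => hvc (hm.injective h)) h, by rw [hm, Sym2.eq_swap]⟩
  · rintro ⟨v, hv, rfl⟩
    exact ⟨v, (hL.mem_verts_iff hm (hl v hv)).2 (Or.inl (by simp [hv])), hl v hv, rfl⟩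

/-- The origamistrip on an augmenting path and its companion: the vertices `u i` are the covered
vertices of the list, and the vertices `v i` are their mates. -/
def stripOfList (hm : Function.Involutive m) (b c : V) (l : List V)
    (hs : Simple m (b :: (l ++ [c]))) (hb : m b = b) (hc : m c = c) (hl : ∀ v ∈ l, m v ≠ v) :
    Origamistrip V l.length where
  u := fun i => l[i]
  v := fun i => m l[i]
  x := b
  y := c
  u_injective := by
    have hnd : l.Nodup := by
      have : Simple m l := (simple_cons.1 hs).2.of_append_left
      exact this.imp fun h => h.1.symm
    intro i j h
    exact Fin.ext ((hnd.getElem_inj_iff).1 h)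
  v_injective := by
    have hnd : l.Nodup := by
      have : Simple m l := (simple_cons.1 hs).2.of_append_left
      exact this.imp fun h => h.1.symm
    intro i j h
    exact Fin.ext ((hnd.getElem_inj_iff).1 (hm.injective h))
  u_ne_v := by
    have := nodup_append_map hm (simple_cons.1 hs).2.of_append_left hl
    intro i j h
    exact (List.nodup_append.1 this).2.2 _ (List.getElem_mem i.2) _
      (List.mem_map_of_mem (List.getElem_mem j.2)) h
  x_ne_y := ((simple_cons.1 hs).1 c (by simp)).1.symm
  x_ne_u := by rintro i rfl; exact hl _ (List.getElem_mem i.2) hb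
  x_ne_v := by rintro i rfl; exact hl _ (List.getElem_mem i.2) (hm.injective hb)
  y_ne_u := by rintro i rfl; exact hl _ (List.getElem_mem i.2) hc
  y_ne_v := by rintro i rfl; exact hl _ (List.getElem_mem i.2) (hm.injective hc)

variable (hm : Function.Involutive m) {b c : V} {l : List V} (hs : Simple m (b :: (l ++ [c])))
  (hb : m b = b) (hc : m c = c) (hl : ∀ v ∈ l, m v ≠ v)

lemma matchingA_stripOfList (hne : l ≠ []) :
    (stripOfList hm b c l hs hb hc hl).matchingA = altEdges m (b :: (l ++ [c])) := by
  have hpos := List.length_pos_of_ne_nil hne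
  ext e
  rw [mem_altEdges_iff]
  simp only [Origamistrip.matchingA, stripOfList, Set.mem_ofPred_eq]
  constructor
  · rintro (⟨i, hi, rfl⟩ | ⟨i, j, hij, rfl⟩ | ⟨i, hi, rfl⟩)
    · refine ⟨0, by simp, ?_⟩
      have : i = ⟨0, hpos⟩ := Fin.ext hi
      subst this
      simp [hb, List.getElem_append_left, hpos]
    · obtain ⟨j, hj⟩ := j
      obtain rfl : j = i + 1 := hij
      refine ⟨i + 1, by simp, ?_⟩
      simp only [List.getElem_cons_succ, Fin.getElem_fin]
      rw [List.getElem_append_left (by omega), List.getElem_append_left i.2, Sym2.eq_swap]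
    · have hi' := i.2
      refine ⟨i + 1, by simp, ?_⟩
      simp only [List.getElem_cons_succ, Fin.getElem_fin]
      rw [List.getElem_append_right (by omega), List.getElem_append_left i.2, Sym2.eq_swap]
      simp
  · rintro ⟨t, ht, rfl⟩
    simp only [List.length_cons, List.length_append, List.length_nil] at ht
    cases t with
    | zero =>
      refine Or.inl ⟨⟨0, hpos⟩, rfl, ?_⟩
      simp only [List.getElem_cons_succ, List.getElem_cons_zero, Fin.getElem_fin]
      rw [List.getElem_append_left hpos, hb, Sym2.eq_swap]
    | succ t =>
      right
      by_cases htl : t + 1 < l.length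
      · refine Or.inl ⟨⟨t, by omega⟩, ⟨t + 1, htl⟩, rfl, ?_⟩
        simp only [List.getElem_cons_succ, Fin.getElem_fin]
        rw [List.getElem_append_left htl, List.getElem_append_left (by omega), Sym2.eq_swap]
      · refine Or.inr ⟨⟨t, by omega⟩, by simp only; omega, ?_⟩
        simp only [List.getElem_cons_succ, Fin.getElem_fin]
        rw [List.getElem_append_right (by omega), List.getElem_append_left (by omega),
          Sym2.eq_swap]
        simp

lemma matchingB_stripOfList :
    (stripOfList hm b c l hs hb hc hl).matchingB =
      Sym2.map m '' (stripOfList hm b c l hs hb hc hl).matchingA := by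
  ext e
  simp only [Origamistrip.matchingB, Origamistrip.matchingA, stripOfList, Set.mem_ofPred_eq,
    Set.mem_image]
  constructor
  · rintro (⟨i, hi, rfl⟩ | ⟨i, j, hij, rfl⟩ | ⟨i, hi, rfl⟩)
    · exact ⟨_, Or.inl ⟨i, hi, rfl⟩, by simp [hb]⟩
    · exact ⟨_, Or.inr (Or.inl ⟨i, j, hij, rfl⟩), by simp [hm _]⟩
    · exact ⟨_, Or.inr (Or.inr ⟨i, hi, rfl⟩), by simp [hm _, hc]⟩
  · rintro ⟨_, ⟨i, hi, rfl⟩ | ⟨i, j, hij, rfl⟩ | ⟨i, hi, rfl⟩, rfl⟩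
    · exact Or.inl ⟨i, hi, by simp [hb]⟩
    · exact Or.inr (Or.inl ⟨i, j, hij, by simp [hm _]⟩)
    · exact Or.inr (Or.inr ⟨i, hi, by simp [hm _, hc]⟩)

lemma skeleton_stripOfList :
    (stripOfList hm b c l hs hb hc hl).skeleton =
      matchEdges m (altEdges m (b :: (l ++ [c]))) := by
  rw [matchEdges_altEdges hm ⟨hs, b, l, c, rfl, hb, hc, hl⟩ hb hc hl]
  ext e
  simp only [Origamistrip.skeleton, stripOfList, Set.mem_ofPred_eq]
  constructor
  · rintro ⟨i, rfl⟩; exact ⟨_, List.getElem_mem i.2, rfl⟩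
  · rintro ⟨v, hv, rfl⟩
    obtain ⟨i, hi, rfl⟩ := List.getElem_of_mem hv
    exact ⟨⟨i, hi⟩, rfl⟩

lemma mem_interior_stripOfList {v : V} (hv : v ∈ (stripOfList hm b c l hs hb hc hl).interior) :
    m v ≠ v ∧ v ∈ verts (altEdges m (b :: (l ++ [c]))) := by
  have hL : IsAug m (b :: (l ++ [c])) := ⟨hs, b, l, c, rfl, hb, hc, hl⟩
  rcases hv with ⟨i, rfl⟩ | ⟨i, rfl⟩
  · have hi : l[i] ∈ l := List.getElem_mem i.2
    exact ⟨hl _ hi, (hL.mem_verts_iff hm (hl _ hi)).2 (Or.inl (by simp))⟩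
  · have hi : l[i] ∈ l := List.getElem_mem i.2
    have hc := hl _ hi
    exact ⟨fun h => hc (hm.injective h), (hL.mate_mem_verts hm hc).2
      ((hL.mem_verts_iff hm hc).2 (Or.inl (by simp)))⟩

end Strips

/-! ### The badge of a tight family -/

section Badge

variable {V ι : Type*}

/-- A badge in the combinatorial sense is a badge. The multigraph has one edge for each pair of a path
and its companion, and its weight is the number of occurrences of either. -/
theorem IsBadgeFamily.isBadge [Fintype ι] {m : V → V} (hm : Function.Involutive m)
    {C P : ι → Set (Sym2 V)} (h : IsBadgeFamily m C Finset.univ)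
    (hP : ∀ i, P i = C i ∪ matchEdges m (C i)) {k : ℕ} (hk : Fintype.card ι = 2 * k)
    {M : Set (Sym2 V)} (hM : M = {e | ∃ v, m v ≠ v ∧ e = s(v, m v)}) : IsBadge k M P := by
  classical
  have hex : ∀ i, ∃ b c l, Simple m (b :: (l ++ [c])) ∧ m b = b ∧ m c = c ∧ (∀ v ∈ l, m v ≠ v) ∧
      C i = altEdges m (b :: (l ++ [c])) := by
    intro i
    obtain ⟨L, ⟨hs, b, l, c, rfl, hb, hc, hl⟩, hC⟩ := h.aug i (Finset.mem_univ i)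
    exact ⟨b, c, l, hs, hb, hc, hl, hC⟩
  choose b c l hs hb hc hl hC using hex
  have hlen : ∀ i, (C i).ncard = (l i).length + 1 := by
    intro i
    rw [hC i, ncard_altEdges hm (hs i)]
    simp
  have hcount : ∀ i, {j | C j = C i}.ncard = (l i).length ∧
      {j | C j = Sym2.map m '' C i}.ncard = (l i).length := by
    intro i
    have h₁ := h.count i (Finset.mem_univ i)
    have h₂ := h.count_image i (Finset.mem_univ i)
    simp only [Finset.coe_univ, Set.mem_univ, true_and] at h₁ h₂
    have := hlen i
    omega
  have hpos : ∀ i, 0 < (l i).length := by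
    intro i
    rw [← (hcount i).1, Set.ncard_pos]
    exact ⟨i, rfl⟩
  have hne : ∀ i, C i ≠ Sym2.map m '' C i := by
    intro i
    have hL : IsAug m (b i :: (l i ++ [c i])) := ⟨hs i, _, _, _, rfl, hb i, hc i, hl i⟩
    have := hL.ne_image hm (by rw [← hC i, hlen i]; have := hpos i; omega)
    rwa [← hC i] at this
  -- the edges of the multigraph are the classes of paths that agree up to companions
  let S : Setoid ι :=
    { r := fun i j => C j = C i ∨ C j = Sym2.map m '' C i
      iseqv := by
        refine ⟨fun i => Or.inl rfl, ?_, ?_⟩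
        · rintro i j (h | h)
          · exact Or.inl h.symm
          · exact Or.inr (by rw [h, image_image_mate hm])
        · rintro i j k (h | h) (h' | h')
          · exact Or.inl (h'.trans h)
          · exact Or.inr (by rw [h', h])
          · exact Or.inr (by rw [h', h])
          · exact Or.inl (by rw [h', h, image_image_mate hm]) }
  let n := Fintype.card (Quotient S)
  let q : Quotient S ≃ Fin n := Fintype.equivFin _
  let rep : Fin n → ι := fun e => (q.symm e).out
  let cls : ι → Fin n := fun i => q ⟦i⟧
  have hcls : ∀ i e, cls i = e ↔ C i = C (rep e) ∨ C i = Sym2.map m '' C (rep e) := by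
    intro i e
    have : cls i = e ↔ (⟦i⟧ : Quotient S) = ⟦rep e⟧ := by
      rw [Quotient.out_eq]
      exact ⟨fun h => by rw [← h]; simp [cls], fun h => by simp [cls, h]⟩
    rw [this, eq_comm, Quotient.eq]
    rfl
  have hrep : ∀ i, C i = C (rep (cls i)) ∨ C i = Sym2.map m '' C (rep (cls i)) := fun i =>
    (hcls i _).1 rfl
  let B : Badge V :=
    { E := Fin n
      fintypeE := inferInstance
      w := fun e => (l (rep e)).length
      w_pos := fun e => hpos _
      strip := fun e => stripOfList hm (b (rep e)) (c (rep e)) (l (rep e)) (hs _) (hb _) (hc _)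
        (hl _)
      interior_disjoint := by
        intro e e' hee'
        rw [Set.disjoint_left]
        intro v hv hv'
        obtain ⟨h₁, h₂⟩ := mem_interior_stripOfList hm (hs _) (hb _) (hc _) (hl _) hv
        obtain ⟨-, h₃⟩ := mem_interior_stripOfList hm (hs _) (hb _) (hc _) (hl _) hv'
        rw [← hC] at h₂ h₃
        have hself : ∀ e, cls (rep e) = e := fun e => (hcls _ e).2 (Or.inl rfl)
        rcases h.disj (rep e) (Finset.mem_univ _) (rep e') (Finset.mem_univ _) with h | h | h
        · exact hee' (((hcls _ e).2 (Or.inl h)).symm.trans (hself e'))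
        · exact hee' (((hcls _ e).2 (Or.inr h)).symm.trans (hself e'))
        · exact h v h₁ h₂ h₃
      x_notMem_interior := fun e e' h =>
        (mem_interior_stripOfList hm (hs _) (hb _) (hc _) (hl _) h).1 (hb _)
      y_notMem_interior := fun e e' h =>
        (mem_interior_stripOfList hm (hs _) (hb _) (hc _) (hl _) h).1 (hc _) }
  have hpath : ∀ j : B.Index, B.path j =
      (if j.2.1 = true then C (rep j.1) else Sym2.map m '' C (rep j.1)) ∪
        matchEdges m (C (rep j.1)) := by
    rintro ⟨e, t, s⟩
    have hne : l (rep e) ≠ [] := List.ne_nil_of_length_pos (hpos _)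
    cases t
    · change (stripOfList hm (b (rep e)) (c (rep e)) (l (rep e)) (hs _) (hb _) (hc _) (hl _)).matchingB ∪
        (stripOfList hm (b (rep e)) (c (rep e)) (l (rep e)) (hs _) (hb _) (hc _) (hl _)).skeleton = _
      rw [matchingB_stripOfList, matchingA_stripOfList hm (hs _) (hb _) (hc _) (hl _) hne, skeleton_stripOfList, ← hC]
      simp
    · change (stripOfList hm (b (rep e)) (c (rep e)) (l (rep e)) (hs _) (hb _) (hc _) (hl _)).matchingA ∪
        (stripOfList hm (b (rep e)) (c (rep e)) (l (rep e)) (hs _) (hb _) (hc _) (hl _)).skeleton = _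
      rw [matchingA_stripOfList hm (hs _) (hb _) (hc _) (hl _) hne, skeleton_stripOfList, ← hC]
      simp
  -- each colour is sent to its strip and its side of the strip; the fibres have the right size
  let f : ι → Fin n × Bool := fun i => (cls i, decide (C i = C (rep (cls i))))
  have hf : ∀ e t i, f i = (e, t) ↔ C i = if t = true then C (rep e) else
      Sym2.map m '' C (rep e) := by
    intro e t i
    have hr := hne (rep e)
    simp only [f, Prod.mk.injEq]
    constructor
    · rintro ⟨rfl, rfl⟩
      by_cases hi : C i = C (rep (cls i))
      · simp [hi]
      · simpa [hi] using (hrep i).resolve_left hi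
    · intro hi
      have he : cls i = e := (hcls i e).2 (by cases t <;> simp_all)
      refine ⟨he, ?_⟩
      rw [he]
      cases t
      · simp only [Bool.false_eq_true, if_false] at hi
        rw [hi]
        simpa using hr.symm
      · simpa using hi
  have hfib : ∀ y : Fin n × Bool, Nonempty ({i // f i = y} ≃ Fin (l (rep y.1)).length) := by
    rintro ⟨e, t⟩
    refine ⟨Fintype.equivFinOfCardEq ?_⟩
    rw [← Nat.card_eq_fintype_card]
    change Set.ncard {i | f i = (e, t)} = _
    have : {i | f i = (e, t)} = {i | C i = if t = true then C (rep e) else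
        Sym2.map m '' C (rep e)} := by
      ext i; exact hf e t i
    rw [this]
    cases t
    · simpa using (hcount (rep e)).2
    · simpa using (hcount (rep e)).1
  let g := fun y => (hfib y).some
  let σ₀ : (Σ y : Fin n × Bool, Fin (l (rep y.1)).length) ≃ B.Index :=
    { toFun := fun z => ⟨z.1.1, z.1.2, z.2⟩
      invFun := fun z => ⟨(z.1, z.2.1), z.2.2⟩
      left_inv := fun _ => rfl
      right_inv := fun _ => rfl }
  let σ : ι ≃ B.Index :=
    ((Equiv.sigmaFiberEquiv f).symm.trans (Equiv.sigmaCongrRight g)).trans σ₀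
  refine ⟨B, ?_, ?_, σ, ?_⟩
  · have h₁ : Fintype.card (Σ y : Fin n × Bool, Fin (l (rep y.1)).length) = 2 * k := by
      rw [← hk]
      exact Fintype.card_congr ((Equiv.sigmaFiberEquiv f).symm.trans
        (Equiv.sigmaCongrRight g)).symm
    rw [Fintype.card_sigma, Fintype.sum_prod_type] at h₁
    simp only [Fintype.card_fin, Fintype.sum_bool] at h₁
    rw [Finset.sum_add_distrib] at h₁
    have h₂ : B.weight = ∑ e : Fin n, (l (rep e)).length := rfl
    omega
  · have hsk : B.skeleton = ⋃ e : Fin n, matchEdges m (C (rep e)) := by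
      refine Set.iUnion_congr fun e => ?_
      rw [hC]
      exact skeleton_stripOfList hm (hs _) (hb _) (hc _) (hl _)
    rw [hsk, hM]
    ext e
    rw [Set.mem_iUnion]
    constructor
    · rintro ⟨t, v, -, hv, rfl⟩
      exact ⟨v, hv, rfl⟩
    · rintro ⟨v, hv, rfl⟩
      obtain ⟨i, -, hi⟩ := h.cover v hv
      have : s(v, m v) ∈ matchEdges m (C i) := ⟨v, hi, hv, rfl⟩
      refine ⟨cls i, ?_⟩
      rcases hrep i with h | h
      · rwa [← h]
      · rwa [h, matchEdges_image hm] at this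
  · intro i
    rw [hpath, hP]
    change _ = (if (f i).2 = true then C (rep (f i).1) else Sym2.map m '' C (rep (f i).1)) ∪
      matchEdges m (C (rep (f i).1))
    have h₁ := (hf (f i).1 (f i).2 i).1 rfl
    rw [← h₁]
    congr 1
    rcases hrep i with h | h
    · rw [h]
    · rw [h, matchEdges_image hm]

end Badge

end RainbowBadge

theorem mainTheorem2 {V ι : Type*} (G : SimpleGraph V) (k : ℕ) (F : G.Subgraph)
    (hF : F.IsMatching) (hk : F.edgeSet.encard = k)
    (P : ι → Set (Sym2 V)) (hP : ∀ i, RainbowBadge.IsAAP F (P i))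
    (hR : ¬ ∃ S : Set (Sym2 V), RainbowBadge.IsRainbowAAP F P S) :
    ENat.card ι ≤ 2 * k ∧
      (ENat.card ι = 2 * k → RainbowBadge.IsBadge k F.edgeSet P) := by
  open RainbowBadge in
  have hm := mate_involutive hF
  obtain ⟨hW, hWk⟩ := ncard_covered hF hk
  have hlist := fun i => (exists_list_of_isAAP hF (hP i)).2
  have hnoR := noRainbow_of_not_isRainbowAAP hF hP hR
  have hle : ∀ J : Finset ι, J.card ≤ 2 * k := by
    intro J
    rw [← hWk]
    refine (hnoR J).card_le hm hW fun i _ => ?_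
    obtain ⟨L, hL, hE, -⟩ := hlist i
    exact ⟨L, hL, hE.ge⟩
  have hfin : Finite ι := by
    by_contra hinf
    rw [not_finite_iff_infinite] at hinf
    obtain ⟨J, hJ⟩ := Infinite.exists_subset_card_eq ι (2 * k + 1)
    have := hle J
    omega
  have := Fintype.ofFinite ι
  rw [ENat.card_eq_coe_fintype_card]
  refine ⟨by exact_mod_cast hle Finset.univ, fun hcard => ?_⟩
  have hcard : Fintype.card ι = 2 * k := by exact_mod_cast hcard
  have hbadge := isBadgeFamily_of_noRainbow hm hW (hnoR Finset.univ) (fun i _ => by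
    obtain ⟨L, hL, hE, -⟩ := hlist i
    exact ⟨L, hL, hE⟩) (by rw [hWk, ← hcard, Finset.card_univ])
  refine hbadge.isBadge hm (fun i => ?_) hcard ?_
  · obtain ⟨L, hL, hE, hS⟩ := hlist i
    rwa [← hE] at hS
  · ext e
    induction e with
    | _ x y =>
      constructor
      · intro h
        obtain ⟨rfl, hne⟩ := (mem_edgeSet_iff_mate hF).1 h
        exact ⟨x, hne.symm, rfl⟩
      · rintro ⟨v, hv, h⟩
        rw [h]
        exact (mem_edgeSet_iff_mate hF).2 ⟨rfl, hv.symm⟩
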